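/- **Setting.** Let $d\in\{1,2,3\}$, $m=d+2$, $\gamma>1$, $s_0\in\mathbb R$, $t_f>0$. For $u=(\rho,\rho V,\rho E)\in\mathbb R^m$ let $p=(\gamma-1)(\rho E-\rho\|V\|^2/2)$, $X_u=\{\rho>0,\ p>0\}$, let $F(u)$ be the $m\times d$ Euler flux with rows $\rho V_j$, $\rho V_iV_j+\delta_{ij}p$, $V_j(\rho E+p)$, let $s=\log(p/\rho^\gamma)-s_0$, $H(u)=-\rho s$, and let $$v(u)=(\gamma-1)\Big(\tfrac{-s}{\gamma-1}+\tfrac{\gamma+1}{\gamma-1}-\tfrac{\rho E}{p},\ \tfrac{\rho V}{p},\ -\tfrac{\rho}{p}\Big)$$ be the entropy variables, with inverse $u(v)$ on $X_v=v(X_u)$. For a unit vector $n$ put $A_n=(\partial F/\partial u)\cdot n$, $\tilde A_0=\partial u/\partial v$, $\tilde A_n=A_n\tilde A_0$ and $|\tilde A_n|_{\tilde A_0}=\tilde A_0\,|\tilde A_0^{-1}\tilde A_n|$, where $|P\,\mathrm{diag}(\lambda_i)P^{-1}|=P\,\mathrm{diag}(|\lambda_i|)P^{-1}$. Let $\tilde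 v(\theta;v_1,v_2)=v_1+\theta(v_2-v_1)$, $\theta\in[0,1]$. **Mesh and spaces.** Let $\Omega\subset\mathbb R^d$ be a bounded, open, connected periodic domain, i.e. a fundamental domain of a group $\Lambda$ of translations. Let $\mathcal T_h$ be a finite partition of $\Omega$ into non-singular curved elements $K=\psi_K(K_{ref})$, with $\psi_K$ a polynomial map that is injective with invertible derivative on the convex polytope $K_{ref}$. Modulo $\Lambda$ every face $F$ has exactly two sides, and is parametrized by $\phi_F:F_{ref}\to F$, which on each side is (up to a translation in $\Lambda$) the composition of the mapping $\psi_K$ of the adjacent element with an affine embedding of the convex polytope $F_{ref}$ into $\partial K_{ref}$; the images of these embeddings tile $\partial K_{ref}$ for each $K$. For $k\ge0$ let $\mathcal V_h^k$ be the space of $w$ such that $w|_K\circ\psi_K$ is an $\mathbb R^m$-valued polynomial of degree at most $k$ for every $K$. For a subset $\mathcal E_h^E$ of the set of faces $\mathcal E_h$ let $\mathcal M_h^k$ be the space of functions $\mu$ on the faces such that $\mu|_F\circ\phi_F$ is an $\mathbb R^m$-valued polynomial of degree at most $k$ for every face $F$, and $\mu$ is (periodically) continuous on $\mathcal E_h^E$.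 **Scheme.** Let $v_h(t)\in\mathcal V_h^k$ ($0\le t\le t_f$), continuous in time on $[0,t_f]$ and differentiable on $(0,t_f)$, and $\hat v_h(t)\in\mathcal M_h^k$ ($0<t<t_f$) satisfy, for all $w\in\mathcal V_h^k$, $\mu\in\mathcal M_h^k$ and $t\in(0,t_f)$, $$\Big(\tfrac{\partial u(v_h)}{\partial t},w\Big)_{\mathcal T_h}-\big(F(v_h),\nabla w\big)_{\mathcal T_h}+\langle\hat f_h,w\rangle_{\partial\mathcal T_h}=0,\qquad \langle\hat f_h,\mu\rangle_{\partial\mathcal T_h}=0,$$ and $(v_h|_{t=0}-v(u_0),w)_{\mathcal T_h}=0$ for an initial condition $u_0$ with values in $X_u$ and $v(u_0)$ integrable. Here $$\hat f_h=\tfrac12\big(F(\hat v_h)+F(v_h)\big)\cdot n+\tfrac12\,\sigma(\hat v_h,v_h;n)\,(v_h-\hat v_h)$$ with $n$ the outward unit normal of the element, $F(v)=F(u(v))$, and $\hat f_h$ is assumed integrable on the faces. Each face is counted twice in $\partial\mathcal T_h$, once for each side. The numerical solution is assumed physical: $v_h$ takes values in $X_v$ on the closed elements, and $\hat v_h$ takes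 values in $X_v$ on the faces. **Claim.** Suppose that $\sigma$ is one of the following stabilization matrices: (i) the mean-value matrix $$\sigma_{MV}(v_1,v_2;n)=\int_0^1(1-\theta)\Big(\big|\tilde A_n(\tilde v(\theta;v_1,v_2))\big|_{\tilde A_0}+\big|\tilde A_n(\tilde v(\theta;v_2,v_1))\big|_{\tilde A_0}\Big)d\theta;$$ (ii) the symmetric variable matrix $|\tilde A_n(v_*)|_{\tilde A_0}$; (iii) the symmetric Lax–Friedrichs matrix $\lambda_{\max}(v_*)\,\tilde A_0(v_*)$, where $\lambda_{\max}$ is the largest modulus of an eigenvalue of $A_n$. In (ii) and (iii), $v_*=v_*(v_1,v_2;n)$ is any function such that for all $v_1,v_2\in X_v$ and all $\|n\|=1$ one has $v_*\in X_v$ and $$(v_2-v_1)^t\,\big|\tilde A_n(v_*)\big|_{\tilde A_0}(v_2-v_1)\ \ge\ \sup_{\theta\in[0,1]}(v_2-v_1)^t\,\big|\tilde A_n(\tilde v(\theta;v_1,v_2))\big|_{\tilde A_0}(v_2-v_1).$$ Then the scheme is entropy stable: $t\mapsto\int_{\mathcal T_h}H(u(v_h(t)))$ is differentiable on $(0,t_f)$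 with $$\frac{d}{dt}\int_{\mathcal T_h}H(u(v_h(t)))\le 0\qquad(0<t<t_f),$$ and, with $u^*=\frac1{|\Omega|}\int_{\mathcal T_h}u(v_h(0))\in X_u$, $$\int_{\mathcal T_h}H(u^*)\ \le\ \int_{\mathcal T_h}H(u(v_h(t)))\ \le\ \int_{\mathcal T_h}H(u(v_h(0)))\qquad(0\le t\le t_f).$$ -/

import Mathlib

open MeasureTheory Set

noncomputable section

namespace EulerHDG

/-! ### The compressible Euler equations and the entropy variables -/

/-- Physical space `ℝ^d` with its Euclidean structure. -/
abbrev Space (d : ℕ) := EuclideanSpace ℝ (Fin d)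

/-- Indices of the `m = d + 2` components: density, `d` momenta, total energy. -/
abbrev Comp (d : ℕ) := Unit ⊕ Fin d ⊕ Unit

/-- Vectors of `ℝ^m`, used both for conservation variables and for entropy variables. -/
abbrev State (d : ℕ) := Comp d → ℝ

variable {d : ℕ}

/-- First component (density `ρ`, for conservation variables). -/
def fstC (u : State d) : ℝ := u (Sum.inl ())

/-- Middle components (momentum `ρ V`, for conservation variables). -/
def midC (u : State d) (j : Fin d) : ℝ := u (Sum.inr (Sum.inl j))

/-- Last component (total energy `ρ E`, for conservation variables). -/
def lastC (u : State d) : ℝ := u (Sum.inr (Sum.inr ()))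

/-- The vector with given first, middle and last components. -/
def mkState (a : ℝ) (b : Fin d → ℝ) (c : ℝ) : State d :=
  Sum.elim (fun _ => a) (Sum.elim b (fun _ => c))

/-- Pressure of a calorically perfect gas, `p = (γ - 1) (ρE - ρ ‖V‖² / 2)`. -/
def pressure (γ : ℝ) (u : State d) : ℝ :=
  (γ - 1) * (lastC u - (∑ j, midC u j ^ 2) / (2 * fstC u))

/-- The set `X_u` of physical states: positive density and pressure. -/
def physStates (d : ℕ) (γ : ℝ) : Set (State d) :=
  {u | 0 < fstC u ∧ 0 < pressure γ u}

/-- The inviscid flux, an `m × d` matrix with rows `ρ V_j`, `ρ V_i V_j + δ_ij p`,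
`V_j (ρE + p)`. -/
def flux (γ : ℝ) (u : State d) : Matrix (Comp d) (Fin d) ℝ :=
  Matrix.of fun i j =>
    mkState (midC u j)
      (fun i' => midC u i' * midC u j / fstC u + if i' = j then pressure γ u else 0)
      (midC u j / fstC u * (lastC u + pressure γ u)) i

/-- Thermodynamic entropy `s = log (p / ρ^γ) - s₀`. -/
def thermoEntropy (γ s₀ : ℝ) (u : State d) : ℝ :=
  Real.log (pressure γ u / fstC u ^ γ) - s₀

/-- Generalized entropy `H = - ρ s`. -/
def entropy (γ s₀ : ℝ) (u : State d) : ℝ := -(fstC u * thermoEntropy γ s₀ u)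

/-- The entropy variables `v(u)`. -/
def entropyVar (γ s₀ : ℝ) (u : State d) : State d :=
  (γ - 1) • mkState
    (-thermoEntropy γ s₀ u / (γ - 1) + (γ + 1) / (γ - 1) - lastC u / pressure γ u)
    (fun j => midC u j / pressure γ u)
    (-(fstC u / pressure γ u))

/-- The set `X_v = v(X_u)` of physical states in entropy variables. -/
def physEntropyStates (d : ℕ) (γ s₀ : ℝ) : Set (State d) :=
  entropyVar γ s₀ '' physStates d γ

/-- Pressure as a function of the entropy variables. -/
def pressureOfEntropyVar (γ s₀ : ℝ) (v : State d) : ℝ :=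
  Real.exp (-((γ - fstC v + (∑ j, midC v j ^ 2) / (2 * lastC v)) + s₀
    + γ * Real.log (-lastC v / (γ - 1))) / (γ - 1))

/-- The inverse mapping `u(v)` of `v(u)` on `X_v`, in closed form
(see `consVar_entropyVar`). -/
def consVar (γ s₀ : ℝ) (v : State d) : State d :=
  let p := pressureOfEntropyVar γ s₀ v
  let ρ := p * (-lastC v / (γ - 1))
  mkState ρ (fun j => ρ * (-midC v j / lastC v))
    (p / (γ - 1) + ρ * (∑ j, (midC v j / lastC v) ^ 2) / 2)

/-- `u(v(u)) = u` for physical states. -/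
theorem consVar_entropyVar {γ : ℝ} (hγ : 1 < γ) (s₀ : ℝ) {u : State d}
    (hu : u ∈ physStates d γ) : consVar γ s₀ (entropyVar γ s₀ u) = u := by
  obtain ⟨hρ, hp⟩ := hu
  have hg : γ - 1 ≠ 0 := by linarith
  have hρ' := hρ.ne'
  have hp' := hp.ne'
  have e1 : fstC (entropyVar γ s₀ u) =
      -thermoEntropy γ s₀ u + (γ + 1) - (γ - 1) * lastC u / pressure γ u := by
    simp only [entropyVar, fstC, mkState, Pi.smul_apply, smul_eq_mul, Sum.elim_inl]
    field_simp
  have e2 : ∀ j, midC (entropyVar γ s₀ u) j = (γ - 1) * (midC u j / pressure γ u) := fun j => by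
    simp [entropyVar, midC, mkState]
  have e3 : lastC (entropyVar γ s₀ u) = -((γ - 1) * (fstC u / pressure γ u)) := by
    simp [entropyVar, lastC, mkState]
  have e4 : -lastC (entropyVar γ s₀ u) / (γ - 1) = fstC u / pressure γ u := by
    rw [e3]; field_simp
  have hE : lastC u = pressure γ u / (γ - 1) + (∑ j, midC u j ^ 2) / (2 * fstC u) := by
    unfold pressure; field_simp; ring
  have e5 : (∑ j, midC (entropyVar γ s₀ u) j ^ 2) =
      ((γ - 1) / pressure γ u) ^ 2 * ∑ j, midC u j ^ 2 := by
    rw [Finset.mul_sum]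
    refine Finset.sum_congr rfl fun j _ => ?_
    rw [e2]; ring
  have e6 : ∀ j, midC (entropyVar γ s₀ u) j / lastC (entropyVar γ s₀ u)
      = -(midC u j / fstC u) := fun j => by
    rw [e2, e3]; field_simp
  have hpr : pressureOfEntropyVar γ s₀ (entropyVar γ s₀ u) = pressure γ u := by
    have hth : thermoEntropy γ s₀ u
        = Real.log (pressure γ u) - γ * Real.log (fstC u) - s₀ := by
      rw [thermoEntropy, Real.log_div hp' (Real.rpow_pos_of_pos hρ γ).ne', Real.log_rpow hρ]
    have key : γ - fstC (entropyVar γ s₀ u)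
        + (∑ j, midC (entropyVar γ s₀ u) j ^ 2) / (2 * lastC (entropyVar γ s₀ u))
        = thermoEntropy γ s₀ u := by
      rw [e1, e3, e5]
      generalize thermoEntropy γ s₀ u = S
      generalize (∑ j, midC u j ^ 2) = Q at *
      generalize pressure γ u = P at *
      rw [hE]
      field_simp
      ring
    rw [pressureOfEntropyVar, key, e4, Real.log_div hρ' hp', hth]
    have : -(Real.log (pressure γ u) - γ * Real.log (fstC u) - s₀ + s₀
        + γ * (Real.log (fstC u) - Real.log (pressure γ u))) / (γ - 1)
        = Real.log (pressure γ u) := by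
      field_simp; ring
    rw [this, Real.exp_log hp]
  have hrho : pressure γ u * (fstC u / pressure γ u) = fstC u := by field_simp
  unfold consVar
  simp only [hpr, e4, hrho, e6, neg_div, neg_neg]
  funext i
  rcases i with _ | j | _
  · rfl
  · simp only [mkState, Sum.elim_inr, Sum.elim_inl]
    change fstC u * (midC u j / fstC u) = midC u j
    field_simp
  · simp only [mkState, Sum.elim_inr]
    change _ = lastC u
    rw [hE]
    have : ∑ j, (-(midC u j / fstC u)) ^ 2 = (∑ j, midC u j ^ 2) / fstC u ^ 2 := by
      rw [Finset.sum_div]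
      exact Finset.sum_congr rfl fun j _ => by rw [neg_sq, div_pow]
    rw [this]
    field_simp

/-! ### Jacobian matrices and stabilization matrices -/

/-- Square matrices of size `m`. -/
abbrev StateMat (d : ℕ) := Matrix (Comp d) (Comp d) ℝ

/-- Jacobian matrix of a map `ℝ^m → ℝ^m`. -/
def jacobian (f : State d → State d) (x : State d) : StateMat d :=
  LinearMap.toMatrix' (fderiv ℝ f x : State d →ₗ[ℝ] State d)

/-- The flux `F(u) · n` in the direction `n`. -/
def normalFlux (γ : ℝ) (n : Space d) (u : State d) : State d :=
  fun i => ∑ j, flux γ u i j * n j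

/-- `A_n = (∂F/∂u) · n` at the conservation state `u`. -/
def An (γ : ℝ) (n : Space d) (u : State d) : StateMat d :=
  jacobian (normalFlux γ n) u

/-- `Ã₀ = ∂u/∂v` at the entropy state `v`. -/
def A0t (γ s₀ : ℝ) (v : State d) : StateMat d := jacobian (consVar γ s₀) v

/-- `Ã_n = A_n Ã₀` at the entropy state `v`. -/
def Ant (γ s₀ : ℝ) (n : Space d) (v : State d) : StateMat d :=
  An γ n (consVar γ s₀ v) * A0t γ s₀ v

/-- `C` is the absolute value `P |D| P⁻¹` of the real-diagonalizable matrix `B = P D P⁻¹`. -/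
def IsMatAbs (B C : StateMat d) : Prop :=
  ∃ (P : StateMat d) (D : Comp d → ℝ), IsUnit P.det ∧
    B = P * Matrix.diagonal D * P⁻¹ ∧ C = P * Matrix.diagonal (fun i => |D i|) * P⁻¹

/-- The absolute value does not depend on the diagonalization. -/
theorem IsMatAbs.unique {B C C' : StateMat d} (h : IsMatAbs B C) (h' : IsMatAbs B C') :
    C = C' := by
  obtain ⟨P, D, hP, hB, hC⟩ := h
  obtain ⟨Q, E, hQ, hB', hC'⟩ := h'
  have hS : Q⁻¹ * P * Matrix.diagonal D = Matrix.diagonal E * (Q⁻¹ * P) := by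
    have h1 : P * Matrix.diagonal D = Q * Matrix.diagonal E * Q⁻¹ * P := by
      rw [← hB', hB, Matrix.mul_assoc _ P⁻¹ P, Matrix.nonsing_inv_mul _ hP, Matrix.mul_one]
    rw [Matrix.mul_assoc, h1]
    simp only [← Matrix.mul_assoc]
    rw [Matrix.nonsing_inv_mul _ hQ, Matrix.one_mul]
  have hS' : Q⁻¹ * P * Matrix.diagonal (fun i => |D i|)
      = Matrix.diagonal (fun i => |E i|) * (Q⁻¹ * P) := by
    ext i j
    have := congrFun (congrFun hS i) j
    rw [Matrix.mul_diagonal, Matrix.diagonal_mul] at this ⊢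
    generalize (Q⁻¹ * P) i j = x at *
    rcases eq_or_ne x 0 with rfl | hx
    · simp
    · have h2 : D j = E i := mul_left_cancel₀ hx (by rw [this, mul_comm])
      rw [h2, mul_comm]
  rw [hC, hC']
  have h3 : P * Matrix.diagonal (fun i => |D i|)
      = Q * Matrix.diagonal (fun i => |E i|) * Q⁻¹ * P := by
    have h4 : P * Matrix.diagonal (fun i => |D i|)
        = Q * (Q⁻¹ * P * Matrix.diagonal (fun i => |D i|)) := by
      simp only [← Matrix.mul_assoc]
      rw [Matrix.mul_nonsing_inv _ hQ, Matrix.one_mul]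
    rw [h4, hS']
    simp only [Matrix.mul_assoc]
  rw [h3, Matrix.mul_assoc _ P P⁻¹, Matrix.mul_nonsing_inv _ hP, Matrix.mul_one]

open Classical in
/-- The absolute value `|B|` of a real-diagonalizable matrix (and `0` for other matrices). -/
def matAbs (B : StateMat d) : StateMat d :=
  if h : ∃ C, IsMatAbs B C then h.choose else 0

/-- The generalized absolute value `|Ã_n|_{Ã₀} = Ã₀ |Ã₀⁻¹ Ã_n|` at the entropy state `v`. -/
def genAbs (γ s₀ : ℝ) (n : Space d) (v : State d) : StateMat d :=
  A0t γ s₀ v * matAbs ((A0t γ s₀ v)⁻¹ * Ant γ s₀ n v)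

/-- The quadratic form `zᵗ B z`. -/
def quadForm (B : StateMat d) (z : State d) : ℝ := z ⬝ᵥ B.mulVec z

/-- The segment `ṽ(θ; v₁, v₂) = v₁ + θ (v₂ - v₁)` in entropy-variable space. -/
def vPath (v₁ v₂ : State d) (θ : ℝ) : State d := v₁ + θ • (v₂ - v₁)

/-- Stabilization matrices `σ(v₁, v₂; n)`. -/
abbrev Stabilization (d : ℕ) := State d → State d → Space d → StateMat d

/-- The mean-value stabilization matrix (the matrix integral is taken entrywise). -/
def sigmaMV (γ s₀ : ℝ) : Stabilization d := fun v₁ v₂ n =>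
  Matrix.of fun i j => ∫ θ in (0 : ℝ)..1,
    (1 - θ) * (genAbs γ s₀ n (vPath v₁ v₂ θ) i j + genAbs γ s₀ n (vPath v₂ v₁ θ) i j)

/-- The symmetric variable stabilization matrix with intermediate state `vstar`. -/
def sigmaS (γ s₀ : ℝ) (vstar : State d → State d → Space d → State d) : Stabilization d :=
  fun v₁ v₂ n => genAbs γ s₀ n (vstar v₁ v₂ n)

/-- Largest modulus of an eigenvalue of `A_n` at the entropy state `v`. -/
def lambdaMax (γ s₀ : ℝ) (n : Space d) (v : State d) : ℝ :=
  sSup {r | ∃ μ : ℝ,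
    Module.End.HasEigenvalue (Matrix.toLin' (An γ n (consVar γ s₀ v))) μ ∧ r = |μ|}

/-- The symmetric Lax–Friedrichs stabilization matrix with intermediate state `vstar`. -/
def sigmaSLF (γ s₀ : ℝ) (vstar : State d → State d → Space d → State d) : Stabilization d :=
  fun v₁ v₂ n => lambdaMax γ s₀ n (vstar v₁ v₂ n) • A0t γ s₀ (vstar v₁ v₂ n)

/-- The condition on the intermediate state: for all physical `v₁, v₂` and unit `n`, `v_*` is
physical and `Δᵗ |Ã_n(v_*)| Δ ≥ sup_{θ ∈ [0,1]} Δᵗ |Ã_n(ṽ(θ; v₁, v₂))| Δ` for `Δ = v₂ - v₁`. -/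
def VStarCondition (γ s₀ : ℝ) (vstar : State d → State d → Space d → State d) : Prop :=
  ∀ v₁ ∈ physEntropyStates d γ s₀, ∀ v₂ ∈ physEntropyStates d γ s₀, ∀ n : Space d, ‖n‖ = 1 →
    vstar v₁ v₂ n ∈ physEntropyStates d γ s₀ ∧
    ∀ θ ∈ Icc (0 : ℝ) 1,
      quadForm (genAbs γ s₀ n (vPath v₁ v₂ θ)) (v₂ - v₁) ≤
        quadForm (genAbs γ s₀ n (vstar v₁ v₂ n)) (v₂ - v₁)

/-- The inviscid numerical flux
`f̂ = ½ (F(v̂) + F(v)) · n + ½ σ(v̂, v; n) (v - v̂)`. -/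
def numFlux (γ s₀ : ℝ) (σ : Stabilization d) (vhat v : State d) (n : Space d) : State d :=
  (1 / 2 : ℝ) • (normalFlux γ n (consVar γ s₀ vhat) + normalFlux γ n (consVar γ s₀ v))
    + (1 / 2 : ℝ) • (σ vhat v n).mulVec (v - vhat)

/-! ### Periodic domains, curved meshes and finite element spaces -/

/-- A periodic domain: a bounded open connected set `Ω` that is a fundamental domain for a group
`Λ` of translations of `ℝ^d`. -/
structure PeriodicDomain (d : ℕ) where
  Ω : Set (Space d)
  Λ : AddSubgroup (Space d)
  isOpen : IsOpen Ω
  isConnected : IsConnected Ω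
  isBounded : Bornology.IsBounded Ω
  translates_disjoint : ∀ l ∈ Λ, l ≠ 0 → Disjoint Ω ((fun x => x + l) '' Ω)
  translates_cover : ∀ x, ∃ l ∈ Λ, x + l ∈ closure Ω

/-- A finite mesh of a periodic domain by non-singular curved elements of degree `p`.

* `Kref`, `Fref` are the reference element and the reference face (convex polytopes).
* `map K` is the parametric mapping of the element `K`.
* After identification modulo `Λ` there is no boundary, so each mesh face `F` has two sides,
  indexed by `Bool`. Its side `b` lies on the element `side F b`, and `emb F b` is the affine map
  that places the reference face on the boundary of the reference element of `side F b`. The two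
  placements coincide in physical space up to the translation `shift F ∈ Λ`.
* The sides that lie on an element tile its boundary. One boundary facet of an element may consist
  of one or of several mesh faces.
* `refNormal F b` is the outward unit normal of the reference element on the side `b` of `F`. -/
structure PeriodicMesh (d p : ℕ) (Elem Face : Type*) extends PeriodicDomain d where
  Kref : Set (Space d)
  Kref_convex : Convex ℝ Kref
  Kref_compact : IsCompact Kref
  Kref_interior : (interior Kref).Nonempty
  Fref : Set (Space (d - 1))
  Fref_convex : Convex ℝ Fref
  Fref_compact : IsCompact Fref
  Fref_interior : (interior Fref).Nonempty
  map : Elem → Space d → Space d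
  map_poly : ∀ K i, ∃ P : MvPolynomial (Fin d) ℝ, P.totalDegree ≤ p ∧
    ∀ ξ, map K ξ i = MvPolynomial.eval (fun j => ξ j) P
  map_injOn : ∀ K, InjOn (map K) Kref
  map_nonsingular : ∀ K, ∀ ξ ∈ Kref, (fderiv ℝ (map K) ξ).det ≠ 0
  elem_subset : ∀ K, map K '' interior Kref ⊆ Ω
  elem_disjoint : ∀ K K', K ≠ K' → Disjoint (map K '' interior Kref) (map K' '' interior Kref)
  elem_cover : closure Ω = ⋃ K, map K '' Kref
  side : Face → Bool → Elem
  emb : Face → Bool → Space (d - 1) →ᵃ[ℝ] Space d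
  emb_injective : ∀ F b, Function.Injective (emb F b)
  shift : Face → Λ
  sides_glued : ∀ F, ∀ s ∈ Fref,
    map (side F true) (emb F true s) + (shift F : Space d) = map (side F false) (emb F false s)
  sides_ne : ∀ F, ¬ (side F true = side F false ∧ shift F = 0)
  boundary_cover : ∀ K,
    frontier Kref = ⋃ (F : Face) (b : Bool) (_ : side F b = K), emb F b '' Fref
  boundary_disjoint : ∀ F b F' b', side F b = side F' b' → (F, b) ≠ (F', b') →
    Disjoint (emb F b '' interior Fref) (emb F' b' '' interior Fref)
  refNormal : Face → Bool → Space d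
  refNormal_norm : ∀ F b, ‖refNormal F b‖ = 1
  refNormal_outward : ∀ F b, ∀ s ∈ Fref, ∀ η ∈ Kref,
    inner ℝ (refNormal F b) (η - emb F b s) ≤ 0

namespace PeriodicMesh

variable {p : ℕ} {Elem Face : Type*} (M : PeriodicMesh d p Elem Face)

/-- The (open) element `K` in physical space. -/
def elem (K : Elem) : Set (Space d) := M.map K '' interior M.Kref

/-- The closed element `K` in physical space. -/
def closedElem (K : Elem) : Set (Space d) := M.map K '' M.Kref

/-- The point with face coordinate `s`, on the boundary of the element at side `b` of `F`. -/
def sidePoint (F : Face) (b : Bool) (s : Space (d - 1)) : Space d :=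
  M.map (M.side F b) (M.emb F b s)

/-- The parametric mapping `φ_F` of the face `F`. -/
def facePoint (F : Face) (s : Space (d - 1)) : Space d := M.sidePoint F false s

/-- Surface area element `√(det (Dφ_Fᵗ Dφ_F))` of the parametrized face `F`. -/
def areaElement (F : Face) (s : Space (d - 1)) : ℝ :=
  Real.sqrt (Matrix.gram ℝ (fun a : Fin (d - 1) =>
    fderiv ℝ (M.facePoint F) s (EuclideanSpace.single a 1))).det

/-- Unit normal on side `b` of the face `F`, outward from the element on that side: the
normalization of `(Dψ_K)⁻ᵗ` applied to the reference normal. -/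
def normal (F : Face) (b : Bool) (s : Space (d - 1)) : Space d :=
  let w := ContinuousLinearMap.adjoint
    (ContinuousLinearMap.inverse (fderiv ℝ (M.map (M.side F b)) (M.emb F b s)))
    (M.refNormal F b)
  ‖w‖⁻¹ • w

/-- The integral over `∂𝒯_h` of a function given, on each side of each face, in terms of the
face coordinate. Every face is counted twice, once for each side. -/
def skeletonIntegral [Fintype Face] (g : Face → Bool → Space (d - 1) → ℝ) : ℝ :=
  ∑ F, ∑ b, ∫ s in M.Fref, g F b s * M.areaElement F s

/-- The integral over `𝒯_h` of an element-wise function. -/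
def meshIntegral [Fintype Elem] (g : Elem → Space d → ℝ) : ℝ :=
  ∑ K, ∫ x in M.elem K, g K x

/-- The space `𝓥_h^k`: on each (closed) element the pull-back to the reference element is a
polynomial of degree at most `k`. -/
def MemV (k : ℕ) (w : Elem → Space d → State d) : Prop :=
  ∀ K i, ∃ P : MvPolynomial (Fin d) ℝ, P.totalDegree ≤ k ∧
    ∀ ξ ∈ M.Kref, w K (M.map K ξ) i = MvPolynomial.eval (fun j => ξ j) P

/-- The space `𝓜_h^k`: polynomials of degree at most `k` in the face coordinate on each face,
continuous on the union of the faces in `EE`. Functions are given face by face; as faces are closed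
and finite in number, continuity on the union means that the values agree at common points, where
points that differ by a translation in `Λ` are identified. -/
def MemM (k : ℕ) (EE : Set Face) (μ : Face → Space d → State d) : Prop :=
  (∀ F i, ∃ P : MvPolynomial (Fin (d - 1)) ℝ, P.totalDegree ≤ k ∧
    ∀ s ∈ M.Fref, μ F (M.facePoint F s) i = MvPolynomial.eval (fun j => s j) P) ∧
  (∀ F ∈ EE, ∀ F' ∈ EE, ∀ s ∈ M.Fref, ∀ s' ∈ M.Fref,
    M.facePoint F s - M.facePoint F' s' ∈ M.Λ →
      μ F (M.facePoint F s) = μ F' (M.facePoint F' s'))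

/-- The numerical flux on side `b` of the face `F`. -/
def sideFlux (γ s₀ : ℝ) (σ : Stabilization d) (v : Elem → Space d → State d)
    (vhat : Face → Space d → State d) (F : Face) (b : Bool) (s : Space (d - 1)) : State d :=
  numFlux γ s₀ σ (vhat F (M.facePoint F s)) (v (M.side F b) (M.sidePoint F b s))
    (M.normal F b s)

/-- `(v_h, v̂_h)` solves the entropy-variable hybridized DG discretization of the unsteady Euler
equations with stabilization matrix `σ` and initial condition `u₀` on the time interval
`[0, tf]`. -/
structure IsSolution [Fintype Elem] [Fintype Face] (k : ℕ) (EE : Set Face) (γ s₀ tf : ℝ)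
    (σ : Stabilization d) (u₀ : Space d → State d)
    (vh : ℝ → Elem → Space d → State d) (vhat : ℝ → Face → Space d → State d) : Prop where
  mem_V : ∀ t ∈ Icc 0 tf, M.MemV k (vh t)
  mem_M : ∀ t ∈ Ioo 0 tf, M.MemM k EE (vhat t)
  continuousOn : ∀ K, ∀ x ∈ M.closedElem K, ContinuousOn (fun t => vh t K x) (Icc 0 tf)
  differentiableAt : ∀ K, ∀ x ∈ M.closedElem K, ∀ t ∈ Ioo 0 tf,
    DifferentiableAt ℝ (fun t => vh t K x) t
  flux_integrable : ∀ t ∈ Ioo 0 tf, ∀ F b,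
    IntegrableOn (fun s => M.areaElement F s • M.sideFlux γ s₀ σ (vh t) (vhat t) F b s) M.Fref
  euler : ∀ t ∈ Ioo 0 tf, ∀ w, M.MemV k w →
    M.meshIntegral (fun K x =>
        ∑ i, deriv (fun t' => consVar γ s₀ (vh t' K x) i) t * w K x i)
      - M.meshIntegral (fun K x => ∑ i, ∑ j,
          flux γ (consVar γ s₀ (vh t K x)) i j
            * fderiv ℝ (w K) x (EuclideanSpace.single j 1) i)
      + M.skeletonIntegral (fun F b s => ∑ i,
          M.sideFlux γ s₀ σ (vh t) (vhat t) F b s i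
            * w (M.side F b) (M.sidePoint F b s) i) = 0
  conservation : ∀ t ∈ Ioo 0 tf, ∀ μ, M.MemM k EE μ →
    M.skeletonIntegral (fun F b s => ∑ i,
      M.sideFlux γ s₀ σ (vh t) (vhat t) F b s i * μ F (M.facePoint F s) i) = 0
  initial_physical : ∀ x ∈ M.Ω, u₀ x ∈ physStates d γ
  initial_integrable : IntegrableOn (fun x => entropyVar γ s₀ (u₀ x)) M.Ω
  initial : ∀ w, M.MemV k w →
    M.meshIntegral (fun K x => ∑ i, (vh 0 K x i - entropyVar γ s₀ (u₀ x) i) * w K x i) = 0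

/-- The numerical solution is physical: density and pressure are pointwise positive (up to element
boundaries, and also for the trace unknown). -/
structure IsPhysical (γ s₀ tf : ℝ)
    (vh : ℝ → Elem → Space d → State d) (vhat : ℝ → Face → Space d → State d) : Prop where
  element : ∀ t ∈ Icc 0 tf, ∀ K, ∀ x ∈ M.closedElem K, vh t K x ∈ physEntropyStates d γ s₀
  trace : ∀ t ∈ Ioo 0 tf, ∀ F, ∀ s ∈ M.Fref,
    vhat t F (M.facePoint F s) ∈ physEntropyStates d γ s₀

/-- Total generalized entropy `∫_{𝒯_h} H(u(v))`. -/
def totalEntropy [Fintype Elem] (γ s₀ : ℝ) (v : Elem → Space d → State d) : ℝ :=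
  M.meshIntegral (fun K x => entropy γ s₀ (consVar γ s₀ (v K x)))

/-- The minimum total entropy state `u^*(v) = |Ω|⁻¹ ∫_{𝒯_h} u(v)`. -/
def uStar [Fintype Elem] (γ s₀ : ℝ) (v : Elem → Space d → State d) : State d :=
  fun i => (volume.real M.Ω)⁻¹ * M.meshIntegral (fun K x => consVar γ s₀ (v K x) i)

/-- Entropy stability: the total generalized entropy is non-increasing in time, and it is bounded
by its initial value and by the entropy of the minimum total entropy state. -/
structure IsEntropyStable [Fintype Elem] (γ s₀ tf : ℝ)
    (vh : ℝ → Elem → Space d → State d) : Prop where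
  integrable : ∀ t ∈ Icc 0 tf, ∀ K,
    IntegrableOn (fun x => consVar γ s₀ (vh t K x)) (M.elem K) ∧
    IntegrableOn (fun x => entropy γ s₀ (consVar γ s₀ (vh t K x))) (M.elem K)
  differentiable : ∀ t ∈ Ioo 0 tf,
    DifferentiableAt ℝ (fun t => M.totalEntropy γ s₀ (vh t)) t
  deriv_nonpos : ∀ t ∈ Ioo 0 tf, deriv (fun t => M.totalEntropy γ s₀ (vh t)) t ≤ 0
  uStar_physical : M.uStar γ s₀ (vh 0) ∈ physStates d γ
  lower_bound : ∀ t ∈ Icc 0 tf,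
    M.meshIntegral (fun _ _ => entropy γ s₀ (M.uStar γ s₀ (vh 0))) ≤ M.totalEntropy γ s₀ (vh t)
  upper_bound : ∀ t ∈ Icc 0 tf, M.totalEntropy γ s₀ (vh t) ≤ M.totalEntropy γ s₀ (vh 0)

end PeriodicMesh

end EulerHDG

end

open MeasureTheory Set

noncomputable section

namespace EulerHDG

variable {d : ℕ}

section

/-! ### Calculus in entropy variables -/

/-! In entropy variables the Euler system is built from potentials. The physical set is the open
half space where the last component is negative, so it is convex and the segment between two
physical states stays physical. On it `(γ - 1) ρ` has gradient `u`, and `(γ - 1) ρ V_j` has gradient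
`F_j` (`hasFDerivAt_density`, `hasFDerivAt_fluxPotential`). Hence `Ã₀` and `Ã_n` are Hessians, `Ã₀`
is positive definite, and the entropy `H = v · u - (γ - 1) ρ` is a Legendre transform, which gives
`∂ₜH = v · ∂ₜu` and the tangent plane inequality for `H`.

Write `ψ_n` for the potential of the normal flux. By `trapezoid_identity` the error of the
trapezoidal mean of `F_n` along a segment with increment `Δ` is an integral of `(θ - 1/2) Δᵗ Ã_n Δ`.
Since `|θ - 1/2| ≤ 1/2` and `|Δᵗ Ã_n Δ| ≤ Δᵗ |Ã_n| Δ`, any `σ` with `Δᵗ σ Δ ≥ ∫ Δᵗ |Ã_n| Δ dθ`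
yields `ψ_n(v) - ψ_n(v̂) ≤ f̂ · (v - v̂)`. This inequality, `IsDissipative`, is all that is needed
of the stabilization. The mean-value matrix satisfies the integral bound with equality, the
symmetric variable matrix by the condition on `v_*`, and the Lax–Friedrichs matrix because `λ_max
Ã₀` dominates `|Ã_n|`.

Testing the scheme with `w = v_h` and `μ = v̂_h` makes the time term equal to the rate of change of
the total entropy. The volume term is the divergence of the potential, so it becomes the integral of
`ψ_n(v_h)` over the element boundaries. The flux term equals the integral of `f̂ · (v_h - v̂_h)`,
which is at least the integral of `ψ_n(v_h) - ψ_n(v̂_h)`. The last potential cancels because the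
trace is single valued and the normals on the two sides of a face are opposite. The entropy rate is
therefore nonpositive.

The geometric input is a divergence theorem on curved elements. On the reference polytope it follows
from Fubini's theorem along lines parallel to the axes (`IsTiledBody.integral_fderiv_single`). It is
transported by the polynomial map with Piola's identity for the cofactors and Nanson's formula for
the surface element. Normals on the two sides are opposite because otherwise the two elements, up to
a translation of `Λ`, would overlap.

For the lower bound, constant test functions show that `∫ u(v_h)` does not change, so neither does
`u^*`. Integrating the tangent plane of `H` at `u^*` is then Jensen's inequality. Differentiation in
time is justified because polynomial states form a finite-dimensional space, where pointwise
differentiability gives differentiable coordinates. -/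

/-- The half space of vectors with negative last component. -/
def negLast (d : ℕ) : Set (State d) := {v | lastC v < 0}

theorem isOpen_negLast : IsOpen (negLast d) :=
  isOpen_lt (continuous_apply _) continuous_const

theorem convex_negLast : Convex ℝ (negLast d) := by
  intro x hx y hy a b ha hb hab
  simp only [negLast, lastC, mem_ofPred_eq, Pi.add_apply, Pi.smul_apply, smul_eq_mul] at *
  rcases ha.eq_or_lt with rfl | ha'
  · have : b = 1 := by linarith
    subst this; linarith
  · nlinarith [mul_neg_of_pos_of_neg ha' hx]

/-- The velocity as a function of the entropy variables. -/
def velocity (v : State d) (j : Fin d) : ℝ := -midC v j / lastC v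

/-- The exponent `(γ - 1) log ρ` as a function of the entropy variables. -/
def logDensity (γ s₀ : ℝ) (v : State d) : ℝ :=
  fstC v - (∑ j, midC v j ^ 2) / (2 * lastC v) - Real.log (-lastC v / (γ - 1)) - γ - s₀

/-- The gradient of `logDensity`. -/
def logDensityGrad (v : State d) : State d :=
  mkState 1 (velocity v) (-1 / lastC v + (∑ j, velocity v j ^ 2) / 2)

/-- The density as a function of the entropy variables. -/
def density (γ s₀ : ℝ) (v : State d) : ℝ := Real.exp (logDensity γ s₀ v / (γ - 1))

theorem density_pos (γ s₀ : ℝ) (v : State d) : 0 < density γ s₀ v := Real.exp_pos _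

theorem pressure_mul_eq_density {γ : ℝ} (hγ : 1 < γ) (s₀ : ℝ) {v : State d} (hv : v ∈ negLast d) :
    pressureOfEntropyVar γ s₀ v * (-lastC v / (γ - 1)) = density γ s₀ v := by
  have hg : γ - 1 ≠ 0 := by linarith
  have hτ : 0 < -lastC v / (γ - 1) := div_pos (neg_pos.2 hv) (by linarith)
  rw [pressureOfEntropyVar, density, ← Real.exp_log hτ, ← Real.exp_add, Real.log_exp,
    logDensity]
  congr 1
  field_simp
  ring

/-- `logDensity` is `(γ - 1) log ρ`, so this product is the gradient of `(γ - 1) ρ`. All later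
potential identities rest on this form. -/
theorem consVar_eq {γ : ℝ} (hγ : 1 < γ) (s₀ : ℝ) {v : State d} (hv : v ∈ negLast d) :
    consVar γ s₀ v = density γ s₀ v • logDensityGrad v := by
  have hg : γ - 1 ≠ 0 := by linarith
  have hl : lastC v ≠ 0 := ne_of_lt hv
  have hp : pressureOfEntropyVar γ s₀ v / (γ - 1) = density γ s₀ v * (-1 / lastC v) := by
    rw [← pressure_mul_eq_density hγ s₀ hv]
    field_simp
  simp only [consVar]
  rw [pressure_mul_eq_density hγ s₀ hv, hp]
  funext i
  rcases i with _ | j | _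
  · simp [mkState, logDensityGrad]
  · simp [mkState, logDensityGrad, velocity]
  · simp only [mkState, logDensityGrad, velocity, Sum.elim_inr, Pi.smul_apply, smul_eq_mul,
      neg_div, neg_sq]
    ring

theorem fstC_consVar {γ : ℝ} (hγ : 1 < γ) (s₀ : ℝ) {v : State d} (hv : v ∈ negLast d) :
    fstC (consVar γ s₀ v) = density γ s₀ v := by
  rw [consVar_eq hγ s₀ hv]; simp [fstC, logDensityGrad, mkState]

theorem midC_consVar {γ : ℝ} (hγ : 1 < γ) (s₀ : ℝ) {v : State d} (hv : v ∈ negLast d)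
    (j : Fin d) : midC (consVar γ s₀ v) j = density γ s₀ v * velocity v j := by
  rw [consVar_eq hγ s₀ hv]; simp [midC, logDensityGrad, mkState]

theorem lastC_consVar {γ : ℝ} (hγ : 1 < γ) (s₀ : ℝ) {v : State d} (hv : v ∈ negLast d) :
    lastC (consVar γ s₀ v)
      = density γ s₀ v * (-1 / lastC v + (∑ j, velocity v j ^ 2) / 2) := by
  rw [consVar_eq hγ s₀ hv]; simp [lastC, logDensityGrad, mkState]

theorem pressure_consVar {γ : ℝ} (hγ : 1 < γ) (s₀ : ℝ) {v : State d} (hv : v ∈ negLast d) :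
    pressure γ (consVar γ s₀ v) = density γ s₀ v * ((γ - 1) / -lastC v) := by
  have hρ := (density_pos γ s₀ v).ne'
  have hl : lastC v ≠ 0 := ne_of_lt hv
  rw [pressure, lastC_consVar hγ s₀ hv, fstC_consVar hγ s₀ hv]
  simp only [midC_consVar hγ s₀ hv, mul_pow, ← Finset.mul_sum]
  field_simp
  ring

theorem consVar_mem {γ : ℝ} (hγ : 1 < γ) (s₀ : ℝ) {v : State d} (hv : v ∈ negLast d) :
    consVar γ s₀ v ∈ physStates d γ := by
  constructor
  · rw [fstC_consVar hγ s₀ hv]; exact density_pos _ _ _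
  · rw [pressure_consVar hγ s₀ hv]
    exact mul_pos (density_pos _ _ _) (div_pos (by linarith) (neg_pos.2 hv))

theorem thermoEntropy_consVar {γ : ℝ} (hγ : 1 < γ) (s₀ : ℝ) {v : State d} (hv : v ∈ negLast d) :
    thermoEntropy γ s₀ (consVar γ s₀ v)
      = γ - fstC v + (∑ j, midC v j ^ 2) / (2 * lastC v) := by
  have hg : γ - 1 ≠ 0 := by linarith
  have hτ : 0 < (γ - 1) / -lastC v := div_pos (by linarith) (neg_pos.2 hv)
  have hρ := density_pos γ s₀ v
  have e : -lastC v / (γ - 1) = ((γ - 1) / -lastC v)⁻¹ := by rw [inv_div]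
  rw [thermoEntropy, pressure_consVar hγ s₀ hv, fstC_consVar hγ s₀ hv,
    Real.log_div (mul_pos hρ hτ).ne' (Real.rpow_pos_of_pos hρ γ).ne', Real.log_rpow hρ,
    Real.log_mul hρ.ne' hτ.ne', density, Real.log_exp, logDensity, e, Real.log_inv]
  field_simp
  ring

theorem entropyVar_consVar {γ : ℝ} (hγ : 1 < γ) (s₀ : ℝ) {v : State d} (hv : v ∈ negLast d) :
    entropyVar γ s₀ (consVar γ s₀ v) = v := by
  have hg : γ - 1 ≠ 0 := by linarith
  have hl : lastC v ≠ 0 := ne_of_lt hv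
  have hρ := (density_pos γ s₀ v).ne'
  have hs : ∑ j, velocity v j ^ 2 = (∑ j, midC v j ^ 2) / lastC v ^ 2 := by
    rw [Finset.sum_div]
    exact Finset.sum_congr rfl fun j _ => by rw [velocity, div_pow, neg_sq]
  rw [entropyVar, thermoEntropy_consVar hγ s₀ hv, pressure_consVar hγ s₀ hv,
    lastC_consVar hγ s₀ hv, fstC_consVar hγ s₀ hv, hs]
  simp only [midC_consVar hγ s₀ hv]
  funext i
  rcases i with _ | j | _
  · change (γ - 1) * _ = fstC v
    simp only [mkState, Sum.elim_inl]
    field_simp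
    ring
  · change (γ - 1) * _ = midC v j
    simp only [mkState, Sum.elim_inl, Sum.elim_inr, velocity]
    field_simp
  · change (γ - 1) * _ = lastC v
    simp only [mkState, Sum.elim_inr]
    field_simp

/-- The closed formula for `u(v)` is a two-sided inverse on the whole half space. Openness and
convexity of the physical set are read off from this description. -/
theorem physEntropyStates_eq {γ : ℝ} (hγ : 1 < γ) (s₀ : ℝ) :
    physEntropyStates d γ s₀ = negLast d := by
  ext v
  constructor
  · rintro ⟨u, ⟨hρ, hp⟩, rfl⟩
    change lastC (entropyVar γ s₀ u) < 0
    have : lastC (entropyVar γ s₀ u) = -((γ - 1) * (fstC u / pressure γ u)) := by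
      simp [entropyVar, lastC, mkState]
    rw [this, neg_lt_zero]
    exact mul_pos (by linarith) (div_pos hρ hp)
  · exact fun hv => ⟨_, consVar_mem hγ s₀ hv, entropyVar_consVar hγ s₀ hv⟩

theorem dotProduct_state (a b : State d) :
    a ⬝ᵥ b = fstC a * fstC b + ∑ j, midC a j * midC b j + lastC a * lastC b := by
  simp [dotProduct, fstC, midC, lastC, Fintype.sum_sum_type, add_assoc]

/-- `H(u(v)) = v · u(v) - (γ - 1) ρ(v)`. -/
theorem entropy_consVar {γ : ℝ} (hγ : 1 < γ) (s₀ : ℝ) {v : State d} (hv : v ∈ negLast d) :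
    entropy γ s₀ (consVar γ s₀ v) = v ⬝ᵥ consVar γ s₀ v - (γ - 1) * density γ s₀ v := by
  have hl : lastC v ≠ 0 := ne_of_lt hv
  have hs : ∑ j, velocity v j ^ 2 = (∑ j, midC v j ^ 2) / lastC v ^ 2 := by
    rw [Finset.sum_div]
    exact Finset.sum_congr rfl fun j _ => by rw [velocity, div_pow, neg_sq]
  have hs' : ∑ j, midC v j * (density γ s₀ v * velocity v j)
      = -(density γ s₀ v * (∑ j, midC v j ^ 2) / lastC v) := by
    rw [Finset.mul_sum, Finset.sum_div, ← Finset.sum_neg_distrib]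
    exact Finset.sum_congr rfl fun j _ => by rw [velocity]; ring
  rw [entropy, thermoEntropy_consVar hγ s₀ hv, dotProduct_state, fstC_consVar hγ s₀ hv,
    lastC_consVar hγ s₀ hv, hs]
  simp only [midC_consVar hγ s₀ hv]
  rw [hs']
  field_simp
  ring

/-! ### Derivatives of the density and of the conservation variables -/

/-- The first component as a continuous linear map. -/
def fstCL : State d →L[ℝ] ℝ := ContinuousLinearMap.proj (Sum.inl ())

/-- The middle components as continuous linear maps. -/
def midCL (j : Fin d) : State d →L[ℝ] ℝ := ContinuousLinearMap.proj (Sum.inr (Sum.inl j))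

/-- The last component as a continuous linear map. -/
def lastCL : State d →L[ℝ] ℝ := ContinuousLinearMap.proj (Sum.inr (Sum.inr ()))

@[simp] theorem fstCL_apply (v : State d) : fstCL v = fstC v := rfl
@[simp] theorem midCL_apply (j : Fin d) (v : State d) : midCL j v = midC v j := rfl
@[simp] theorem lastCL_apply (v : State d) : lastCL v = lastC v := rfl

theorem hasFDerivAt_fstC (v : State d) : HasFDerivAt fstC fstCL v := fstCL.hasFDerivAt
theorem hasFDerivAt_midC (j : Fin d) (v : State d) :
    HasFDerivAt (fun v => midC v j) (midCL j) v := (midCL j).hasFDerivAt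
theorem hasFDerivAt_lastC (v : State d) : HasFDerivAt lastC lastCL v := lastCL.hasFDerivAt

/-- The dot product with `u` as a continuous linear map. -/
def dotCL (u : State d) : State d →L[ℝ] ℝ :=
  LinearMap.toContinuousLinearMap (dotProductBilin ℝ ℝ u)

@[simp] theorem dotCL_apply (u z : State d) : dotCL u z = u ⬝ᵥ z := rfl

theorem hasFDerivAt_inv_lastC {v : State d} (hv : v ∈ negLast d) :
    HasFDerivAt (fun v => (lastC v)⁻¹) (-((lastC v ^ 2)⁻¹) • lastCL) v :=
  (hasDerivAt_inv (ne_of_lt hv)).comp_hasFDerivAt v (hasFDerivAt_lastC v)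

theorem hasFDerivAt_velocity {v : State d} (hv : v ∈ negLast d) (j : Fin d) :
    HasFDerivAt (fun v => velocity v j)
      ((-lastC v)⁻¹ • (midCL j + velocity v j • lastCL)) v := by
  have hl : lastC v ≠ 0 := ne_of_lt hv
  refine ((hasFDerivAt_midC j v).neg.mul (hasFDerivAt_inv_lastC hv)).congr_fderiv ?_
  ext z
  simp [velocity]
  field_simp
  ring

theorem hasFDerivAt_sum_velocity_sq {v : State d} (hv : v ∈ negLast d) :
    HasFDerivAt (fun v => ∑ j, velocity v j ^ 2)
      (∑ j, (2 * velocity v j) • ((-lastC v)⁻¹ • (midCL j + velocity v j • lastCL))) v := by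
  refine HasFDerivAt.fun_sum fun j _ => ?_
  refine ((hasFDerivAt_velocity hv j).pow 2).congr_fderiv ?_
  simp

theorem hasFDerivAt_logDensity {γ : ℝ} (hγ : 1 < γ) (s₀ : ℝ) {v : State d} (hv : v ∈ negLast d) :
    HasFDerivAt (logDensity γ s₀) (dotCL (logDensityGrad v)) v := by
  have hg : γ - 1 ≠ 0 := by linarith
  have hl : lastC v ≠ 0 := ne_of_lt hv
  have hτ : -lastC v / (γ - 1) ≠ 0 := div_ne_zero (neg_ne_zero.2 hl) hg
  have h1 : HasFDerivAt (fun v : State d => ∑ j, midC v j ^ 2)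
      (∑ j, (2 * midC v j) • midCL j) v := by
    refine HasFDerivAt.fun_sum fun j _ => ?_
    refine ((hasFDerivAt_midC j v).pow 2).congr_fderiv ?_
    simp
  have h2 := (h1.mul (hasFDerivAt_inv_lastC hv)).const_mul (1 / 2)
  have h3 := ((hasFDerivAt_lastC v).neg.mul_const (γ - 1)⁻¹).log
    (by rwa [div_eq_mul_inv] at hτ)
  have h4 := ((((hasFDerivAt_fstC v).sub h2).sub h3).sub_const γ).sub_const s₀
  refine (h4.congr_fderiv ?_).congr_of_eventuallyEq (Filter.Eventually.of_forall fun w => ?_)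
  · ext z
    have hs : ∑ j, velocity v j ^ 2 = (∑ j, midC v j ^ 2) / lastC v ^ 2 := by
      rw [Finset.sum_div]
      exact Finset.sum_congr rfl fun j _ => by rw [velocity, div_pow, neg_sq]
    have e1 : ∑ j, 2 * midC v j * midC z j = 2 * ∑ j, midC v j * midC z j := by
      rw [Finset.mul_sum]; exact Finset.sum_congr rfl fun j _ => by ring
    have e2 : ∑ j, velocity v j * midC z j = -(∑ j, midC v j * midC z j) / lastC v := by
      rw [← Finset.sum_neg_distrib, Finset.sum_div]
      exact Finset.sum_congr rfl fun j _ => by rw [velocity]; ring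
    rw [dotCL_apply, dotProduct_state]
    have f1 : fstC (logDensityGrad v) = 1 := rfl
    have f2 : ∀ j, midC (logDensityGrad v) j = velocity v j := fun _ => rfl
    have f3 : lastC (logDensityGrad v) = -1 / lastC v + (∑ j, velocity v j ^ 2) / 2 := rfl
    simp only [f1, f2, f3, e2, hs]
    simp [e1]
    field_simp
    ring
  · simp only [logDensity, Pi.mul_apply, Pi.sub_apply, Pi.neg_apply]
    rw [div_eq_mul_inv (-lastC w)]
    field_simp

/-- Chain rule for `exp (logDensity / (γ - 1))` together with `consVar_eq`: the scaled density is a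
potential of `u`. -/
theorem hasFDerivAt_density {γ : ℝ} (hγ : 1 < γ) (s₀ : ℝ) {v : State d} (hv : v ∈ negLast d) :
    HasFDerivAt (density γ s₀) ((γ - 1)⁻¹ • dotCL (consVar γ s₀ v)) v := by
  have := ((hasFDerivAt_logDensity hγ s₀ hv).mul_const (γ - 1)⁻¹).exp
  refine this.congr_fderiv ?_
  ext z
  rw [consVar_eq hγ s₀ hv]
  simp [density, div_eq_mul_inv]
  ring

theorem contDiffOn_logDensityGrad : ContDiffOn ℝ ⊤ (logDensityGrad (d := d)) (negLast d) := by
  have hl : ContDiffOn ℝ ⊤ (lastC (d := d)) (negLast d) := lastCL.contDiff.contDiffOn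
  have hv : ∀ j, ContDiffOn ℝ ⊤ (fun v : State d => velocity v j) (negLast d) := fun j =>
    (((midCL j).contDiff).contDiffOn.neg).div hl fun x hx => ne_of_lt hx
  refine contDiffOn_pi.2 fun i => ?_
  rcases i with _ | j | _
  · exact contDiffOn_const
  · exact hv j
  · exact (contDiffOn_const.div hl fun x hx => ne_of_lt hx).add
      ((ContDiffOn.sum fun j _ => (hv j).pow 2).div_const 2)

theorem contDiffOn_density {γ : ℝ} (hγ : 1 < γ) (s₀ : ℝ) :
    ContDiffOn ℝ ⊤ (density γ s₀ : State d → ℝ) (negLast d) := by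
  have hl : ContDiffOn ℝ ⊤ (lastC (d := d)) (negLast d) := lastCL.contDiff.contDiffOn
  refine ContDiffOn.exp (ContDiffOn.div_const ?_ _)
  refine ((((fstCL.contDiff.contDiffOn).sub ((ContDiffOn.sum fun j _ =>
    ((midCL j).contDiff.contDiffOn).pow 2).div (contDiffOn_const.mul hl) fun x hx =>
      mul_ne_zero two_ne_zero (ne_of_lt hx))).sub ?_).sub contDiffOn_const).sub contDiffOn_const
  exact (hl.neg.div_const _).log fun x hx => div_ne_zero (neg_ne_zero.2 (ne_of_lt hx)) (by linarith)

theorem contDiffOn_consVar {γ : ℝ} (hγ : 1 < γ) (s₀ : ℝ) :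
    ContDiffOn ℝ ⊤ (consVar γ s₀ : State d → State d) (negLast d) :=
  ((contDiffOn_density hγ s₀).smul contDiffOn_logDensityGrad).congr fun _ hv => consVar_eq hγ s₀ hv

/-- The derivative of `logDensityGrad`. -/
def logDensityHess (v : State d) : State d →L[ℝ] State d :=
  ContinuousLinearMap.pi (Sum.elim (fun _ => 0) (Sum.elim
    (fun j => (-lastC v)⁻¹ • (midCL j + velocity v j • lastCL))
    (fun _ => (lastC v ^ 2)⁻¹ • lastCL
      + ∑ j, velocity v j • ((-lastC v)⁻¹ • (midCL j + velocity v j • lastCL)))))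

theorem hasFDerivAt_logDensityGrad {v : State d} (hv : v ∈ negLast d) :
    HasFDerivAt logDensityGrad (logDensityHess v) v := by
  refine hasFDerivAt_pi.2 fun i => ?_
  rcases i with _ | j | _
  · exact hasFDerivAt_const _ _
  · exact hasFDerivAt_velocity hv j
  · refine (((hasFDerivAt_inv_lastC hv).const_mul (-1)).add
      ((hasFDerivAt_sum_velocity_sq hv).mul_const 2⁻¹)).congr_fderiv ?_
    ext z
    simp [Finset.mul_sum]
    refine Finset.sum_congr rfl fun j _ => ?_
    ring

theorem hasFDerivAt_consVar {γ : ℝ} (hγ : 1 < γ) (s₀ : ℝ) {v : State d} (hv : v ∈ negLast d) :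
    HasFDerivAt (consVar γ s₀) (density γ s₀ v • logDensityHess v +
      ((γ - 1)⁻¹ • dotCL (consVar γ s₀ v)).smulRight (logDensityGrad v)) v :=
  ((hasFDerivAt_density hγ s₀ hv).smul (hasFDerivAt_logDensityGrad hv)).congr_of_eventuallyEq
    (Filter.eventually_of_mem (isOpen_negLast.mem_nhds hv) fun _ hw => consVar_eq hγ s₀ hw)

/-- The Hessian of the exponential of `logDensity` is a rank-one term plus the Hessian of
`logDensity`, which splits into squares weighted by the positive numbers `1 / -lastC v` and `1 /
lastC v ^ 2`. Both symmetry and positivity of `Ã₀` are visible in this form. -/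
theorem dotProduct_fderiv_consVar {γ : ℝ} (hγ : 1 < γ) (s₀ : ℝ) {v : State d}
    (hv : v ∈ negLast d) (w z : State d) :
    w ⬝ᵥ fderiv ℝ (consVar γ s₀) v z = density γ s₀ v *
      ((logDensityGrad v ⬝ᵥ w) * (logDensityGrad v ⬝ᵥ z) / (γ - 1)
        + ∑ j, (midC w j + velocity v j * lastC w) * (midC z j + velocity v j * lastC z) / -lastC v
        + lastC w * lastC z / lastC v ^ 2) := by
  have hg : γ - 1 ≠ 0 := by linarith
  have hl : lastC v ≠ 0 := ne_of_lt hv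
  have f1 : fstC (logDensityHess v z) = 0 := rfl
  have f2 : ∀ j, midC (logDensityHess v z) j
      = (-lastC v)⁻¹ * (midC z j + velocity v j * lastC z) := fun _ => rfl
  have f3 : lastC (logDensityHess v z) = (lastC v ^ 2)⁻¹ * lastC z
      + ∑ j, velocity v j * ((-lastC v)⁻¹ * (midC z j + velocity v j * lastC z)) := by
    simp only [lastC, logDensityHess, lastCL, midC, midCL, ContinuousLinearMap.coe_pi',
      Sum.elim_inr, add_apply, smul_apply, sum_apply, ContinuousLinearMap.proj_apply, smul_eq_mul]
  have hH : w ⬝ᵥ logDensityHess v z =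
      ∑ j, (midC w j + velocity v j * lastC w) * (midC z j + velocity v j * lastC z) / -lastC v
        + lastC w * lastC z / lastC v ^ 2 := by
    rw [dotProduct_state, f1, f3, mul_add, Finset.mul_sum, mul_zero, zero_add, add_left_comm,
      ← Finset.sum_add_distrib, add_comm]
    congr 1
    · refine Finset.sum_congr rfl fun j _ => ?_
      rw [f2]; ring
    · ring
  rw [(hasFDerivAt_consVar hγ s₀ hv).fderiv]
  simp only [add_apply, smul_apply, smul_eq_mul,
    ContinuousLinearMap.smulRight_apply, dotProduct_add, dotProduct_smul, hH, dotCL_apply]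
  rw [consVar_eq hγ s₀ hv, smul_dotProduct, dotProduct_comm w, smul_eq_mul]
  generalize ∑ j, (midC w j + velocity v j * lastC w) * (midC z j + velocity v j * lastC z)
    / -lastC v = S
  field_simp
  ring

/-- The quadratic form of `Ã₀` is positive definite. -/
theorem dotProduct_fderiv_consVar_pos {γ : ℝ} (hγ : 1 < γ) (s₀ : ℝ) {v : State d}
    (hv : v ∈ negLast d) {z : State d} (hz : z ≠ 0) :
    0 < z ⬝ᵥ fderiv ℝ (consVar γ s₀) v z := by
  have hg : 0 < γ - 1 := by linarith
  have hl : 0 < -lastC v := neg_pos.2 hv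
  rw [dotProduct_fderiv_consVar hγ s₀ hv]
  refine mul_pos (density_pos _ _ _) ?_
  have h1 : 0 ≤ (logDensityGrad v ⬝ᵥ z) * (logDensityGrad v ⬝ᵥ z) / (γ - 1) :=
    div_nonneg (mul_self_nonneg _) hg.le
  have h2' : ∀ j ∈ Finset.univ, 0 ≤
      (midC z j + velocity v j * lastC z) * (midC z j + velocity v j * lastC z) / -lastC v :=
    fun j _ => div_nonneg (mul_self_nonneg _) hl.le
  have h2 := Finset.sum_nonneg h2'
  have h3 : 0 ≤ lastC z * lastC z / lastC v ^ 2 := div_nonneg (mul_self_nonneg _) (sq_nonneg _)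
  -- If the sum of squares vanishes, the system is triangular: the last component is zero, then the
  -- middle ones, then the first.
  refine lt_of_le_of_ne (by positivity) fun h => hz ?_
  have e3 : lastC z = 0 := by
    have : lastC z * lastC z / lastC v ^ 2 = 0 := by linarith
    rcases div_eq_zero_iff.1 this with h | h
    · exact mul_self_eq_zero.1 h
    · exact absurd h (pow_ne_zero 2 (by linarith))
  have e2 : ∀ j, midC z j = 0 := fun j => by
    have := (Finset.sum_eq_zero_iff_of_nonneg h2').1 (by linarith) j (Finset.mem_univ j)
    rcases div_eq_zero_iff.1 this with h | h
    · simpa [e3] using h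
    · exact absurd h hl.ne'
  have e1 : fstC z = 0 := by
    have : (logDensityGrad v ⬝ᵥ z) * (logDensityGrad v ⬝ᵥ z) / (γ - 1) = 0 := by linarith
    rcases div_eq_zero_iff.1 this with h | h
    · have h := mul_self_eq_zero.1 h
      rw [dotProduct_state] at h
      simpa [e2, e3, fstC, logDensityGrad, mkState] using h
    · exact absurd h hg.ne'
  funext i
  rcases i with _ | j | _
  · exact e1
  · exact e2 j
  · exact e3

/-! ### Potentials of the flux and symmetry of `Ã_n` -/

/-- The potential `(γ - 1) ρ V_j` of the flux in direction `j`. -/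
def fluxPotential (γ s₀ : ℝ) (j : Fin d) (v : State d) : ℝ :=
  (γ - 1) * (density γ s₀ v * velocity v j)

/-- Product rule for `ρ V_j`. The derivative of `ρ` produces the convective part `V_j u`, and the
derivative of `V_j` produces the pressure terms, since `p = (γ - 1) ρ / -lastC v`. -/
theorem hasFDerivAt_fluxPotential {γ : ℝ} (hγ : 1 < γ) (s₀ : ℝ) {v : State d}
    (hv : v ∈ negLast d) (j : Fin d) :
    HasFDerivAt (fluxPotential γ s₀ j) (dotCL fun i => flux γ (consVar γ s₀ v) i j) v := by
  have hg : γ - 1 ≠ 0 := by linarith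
  have hl : lastC v ≠ 0 := ne_of_lt hv
  have hρ := (density_pos γ s₀ v).ne'
  refine (((hasFDerivAt_density hγ s₀ hv).mul (hasFDerivAt_velocity hv j)).const_mul
    (γ - 1)).congr_fderiv ?_
  ext z
  set u := consVar γ s₀ v with hu
  have g2 : ∀ i, midC (fun i => flux γ u i j) i
      = midC u i * midC u j / fstC u + if i = j then pressure γ u else 0 := fun _ => rfl
  have e : ∑ i, midC (fun i => flux γ u i j) i * midC z i
      = midC u j / fstC u * ∑ i, midC u i * midC z i + pressure γ u * midC z j := by
    simp only [g2, add_mul, Finset.sum_add_distrib, ite_mul, zero_mul, Finset.sum_ite_eq',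
      Finset.mem_univ, if_true, Finset.mul_sum]
    congr 1
    exact Finset.sum_congr rfl fun i _ => by ring
  have g1 : fstC (fun i => flux γ u i j) = midC u j := rfl
  have g3 : lastC (fun i => flux γ u i j) = midC u j / fstC u * (lastC u + pressure γ u) := rfl
  rw [dotCL_apply, dotProduct_state, e, g1, g3]
  simp only [add_apply, smul_apply, smul_eq_mul,
    dotCL_apply, midCL_apply, lastCL_apply, dotProduct_state u z]
  rw [hu, pressure_consVar hγ s₀ hv, fstC_consVar hγ s₀ hv, midC_consVar hγ s₀ hv, ← hu]
  field_simp
  ring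

/-- The potential of the normal flux. -/
def normalPotential (γ s₀ : ℝ) (n : Space d) (v : State d) : ℝ :=
  ∑ j, fluxPotential γ s₀ j v * n j

theorem hasFDerivAt_normalPotential {γ : ℝ} (hγ : 1 < γ) (s₀ : ℝ) {v : State d}
    (hv : v ∈ negLast d) (n : Space d) :
    HasFDerivAt (normalPotential γ s₀ n) (dotCL (normalFlux γ n (consVar γ s₀ v))) v := by
  refine (HasFDerivAt.fun_sum fun j _ =>
    (hasFDerivAt_fluxPotential hγ s₀ hv j).mul_const (n j)).congr_fderiv ?_
  ext z
  simp only [sum_apply, smul_apply, smul_eq_mul,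
    dotCL_apply, normalFlux, dotProduct, Finset.mul_sum, Finset.sum_mul]
  rw [Finset.sum_comm]
  exact Finset.sum_congr rfl fun i _ => Finset.sum_congr rfl fun j _ => by ring

theorem contDiffOn_normalFlux (γ : ℝ) (n : Space d) :
    ContDiffOn ℝ ⊤ (normalFlux γ n) {u | 0 < fstC u} := by
  have h1 : ContDiffOn ℝ ⊤ (fstC (d := d)) {u | 0 < fstC u} := fstCL.contDiff.contDiffOn
  have h2 : ∀ j, ContDiffOn ℝ ⊤ (fun u : State d => midC u j) {u | 0 < fstC u} :=
    fun j => (midCL j).contDiff.contDiffOn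
  have h3 : ContDiffOn ℝ ⊤ (lastC (d := d)) {u | 0 < fstC u} := lastCL.contDiff.contDiffOn
  have hp : ContDiffOn ℝ ⊤ (pressure (d := d) γ) {u | 0 < fstC u} :=
    contDiffOn_const.mul (h3.sub ((ContDiffOn.sum fun j _ => (h2 j).pow 2).div
      (contDiffOn_const.mul h1) fun x hx => mul_ne_zero two_ne_zero (ne_of_gt hx)))
  refine contDiffOn_pi.2 fun i => ContDiffOn.sum fun j _ => ContDiffOn.mul ?_ contDiffOn_const
  rcases i with _ | i | _
  · exact h2 j
  · refine (((h2 i).mul (h2 j)).div h1 fun x hx => ne_of_gt hx).add ?_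
    split_ifs
    · exact hp
    · exact contDiffOn_const
  · exact ((h2 j).div h1 fun x hx => ne_of_gt hx).mul (h3.add hp)

theorem contDiffOn_normalFlux_consVar {γ : ℝ} (hγ : 1 < γ) (s₀ : ℝ) (n : Space d) :
    ContDiffOn ℝ ⊤ (fun v => normalFlux γ n (consVar γ s₀ v)) (negLast d) :=
  (contDiffOn_normalFlux γ n).comp (contDiffOn_consVar hγ s₀)
    fun _ hv => (consVar_mem hγ s₀ hv).1

theorem jacobian_mulVec (f : State d → State d) (x z : State d) :
    (jacobian f x).mulVec z = fderiv ℝ f x z := by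
  rw [jacobian, LinearMap.toMatrix'_mulVec]; rfl

theorem Ant_eq {γ : ℝ} (hγ : 1 < γ) (s₀ : ℝ) {v : State d} (hv : v ∈ negLast d) (n : Space d) :
    Ant γ s₀ n v = jacobian (fun v => normalFlux γ n (consVar γ s₀ v)) v := by
  have h1 : DifferentiableAt ℝ (normalFlux γ n) (consVar γ s₀ v) :=
    ((contDiffOn_normalFlux γ n).differentiableOn (by simp)).differentiableAt
      ((isOpen_lt continuous_const (continuous_apply _)).mem_nhds (consVar_mem hγ s₀ hv).1)
  have h2 : DifferentiableAt ℝ (consVar γ s₀) v := (hasFDerivAt_consVar hγ s₀ hv).differentiableAt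
  rw [Ant, An, A0t, jacobian, jacobian, jacobian, ← LinearMap.toMatrix'_comp]
  congr 1
  have := fderiv_comp v h1 h2
  rw [Function.comp_def] at this
  rw [this]; rfl

/-- `Ã_n` is the Hessian of `normalPotential`, and second derivatives commute. -/
theorem Ant_isSymm {γ : ℝ} (hγ : 1 < γ) (s₀ : ℝ) {v : State d} (hv : v ∈ negLast d)
    (n : Space d) (w z : State d) :
    w ⬝ᵥ (Ant γ s₀ n v).mulVec z = z ⬝ᵥ (Ant γ s₀ n v).mulVec w := by
  have h1 : DifferentiableAt ℝ (fun v => normalFlux γ n (consVar γ s₀ v)) v :=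
    ((contDiffOn_normalFlux_consVar hγ s₀ n).differentiableOn (by simp)).differentiableAt
      (isOpen_negLast.mem_nhds hv)
  have h2 := ((LinearMap.toContinuousLinearMap
    { toFun := dotCL, map_add' := fun a b => by ext; simp [add_dotProduct],
      map_smul' := fun a b => by ext; simp } :
      State d →L[ℝ] (State d →L[ℝ] ℝ)).hasFDerivAt.comp v h1.hasFDerivAt)
  have := second_derivative_symmetric_of_eventually
    (Filter.eventually_of_mem (isOpen_negLast.mem_nhds hv)
      fun w hw => hasFDerivAt_normalPotential hγ s₀ hw n) h2 z w
  simp only [ContinuousLinearMap.comp_apply, LinearMap.coe_toContinuousLinearMap',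
    LinearMap.coe_mk, AddHom.coe_mk, dotCL_apply] at this
  rw [Ant_eq hγ s₀ hv, jacobian_mulVec, jacobian_mulVec, dotProduct_comm, this, dotProduct_comm]

/-! ### Convexity of the entropy and concavity of the pressure -/

/-- `logDensity` is affine in the first component, plus a quadratic over a positive linear function,
minus a logarithm; each part is convex. The gap to the tangent plane is the sum of squares `hsq`
plus the gap in `log x ≤ x - 1`. -/
theorem logDensity_tangent_le {γ : ℝ} (hγ : 1 < γ) (s₀ : ℝ) {v b : State d} (hv : v ∈ negLast d)
    (hb : b ∈ negLast d) :
    logDensity γ s₀ v + logDensityGrad v ⬝ᵥ (b - v) ≤ logDensity γ s₀ b := by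
  have hg : 0 < γ - 1 := by linarith
  have hτ : 0 < -lastC v := neg_pos.2 hv
  have hσ : 0 < -lastC b := neg_pos.2 hb
  have hl : lastC v ≠ 0 := ne_of_lt hv
  have hl' : lastC b ≠ 0 := ne_of_lt hb
  have f1 : fstC (logDensityGrad v) = 1 := rfl
  have f2 : ∀ j, midC (logDensityGrad v) j = velocity v j := fun _ => rfl
  have f3 : lastC (logDensityGrad v) = -1 / lastC v + (∑ j, velocity v j ^ 2) / 2 := rfl
  have g1 : fstC (b - v) = fstC b - fstC v := rfl
  have g2 : ∀ j, midC (b - v) j = midC b j - midC v j := fun _ => rfl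
  have g3 : lastC (b - v) = lastC b - lastC v := rfl
  have hlog := Real.log_le_sub_one_of_pos (div_pos hσ hτ)
  rw [Real.log_div hσ.ne' hτ.ne', neg_div_neg_eq] at hlog
  have hsq : 0 ≤ ∑ j, (midC b j + lastC b * velocity v j) ^ 2 / (2 * -lastC b) :=
    Finset.sum_nonneg fun j _ => by positivity
  have hexp : ∑ j, (midC b j + lastC b * velocity v j) ^ 2 / (2 * -lastC b)
      = -(∑ j, midC b j ^ 2) / (2 * lastC b) + (∑ j, midC v j ^ 2) / (2 * lastC v)
        - ∑ j, velocity v j * (midC b j - midC v j)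
        - (∑ j, velocity v j ^ 2) / 2 * (lastC b - lastC v) := by
    rw [← Finset.sum_neg_distrib]
    simp only [Finset.sum_div, Finset.sum_mul]
    rw [← Finset.sum_add_distrib, ← Finset.sum_sub_distrib, ← Finset.sum_sub_distrib]
    refine Finset.sum_congr rfl fun j _ => ?_
    rw [velocity]
    field_simp
    ring
  rw [dotProduct_state, f1, f3, g1, g3]
  simp only [f2, g2]
  rw [logDensity, logDensity, Real.log_div hτ.ne' hg.ne', Real.log_div hσ.ne' hg.ne']
  have e : -1 / lastC v * (lastC b - lastC v) = -(lastC b / lastC v - 1) := by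
    field_simp
  rw [hexp, neg_div] at hsq
  rw [add_mul, e]
  linarith

/-- The convexity of the entropy, in the form of the tangent plane inequality. -/
theorem entropy_tangent_le {γ : ℝ} (hγ : 1 < γ) (s₀ : ℝ) {v b : State d} (hv : v ∈ negLast d)
    (hb : b ∈ negLast d) :
    entropy γ s₀ (consVar γ s₀ b) + b ⬝ᵥ (consVar γ s₀ v - consVar γ s₀ b)
      ≤ entropy γ s₀ (consVar γ s₀ v) := by
  have hg : 0 < γ - 1 := by linarith
  -- Under the Legendre transform the roles of the two points are exchanged: the tangent plane of
  -- `H` at `u(b)` corresponds to the tangent plane of `(γ - 1) ρ` at `v`, evaluated at `b`. The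
  -- latter comes from `exp x ≥ 1 + x` and the convexity of `logDensity`.
  rw [entropy_consVar hγ s₀ hb, entropy_consVar hγ s₀ hv, dotProduct_sub]
  have h1 := logDensity_tangent_le hγ s₀ hv hb
  have h2 := Real.add_one_le_exp ((logDensity γ s₀ b - logDensity γ s₀ v) / (γ - 1))
  have h3 : density γ s₀ b
      = density γ s₀ v * Real.exp ((logDensity γ s₀ b - logDensity γ s₀ v) / (γ - 1)) := by
    rw [density, density, ← Real.exp_add]; congr 1; ring
  have hρ := density_pos γ s₀ v
  have h4 : density γ s₀ v * ((logDensity γ s₀ b - logDensity γ s₀ v) / (γ - 1) + 1)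
      ≤ density γ s₀ b := by
    rw [h3]; exact mul_le_mul_of_nonneg_left h2 hρ.le
  have h5 : (γ - 1) * density γ s₀ v + density γ s₀ v * (logDensity γ s₀ b - logDensity γ s₀ v)
      ≤ (γ - 1) * density γ s₀ b := by
    refine le_trans (le_of_eq ?_) (mul_le_mul_of_nonneg_left h4 hg.le)
    field_simp
    ring
  have h6 : density γ s₀ v * (logDensityGrad v ⬝ᵥ (b - v))
      ≤ density γ s₀ v * (logDensity γ s₀ b - logDensity γ s₀ v) :=
    mul_le_mul_of_nonneg_left (by linarith) hρ.le
  have h7 : density γ s₀ v * (logDensityGrad v ⬝ᵥ (b - v))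
      = b ⬝ᵥ consVar γ s₀ v - v ⬝ᵥ consVar γ s₀ v := by
    rw [consVar_eq hγ s₀ hv, dotProduct_sub, dotProduct_smul, dotProduct_smul,
      dotProduct_comm b, dotProduct_comm v, smul_eq_mul, smul_eq_mul, mul_sub]
  linarith

/-- The pressure lies below its tangent planes. -/
theorem pressure_le_tangent {γ : ℝ} (hγ : 1 < γ) {u : State d} (hu : 0 < fstC u) {a : State d}
    (ha : 0 < fstC a) :
    pressure γ u ≤ (γ - 1) * (lastC u - ∑ j, midC a j / fstC a * midC u j
      + (∑ j, (midC a j / fstC a) ^ 2) / 2 * fstC u) := by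
  refine mul_le_mul_of_nonneg_left ?_ (by linarith)
  have h : 0 ≤ ∑ j, (midC u j - fstC u * (midC a j / fstC a)) ^ 2 / (2 * fstC u) :=
    Finset.sum_nonneg fun j _ => by positivity
  have e : ∑ j, (midC u j - fstC u * (midC a j / fstC a)) ^ 2 / (2 * fstC u)
      = (∑ j, midC u j ^ 2) / (2 * fstC u) - ∑ j, midC a j / fstC a * midC u j
        + (∑ j, (midC a j / fstC a) ^ 2) / 2 * fstC u := by
    simp only [Finset.sum_div, Finset.sum_mul]
    rw [← Finset.sum_sub_distrib, ← Finset.sum_add_distrib]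
    refine Finset.sum_congr rfl fun j _ => ?_
    field_simp
    ring
  linarith

end

section

/-! ### Simultaneous diagonalization and the generalized absolute value -/

open Matrix in
theorem exists_orthogonal_diagonalization {ι : Type*} [Fintype ι] [DecidableEq ι]
    {A : Matrix ι ι ℝ} (hA : A.IsHermitian) :
    ∃ (U : Matrix ι ι ℝ) (D : ι → ℝ), Uᵀ * U = 1 ∧ Uᵀ * A * U = diagonal D := by
  refine ⟨hA.eigenvectorUnitary, hA.eigenvalues, ?_, ?_⟩
  · have := Unitary.coe_star_mul_self hA.eigenvectorUnitary
    rwa [star_eq_conjTranspose, conjTranspose_eq_transpose_of_trivial] at this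
  · have := hA.conjStarAlgAut_star_eigenvectorUnitary
    rw [Unitary.conjStarAlgAut_apply] at this
    simpa [star_eq_conjTranspose, conjTranspose_eq_transpose_of_trivial] using this

open Matrix in
-- An orthogonal diagonalization of `S`, rescaled by the inverse roots of its eigenvalues, turns `S`
-- into the identity. A further orthogonal change of basis diagonalizes the transformed `T` and
-- preserves the identity. The witness `Q` is the inverse of the total change of basis `P`.
theorem exists_simultaneous_diagonalization {ι : Type*} [Fintype ι] [DecidableEq ι]
    {S T : Matrix ι ι ℝ} (hS : S.PosDef) (hT : T.IsHermitian) :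
    ∃ (Q : Matrix ι ι ℝ) (D : ι → ℝ), IsUnit Q.det ∧ S = Qᵀ * Q ∧ T = Qᵀ * diagonal D * Q := by
  obtain ⟨U, s, hU, hs⟩ := exists_orthogonal_diagonalization hS.isHermitian
  have hUu : IsUnit U := IsUnit.of_mul_eq_one_right _ hU
  have hpos : ∀ i, 0 < s i := by
    have : (Uᵀ * S * U).PosDef := by
      rw [← conjTranspose_eq_transpose_of_trivial]
      exact hS.conjTranspose_mul_mul_same (mulVec_injective_of_isUnit hUu)
    rw [hs] at this
    exact posDef_diagonal_iff.1 this
  set R : Matrix ι ι ℝ := diagonal fun i => (Real.sqrt (s i))⁻¹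
  have hR : R * diagonal s * R = 1 := by
    rw [diagonal_mul_diagonal, diagonal_mul_diagonal, ← diagonal_one]
    congr 1
    funext i
    have := Real.mul_self_sqrt (hpos i).le
    have h0 := (Real.sqrt_pos.2 (hpos i)).ne'
    field_simp
    rw [sq, this]
  have hRt : Rᵀ = R := diagonal_transpose _
  set C := U * R
  have hC : Cᵀ * S * C = 1 := by
    rw [transpose_mul, hRt, ← hR, ← hs]
    simp only [C, Matrix.mul_assoc]
  have hCT : (Cᵀ * T * C).IsHermitian := by
    have := isHermitian_conjTranspose_mul_mul C hT
    rwa [conjTranspose_eq_transpose_of_trivial] at this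
  obtain ⟨W, D, hW, hD⟩ := exists_orthogonal_diagonalization hCT
  set P := C * W
  have hPS : Pᵀ * S * P = 1 := by
    rw [transpose_mul, ← hW]
    calc Wᵀ * Cᵀ * S * (C * W) = Wᵀ * (Cᵀ * S * C) * W := by simp only [Matrix.mul_assoc]
      _ = Wᵀ * W := by rw [hC, Matrix.mul_one]
  have hPT : Pᵀ * T * P = diagonal D := by
    rw [transpose_mul, ← hD]
    simp only [P, Matrix.mul_assoc]
  have hPu : IsUnit P.det := (isUnit_iff_isUnit_det P).1 (IsUnit.of_mul_eq_one_right _ hPS)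
  have e1 : P * P⁻¹ = 1 := mul_nonsing_inv _ hPu
  have e2 : P⁻¹ᵀ * Pᵀ = 1 := by rw [← transpose_mul, e1, transpose_one]
  have key : ∀ X : Matrix ι ι ℝ, P⁻¹ᵀ * (Pᵀ * X * P) * P⁻¹ = X := fun X => by
    calc P⁻¹ᵀ * (Pᵀ * X * P) * P⁻¹ = (P⁻¹ᵀ * Pᵀ) * X * (P * P⁻¹) := by
          simp only [Matrix.mul_assoc]
      _ = X := by rw [e1, e2, Matrix.one_mul, Matrix.mul_one]
  refine ⟨P⁻¹, D, ?_, ?_, ?_⟩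
  · rw [det_nonsing_inv]; exact hPu.ringInverse
  · rw [← key S, hPS, Matrix.mul_one]
  · rw [← key T, hPT]

open Matrix

theorem A0t_isHermitian {γ : ℝ} (hγ : 1 < γ) (s₀ : ℝ) {v : State d} (hv : v ∈ negLast d) :
    (A0t γ s₀ v).IsHermitian := by
  refine Matrix.IsHermitian.ext fun i j => ?_
  have h : ∀ i j, A0t γ s₀ v i j
      = Pi.single i 1 ⬝ᵥ fderiv ℝ (consVar γ s₀) v (Pi.single j 1) := fun i j => by
    rw [← jacobian_mulVec]; simp [A0t]
  rw [h, h, dotProduct_fderiv_consVar hγ s₀ hv, dotProduct_fderiv_consVar hγ s₀ hv]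
  simp only [mul_comm, star_trivial]

theorem A0t_posDef {γ : ℝ} (hγ : 1 < γ) (s₀ : ℝ) {v : State d} (hv : v ∈ negLast d) :
    (A0t γ s₀ v).PosDef := by
  refine posDef_iff_dotProduct_mulVec.2 ⟨A0t_isHermitian hγ s₀ hv, fun z hz => ?_⟩
  rw [A0t, jacobian_mulVec, star_trivial]
  exact dotProduct_fderiv_consVar_pos hγ s₀ hv hz

theorem Ant_isHermitian {γ : ℝ} (hγ : 1 < γ) (s₀ : ℝ) {v : State d} (hv : v ∈ negLast d)
    (n : Space d) : (Ant γ s₀ n v).IsHermitian := by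
  refine Matrix.IsHermitian.ext fun i j => ?_
  have := Ant_isSymm hγ s₀ hv n (Pi.single i 1) (Pi.single j 1)
  simp at this
  simp [this]

theorem matAbs_eq {B C : StateMat d} (h : IsMatAbs B C) : matAbs B = C := by
  have h' : ∃ C, IsMatAbs B C := ⟨C, h⟩
  rw [matAbs, dif_pos h']
  exact h'.choose_spec.unique h

/-- A common diagonalization of `Ã₀`, `Ã_n` and `|Ã_n|`. -/
theorem exists_genAbs_diagonalization {γ : ℝ} (hγ : 1 < γ) (s₀ : ℝ) {v : State d}
    (hv : v ∈ negLast d) (n : Space d) :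
    ∃ (Q : StateMat d) (D : Comp d → ℝ), IsUnit Q.det ∧ A0t γ s₀ v = Qᵀ * Q ∧
      Ant γ s₀ n v = Qᵀ * diagonal D * Q ∧
      (A0t γ s₀ v)⁻¹ * Ant γ s₀ n v = Q⁻¹ * diagonal D * Q ∧
      genAbs γ s₀ n v = Qᵀ * diagonal (fun i => |D i|) * Q := by
  obtain ⟨Q, D, hQ, hS, hT⟩ :=
    exists_simultaneous_diagonalization (A0t_posDef hγ s₀ hv) (Ant_isHermitian hγ s₀ hv n)
  have hQt : IsUnit Qᵀ.det := by rwa [det_transpose]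
  have hB : (A0t γ s₀ v)⁻¹ * Ant γ s₀ n v = Q⁻¹ * diagonal D * Q := by
    rw [hS, hT, Matrix.mul_inv_rev]
    calc Q⁻¹ * Qᵀ⁻¹ * (Qᵀ * diagonal D * Q) = Q⁻¹ * (Qᵀ⁻¹ * Qᵀ) * diagonal D * Q := by
          simp only [Matrix.mul_assoc]
      _ = _ := by rw [nonsing_inv_mul _ hQt, Matrix.mul_one]
  have hQQ : Q⁻¹⁻¹ = Q := nonsing_inv_nonsing_inv _ hQ
  refine ⟨Q, D, hQ, hS, hT, hB, ?_⟩
  have hC : matAbs ((A0t γ s₀ v)⁻¹ * Ant γ s₀ n v) = Q⁻¹ * diagonal (fun i => |D i|) * Q := by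
    refine matAbs_eq ⟨Q⁻¹, D, ?_, ?_, ?_⟩
    · rw [det_nonsing_inv]; exact hQ.ringInverse
    · rw [hB, hQQ]
    · rw [hQQ]
  rw [genAbs, hC, hS]
  calc Qᵀ * Q * (Q⁻¹ * diagonal (fun i => |D i|) * Q)
      = Qᵀ * (Q * Q⁻¹) * diagonal (fun i => |D i|) * Q := by simp only [Matrix.mul_assoc]
    _ = _ := by rw [mul_nonsing_inv _ hQ, Matrix.mul_one]

theorem quadForm_transpose_mul_diagonal_mul (Q : StateMat d) (D : Comp d → ℝ) (z : State d) :
    quadForm (Qᵀ * diagonal D * Q) z = ∑ i, D i * (Q.mulVec z) i ^ 2 := by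
  rw [quadForm, Matrix.mul_assoc, ← mulVec_mulVec, dotProduct_mulVec, vecMul_transpose,
    ← mulVec_mulVec]
  refine Finset.sum_congr rfl fun i _ => ?_
  rw [mulVec_diagonal]; ring

/-- In the common coordinates `y = Q z` the claim is `|∑ D i * y i ^ 2| ≤ ∑ |D i| * y i ^ 2`. -/
theorem abs_quadForm_Ant_le {γ : ℝ} (hγ : 1 < γ) (s₀ : ℝ) {v : State d} (hv : v ∈ negLast d)
    (n : Space d) (z : State d) :
    |quadForm (Ant γ s₀ n v) z| ≤ quadForm (genAbs γ s₀ n v) z := by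
  obtain ⟨Q, D, -, -, hT, -, hG⟩ := exists_genAbs_diagonalization hγ s₀ hv n
  rw [hT, hG, quadForm_transpose_mul_diagonal_mul, quadForm_transpose_mul_diagonal_mul]
  refine (Finset.abs_sum_le_sum_abs _ _).trans (Finset.sum_le_sum fun i _ => ?_)
  rw [abs_mul, abs_of_nonneg (sq_nonneg ((Q.mulVec z) i))]

/-- From `A_n Qᵀ Q = Qᵀ D Q` the columns of `Qᵀ` are eigenvectors of `A_n` with eigenvalues `D i`,
so every `|D i|` is at most `lambdaMax`. -/
theorem quadForm_genAbs_le_lambdaMax {γ : ℝ} (hγ : 1 < γ) (s₀ : ℝ) {v : State d}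
    (hv : v ∈ negLast d) (n : Space d) (z : State d) :
    quadForm (genAbs γ s₀ n v) z ≤ quadForm (lambdaMax γ s₀ n v • A0t γ s₀ v) z := by
  obtain ⟨Q, D, hQ, hS, hT, -, hG⟩ := exists_genAbs_diagonalization hγ s₀ hv n
  have hS' : A0t γ s₀ v = Qᵀ * Matrix.diagonal (fun _ => 1) * Q := by
    rw [Matrix.diagonal_one, Matrix.mul_one, hS]
  -- `lambdaMax` is a real `sSup`, which dominates its set only if that set is bounded above;
  -- finiteness of the spectrum provides this.
  have hbdd : BddAbove {r | ∃ μ : ℝ,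
      Module.End.HasEigenvalue (toLin' (An γ n (consVar γ s₀ v))) μ ∧ r = |μ|} := by
    refine Set.Finite.bddAbove ?_
    refine ((Module.End.finite_spectrum (toLin' (An γ n (consVar γ s₀ v)))).image
      (fun x => |x|)).subset ?_
    rintro r ⟨μ, hμ, rfl⟩
    exact ⟨μ, hμ.mem_spectrum, rfl⟩
  have hD : ∀ i, |D i| ≤ lambdaMax γ s₀ n v := fun i => by
    refine le_csSup hbdd ⟨D i, ?_, rfl⟩
    have hQt : IsUnit Qᵀ := by rw [isUnit_iff_isUnit_det, det_transpose]; exact hQ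
    have hA : An γ n (consVar γ s₀ v) * Qᵀ = Qᵀ * diagonal D := by
      have h1 : An γ n (consVar γ s₀ v) * Qᵀ * Q = Qᵀ * diagonal D * Q := by
        rw [Matrix.mul_assoc, ← hS, ← hT, Ant]
      have := congrArg (fun X => X * Q⁻¹) h1
      simpa only [Matrix.mul_assoc, mul_nonsing_inv _ hQ, Matrix.mul_one] using this
    refine Module.End.hasEigenvalue_of_hasEigenvector
      (x := Qᵀ.mulVec (Pi.single i 1)) ⟨?_, ?_⟩
    · rw [Module.End.mem_eigenspace_iff, toLin'_apply, mulVec_mulVec, hA, ← mulVec_mulVec,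
        diagonal_mulVec_single, mul_one, ← mulVec_smul, ← Pi.single_smul, smul_eq_mul, mul_one]
    · intro h
      have := mulVec_injective_of_isUnit hQt (h.trans (mulVec_zero _).symm)
      simpa using congrFun this i
  have e : ∀ c : ℝ, quadForm (c • A0t γ s₀ v) z = c * quadForm (A0t γ s₀ v) z := fun c => by
    rw [quadForm, smul_mulVec, dotProduct_smul, smul_eq_mul, quadForm]
  rw [e, hS', hG, quadForm_transpose_mul_diagonal_mul, quadForm_transpose_mul_diagonal_mul,
    Finset.mul_sum]
  exact Finset.sum_le_sum fun i _ => by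
    rw [one_mul]; exact mul_le_mul_of_nonneg_right (hD i) (sq_nonneg _)

/-! ### Integrability of the generalized absolute value along segments -/

theorem vPath_mem {v₁ v₂ : State d} (h₁ : v₁ ∈ negLast d) (h₂ : v₂ ∈ negLast d) {θ : ℝ}
    (hθ : θ ∈ Icc (0 : ℝ) 1) : vPath v₁ v₂ θ ∈ negLast d := by
  have : vPath v₁ v₂ θ = (1 - θ) • v₁ + θ • v₂ := by rw [vPath]; module
  rw [this]
  exact convex_negLast h₁ h₂ (by linarith [hθ.2]) hθ.1 (by ring)

theorem continuous_vPath (v₁ v₂ : State d) : Continuous (vPath v₁ v₂) := by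
  unfold vPath; fun_prop

theorem continuousOn_jacobian {f : State d → State d} {s : Set (State d)} (hs : IsOpen s)
    (hf : ContDiffOn ℝ ⊤ f s) : ContinuousOn (jacobian f) s := by
  refine continuousOn_pi.2 fun i => continuousOn_pi.2 fun j => ?_
  have h := hf.continuousOn_fderiv_of_isOpen hs (by simp)
  have h2 := (h.clm_apply continuousOn_const (g := fun _ => Pi.single j (1 : ℝ)))
  refine ((continuous_apply i).comp_continuousOn h2).congr fun x _ => ?_
  simp [jacobian, LinearMap.toMatrix'_apply]

theorem continuousOn_A0t {γ : ℝ} (hγ : 1 < γ) (s₀ : ℝ) :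
    ContinuousOn (A0t γ s₀ : State d → StateMat d) (negLast d) :=
  continuousOn_jacobian isOpen_negLast (contDiffOn_consVar hγ s₀)

theorem continuousOn_Ant {γ : ℝ} (hγ : 1 < γ) (s₀ : ℝ) (n : Space d) :
    ContinuousOn (Ant γ s₀ n) (negLast d) :=
  (continuousOn_jacobian isOpen_negLast (contDiffOn_normalFlux_consVar hγ s₀ n)).congr
    fun _ hv => Ant_eq hγ s₀ hv n

theorem continuousOn_A0t_inv_mul_Ant {γ : ℝ} (hγ : 1 < γ) (s₀ : ℝ) (n : Space d) :
    ContinuousOn (fun v => (A0t γ s₀ v)⁻¹ * Ant γ s₀ n v) (negLast d) := by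
  intro v hv
  have h := (continuousOn_A0t hγ s₀) v hv
  have hdet : (A0t γ s₀ v).det ≠ 0 := (A0t_posDef hγ s₀ hv).det_pos.ne'
  have h1 : ContinuousWithinAt (fun v => (A0t γ s₀ v)⁻¹) (negLast d) v := by
    simp only [Matrix.inv_def, Ring.inverse_eq_inv']
    exact (((Continuous.matrix_det continuous_id).continuousAt.comp_continuousWithinAt h).inv₀
      hdet).smul ((Continuous.matrix_adjugate continuous_id).continuousAt.comp_continuousWithinAt h)
  exact h1.mul (continuousOn_Ant hγ s₀ n v hv)

theorem continuousOn_entry {X : Type*} [TopologicalSpace X] {M : X → StateMat d} {s : Set X}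
    (h : ContinuousOn M s) (i j : Comp d) : ContinuousOn (fun x => M x i j) s :=
  continuousOn_pi.1 (continuousOn_pi.1 h i) j

/-- Weierstrass approximation on `[-k, k]` with error below `1 / (k + 1)`. Every real number lies in
all but finitely many of these intervals, so a single sequence serves all of them. -/
theorem exists_polynomial_tendsto_abs :
    ∃ p : ℕ → Polynomial ℝ, ∀ x : ℝ,
      Filter.Tendsto (fun k => (p k).eval x) Filter.atTop (nhds |x|) := by
  choose p hp using fun k : ℕ => exists_polynomial_near_of_continuousOn (-(k : ℝ)) k (fun x => |x|)
    continuous_abs.continuousOn (1 / ((k : ℝ) + 1)) (by positivity)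
  refine ⟨p, fun x => ?_⟩
  obtain ⟨N, hN⟩ := exists_nat_ge |x|
  refine tendsto_iff_norm_sub_tendsto_zero.2 ?_
  refine squeeze_zero' (Filter.Eventually.of_forall fun _ => norm_nonneg _) ?_
    tendsto_one_div_add_atTop_nhds_zero_nat
  filter_upwards [Filter.eventually_ge_atTop N] with k hk
  have hk' : (N : ℝ) ≤ k := by exact_mod_cast hk
  have := abs_le.1 (hN.trans hk')
  exact (hp k x ⟨this.1, this.2⟩).le

theorem transpose_mul_diagonal_mul_apply (Q : StateMat d) (D : Comp d → ℝ) (i j : Comp d) :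
    (Qᵀ * Matrix.diagonal D * Q) i j = ∑ k, D k * (Q k i * Q k j) := by
  rw [Matrix.mul_apply]
  refine Finset.sum_congr rfl fun k _ => ?_
  rw [Matrix.mul_diagonal, Matrix.transpose_apply]; ring

theorem aeval_conj_diagonal {Q : StateMat d} (hQ : IsUnit Q.det) (D : Comp d → ℝ)
    (p : Polynomial ℝ) :
    Polynomial.aeval (Q⁻¹ * Matrix.diagonal D * Q) p
      = Q⁻¹ * Matrix.diagonal (fun i => p.eval (D i)) * Q := by
  induction p using Polynomial.induction_on' with
  | add p q hp hq =>
    rw [map_add, hp, hq, ← Matrix.add_mul, ← Matrix.mul_add, Matrix.diagonal_add]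
    simp only [Polynomial.eval_add]
  | monomial k a =>
    have h : ∀ k : ℕ, (Q⁻¹ * Matrix.diagonal D * Q) ^ k
        = Q⁻¹ * Matrix.diagonal (fun i => D i ^ k) * Q := fun k => by
      induction k with
      | zero => simp [nonsing_inv_mul _ hQ]
      | succ k ih =>
        rw [pow_succ, ih]
        calc Q⁻¹ * Matrix.diagonal (fun i => D i ^ k) * Q * (Q⁻¹ * Matrix.diagonal D * Q)
            = Q⁻¹ * (Matrix.diagonal (fun i => D i ^ k) * ((Q * Q⁻¹) * Matrix.diagonal D)) * Q := by
              simp only [Matrix.mul_assoc]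
          _ = _ := by
              rw [mul_nonsing_inv _ hQ, Matrix.one_mul, Matrix.diagonal_mul_diagonal]
              simp only [pow_succ]
    rw [Polynomial.aeval_monomial, h, Algebra.algebraMap_eq_smul_one, smul_mul_assoc, one_mul,
      ← smul_mul_assoc, ← mul_smul_comm, ← Matrix.diagonal_smul]
    congr 3
    funext i
    simp

/-- Continuity of the matrix absolute value is not needed. Polynomials of `Ã₀⁻¹ Ã_n` are continuous
along the segment, and those approximating `|x|` converge pointwise in common diagonal coordinates,
which gives measurability. A continuous dominating function gives integrability. -/
theorem integrableOn_genAbs_vPath {γ : ℝ} (hγ : 1 < γ) (s₀ : ℝ) {v₁ v₂ : State d}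
    (h₁ : v₁ ∈ negLast d) (h₂ : v₂ ∈ negLast d) (n : Space d) (i j : Comp d) :
    IntegrableOn (fun θ => genAbs γ s₀ n (vPath v₁ v₂ θ) i j) (Icc 0 1) := by
  obtain ⟨p, hp⟩ := exists_polynomial_tendsto_abs
  have hmaps : MapsTo (vPath v₁ v₂) (Icc 0 1) (negLast d) := fun θ hθ => vPath_mem h₁ h₂ hθ
  have hpath : ContinuousOn (vPath v₁ v₂) (Icc 0 1) := (continuous_vPath _ _).continuousOn
  have hB := (continuousOn_A0t_inv_mul_Ant hγ s₀ n).comp hpath hmaps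
  have hA := (continuousOn_A0t hγ s₀).comp hpath hmaps
  have hcont : ∀ (q : Polynomial ℝ) (i j : Comp d), ContinuousOn (fun θ =>
      (A0t γ s₀ (vPath v₁ v₂ θ) * Polynomial.aeval
        ((A0t γ s₀ (vPath v₁ v₂ θ))⁻¹ * Ant γ s₀ n (vPath v₁ v₂ θ)) q) i j) (Icc 0 1) :=
    fun q i j => continuousOn_entry (hA.mul (q.continuous_aeval.comp_continuousOn hB)) i j
  have hval : ∀ θ ∈ Icc (0 : ℝ) 1, ∃ (Q : StateMat d) (D : Comp d → ℝ),
      (∀ (q : Polynomial ℝ) i j, (A0t γ s₀ (vPath v₁ v₂ θ) * Polynomial.aeval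
        ((A0t γ s₀ (vPath v₁ v₂ θ))⁻¹ * Ant γ s₀ n (vPath v₁ v₂ θ)) q) i j
          = ∑ k, q.eval (D k) * (Q k i * Q k j)) ∧
      ∀ i j, genAbs γ s₀ n (vPath v₁ v₂ θ) i j = ∑ k, |D k| * (Q k i * Q k j) := by
    intro θ hθ
    obtain ⟨Q, D, hQ, hS, -, hBD, hG⟩ := exists_genAbs_diagonalization hγ s₀ (hmaps hθ) n
    refine ⟨Q, D, fun q i j => ?_, fun i j => ?_⟩
    · rw [hBD, aeval_conj_diagonal hQ, hS, ← transpose_mul_diagonal_mul_apply]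
      refine congrFun (congrFun ?_ i) j
      calc Qᵀ * Q * (Q⁻¹ * Matrix.diagonal (fun i => q.eval (D i)) * Q)
          = Qᵀ * ((Q * Q⁻¹) * Matrix.diagonal (fun i => q.eval (D i))) * Q := by
            simp only [Matrix.mul_assoc]
        _ = _ := by rw [mul_nonsing_inv _ hQ, Matrix.one_mul]
    · rw [hG, transpose_mul_diagonal_mul_apply]
  -- The polynomial `1 + X ^ 2` dominates `|X|`, and the off-diagonal products `Q k i * Q k j` are
  -- controlled by the two diagonal ones.
  have hbound : ∀ i, IntegrableOn (fun θ => (A0t γ s₀ (vPath v₁ v₂ θ) * Polynomial.aeval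
        ((A0t γ s₀ (vPath v₁ v₂ θ))⁻¹ * Ant γ s₀ n (vPath v₁ v₂ θ)) (1 + Polynomial.X ^ 2)) i i)
        (Icc 0 1) := fun i => (hcont _ i i).integrableOn_Icc
  refine Integrable.mono' ((hbound i).add (hbound j)) ?_ ?_
  · refine aestronglyMeasurable_of_tendsto_ae Filter.atTop
      (fun k => (hcont (p k) i j).aestronglyMeasurable measurableSet_Icc) ?_
    filter_upwards [ae_restrict_mem measurableSet_Icc] with θ hθ
    obtain ⟨Q, D, hq, hG⟩ := hval θ hθ
    simp only [hq, hG]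
    exact tendsto_finsetSum _ fun k _ => (hp (D k)).mul_const _
  · filter_upwards [ae_restrict_mem measurableSet_Icc] with θ hθ
    obtain ⟨Q, D, hq, hG⟩ := hval θ hθ
    rw [Pi.add_apply, hG, hq, hq, ← Finset.sum_add_distrib, Real.norm_eq_abs]
    refine (Finset.abs_sum_le_sum_abs _ _).trans (Finset.sum_le_sum fun k _ => ?_)
    simp only [Polynomial.eval_add, Polynomial.eval_one, Polynomial.eval_pow, Polynomial.eval_X]
    rw [abs_mul, abs_abs, ← mul_add]
    have h1 : |D k| ≤ 1 + D k ^ 2 := by nlinarith [sq_nonneg (|D k| - 1), sq_abs (D k), abs_nonneg (D k)]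
    have h2 : |Q k i * Q k j| ≤ Q k i * Q k i + Q k j * Q k j := by
      rw [abs_le]
      constructor <;> nlinarith [sq_nonneg (Q k i + Q k j), sq_nonneg (Q k i - Q k j),
        sq_nonneg (Q k i), sq_nonneg (Q k j)]
    exact mul_le_mul h1 h2 (abs_nonneg _) (by positivity)

theorem quadForm_eq_sum (B : StateMat d) (z : State d) :
    quadForm B z = ∑ i, ∑ j, z i * z j * B i j := by
  simp only [quadForm, dotProduct, mulVec, Finset.mul_sum]
  exact Finset.sum_congr rfl fun i _ => Finset.sum_congr rfl fun j _ => by ring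

theorem intervalIntegrable_quadForm_genAbs {γ : ℝ} (hγ : 1 < γ) (s₀ : ℝ) {v₁ v₂ : State d}
    (h₁ : v₁ ∈ negLast d) (h₂ : v₂ ∈ negLast d) (n : Space d) (z : State d) :
    IntervalIntegrable (fun θ => quadForm (genAbs γ s₀ n (vPath v₁ v₂ θ)) z) volume 0 1 := by
  rw [intervalIntegrable_iff_integrableOn_Icc_of_le zero_le_one]
  simp only [quadForm_eq_sum]
  exact integrable_finsetSum _ fun i _ => integrable_finsetSum _ fun j _ =>
    (integrableOn_genAbs_vPath hγ s₀ h₁ h₂ n i j).const_mul _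

/-! ### The pointwise entropy inequality of the numerical flux -/

/-- Integration by parts with the weight `θ - 1/2`: its end values `±1/2` produce the trapezoidal
mean of `F_n · Δ`, and the remaining integral of `F_n · Δ` is exact because `F_n` is a gradient. -/
theorem trapezoid_identity {γ : ℝ} (hγ : 1 < γ) (s₀ : ℝ) {v₁ v₂ : State d}
    (h₁ : v₁ ∈ negLast d) (h₂ : v₂ ∈ negLast d) (n : Space d) :
    ∫ θ in (0 : ℝ)..1, (θ - 1 / 2) * quadForm (Ant γ s₀ n (vPath v₁ v₂ θ)) (v₂ - v₁)
      = 1 / 2 * ((normalFlux γ n (consVar γ s₀ v₁) + normalFlux γ n (consVar γ s₀ v₂)) ⬝ᵥ (v₂ - v₁))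
        - (normalPotential γ s₀ n v₂ - normalPotential γ s₀ n v₁) := by
  set Δ := v₂ - v₁ with hΔ
  have hu : uIcc (0 : ℝ) 1 = Icc 0 1 := uIcc_of_le zero_le_one
  have hpath : ∀ θ, HasDerivAt (vPath v₁ v₂) Δ θ := fun θ => by
    have := ((hasDerivAt_id θ).smul_const Δ).const_add v₁
    rwa [one_smul] at this
  set g : ℝ → ℝ := fun θ => normalFlux γ n (consVar γ s₀ (vPath v₁ v₂ θ)) ⬝ᵥ Δ
  have hg : ∀ θ ∈ uIcc (0 : ℝ) 1,
      HasDerivAt g (quadForm (Ant γ s₀ n (vPath v₁ v₂ θ)) Δ) θ := fun θ hθ => by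
    rw [hu] at hθ
    have hv := vPath_mem h₁ h₂ hθ
    have h1 : DifferentiableAt ℝ (fun v => normalFlux γ n (consVar γ s₀ v)) (vPath v₁ v₂ θ) :=
      ((contDiffOn_normalFlux_consVar hγ s₀ n).differentiableOn (by simp)).differentiableAt
        (isOpen_negLast.mem_nhds hv)
    have h2 := (dotCL Δ).hasFDerivAt.comp_hasDerivAt θ
      (h1.hasFDerivAt.comp_hasDerivAt θ (hpath θ))
    rw [Ant_eq hγ s₀ hv, quadForm, jacobian_mulVec]
    refine h2.congr_of_eventuallyEq (Filter.Eventually.of_forall fun θ => ?_)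
    simp [g, dotProduct_comm]
  have hP : ∀ θ ∈ uIcc (0 : ℝ) 1,
      HasDerivAt (fun θ => normalPotential γ s₀ n (vPath v₁ v₂ θ)) (g θ) θ := fun θ hθ => by
    rw [hu] at hθ
    exact (hasFDerivAt_normalPotential hγ s₀ (vPath_mem h₁ h₂ hθ) n).comp_hasDerivAt θ (hpath θ)
  have hgc : ContinuousOn g (uIcc 0 1) := fun θ hθ => (hg θ hθ).continuousAt.continuousWithinAt
  have hqc : ContinuousOn (fun θ => quadForm (Ant γ s₀ n (vPath v₁ v₂ θ)) Δ) (uIcc 0 1) := by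
    rw [hu]
    have := (continuousOn_Ant hγ s₀ n).comp (continuous_vPath v₁ v₂).continuousOn
      fun θ hθ => vPath_mem h₁ h₂ hθ
    simp only [quadForm_eq_sum]
    exact continuousOn_finsetSum _ fun i _ => continuousOn_finsetSum _ fun j _ =>
      continuousOn_const.mul (continuousOn_entry this i j)
  rw [intervalIntegral.integral_mul_deriv_eq_deriv_mul (u := fun θ => θ - 1 / 2) (u' := fun _ => 1)
    (v := g) (fun θ _ => (hasDerivAt_id θ).sub_const _) hg intervalIntegrable_const
    hqc.intervalIntegrable]
  simp only [one_mul]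
  rw [intervalIntegral.integral_eq_sub_of_hasDerivAt hP hgc.intervalIntegrable]
  have e1 : vPath v₁ v₂ 1 = v₂ := by simp [vPath]
  have e0 : vPath v₁ v₂ 0 = v₁ := by simp [vPath]
  simp only [g, e1, e0, add_dotProduct]
  ring

/-- A stabilization matrix that dominates the mean of `|Ã_n|` along the segment gives an entropy
stable numerical flux. -/
theorem normalPotential_sub_le {γ : ℝ} (hγ : 1 < γ) (s₀ : ℝ) (σ : Stabilization d)
    {v₁ v₂ : State d} (h₁ : v₁ ∈ negLast d) (h₂ : v₂ ∈ negLast d) (n : Space d)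
    (hσ : ∫ θ in (0 : ℝ)..1, quadForm (genAbs γ s₀ n (vPath v₁ v₂ θ)) (v₂ - v₁)
      ≤ quadForm (σ v₁ v₂ n) (v₂ - v₁)) :
    normalPotential γ s₀ n v₂ - normalPotential γ s₀ n v₁
      ≤ numFlux γ s₀ σ v₁ v₂ n ⬝ᵥ (v₂ - v₁) := by
  have hq := intervalIntegrable_quadForm_genAbs hγ s₀ h₁ h₂ n (v₂ - v₁)
  have h := trapezoid_identity hγ s₀ h₁ h₂ n
  have hle : -(1 / 2) * ∫ θ in (0 : ℝ)..1, quadForm (genAbs γ s₀ n (vPath v₁ v₂ θ)) (v₂ - v₁)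
      ≤ ∫ θ in (0 : ℝ)..1, (θ - 1 / 2) * quadForm (Ant γ s₀ n (vPath v₁ v₂ θ)) (v₂ - v₁) := by
    rw [← intervalIntegral.integral_const_mul]
    refine intervalIntegral.integral_mono_on zero_le_one (hq.const_mul _) ?_ fun θ hθ => ?_
    · have := (continuousOn_Ant hγ s₀ n).comp (continuous_vPath v₁ v₂).continuousOn
        fun θ hθ => vPath_mem h₁ h₂ hθ
      refine ContinuousOn.intervalIntegrable ?_
      rw [uIcc_of_le zero_le_one]
      refine (continuousOn_id.sub continuousOn_const).mul ?_
      simp only [quadForm_eq_sum]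
      exact continuousOn_finsetSum _ fun i _ => continuousOn_finsetSum _ fun j _ =>
        continuousOn_const.mul (continuousOn_entry this i j)
    · have h3 := abs_quadForm_Ant_le hγ s₀ (vPath_mem h₁ h₂ hθ) n (v₂ - v₁)
      have h4 : |θ - 1 / 2| ≤ 1 / 2 := abs_le.2 ⟨by linarith [hθ.1], by linarith [hθ.2]⟩
      have h5 : |(θ - 1 / 2) * quadForm (Ant γ s₀ n (vPath v₁ v₂ θ)) (v₂ - v₁)|
          ≤ 1 / 2 * quadForm (genAbs γ s₀ n (vPath v₁ v₂ θ)) (v₂ - v₁) := by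
        rw [abs_mul]
        exact mul_le_mul h4 h3 (abs_nonneg _) (by norm_num)
      linarith [(abs_le.1 h5).1]
  have hf : numFlux γ s₀ σ v₁ v₂ n ⬝ᵥ (v₂ - v₁)
      = 1 / 2 * ((normalFlux γ n (consVar γ s₀ v₁) + normalFlux γ n (consVar γ s₀ v₂)) ⬝ᵥ (v₂ - v₁))
        + 1 / 2 * quadForm (σ v₁ v₂ n) (v₂ - v₁) := by
    rw [numFlux, add_dotProduct, smul_dotProduct, smul_dotProduct, quadForm,
      dotProduct_comm (v₂ - v₁), smul_eq_mul, smul_eq_mul]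
  rw [hf]
  linarith

/-- The reversed segment is the original one under `θ ↦ 1 - θ`. After this substitution the two
weights are `1 - θ` and `θ`, which add up to one. -/
theorem quadForm_sigmaMV {γ : ℝ} (hγ : 1 < γ) (s₀ : ℝ) {v₁ v₂ : State d} (h₁ : v₁ ∈ negLast d)
    (h₂ : v₂ ∈ negLast d) (n : Space d) (z : State d) :
    quadForm (sigmaMV γ s₀ v₁ v₂ n) z
      = ∫ θ in (0 : ℝ)..1, quadForm (genAbs γ s₀ n (vPath v₁ v₂ θ)) z := by
  have hI : ∀ {v₁ v₂ : State d}, v₁ ∈ negLast d → v₂ ∈ negLast d → ∀ i j, IntervalIntegrable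
      (fun θ => genAbs γ s₀ n (vPath v₁ v₂ θ) i j) volume 0 1 := fun h₁ h₂ i j => by
    rw [intervalIntegrable_iff_integrableOn_Icc_of_le zero_le_one]
    exact integrableOn_genAbs_vPath hγ s₀ h₁ h₂ n i j
  have hsym : ∀ θ, vPath v₂ v₁ θ = vPath v₁ v₂ (1 - θ) := fun θ => by
    simp only [vPath]; module
  have hlin : ContinuousOn (fun θ : ℝ => 1 - θ) (uIcc 0 1) := by fun_prop
  set q : ℝ → ℝ := fun θ => quadForm (genAbs γ s₀ n (vPath v₁ v₂ θ)) z with hq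
  have hqi : IntervalIntegrable q volume 0 1 := intervalIntegrable_quadForm_genAbs hγ s₀ h₁ h₂ n z
  have hqi' : IntervalIntegrable (fun θ => q (1 - θ)) volume 0 1 := by
    have := intervalIntegrable_quadForm_genAbs hγ s₀ h₂ h₁ n z
    simpa only [hsym] using this
  have e : quadForm (sigmaMV γ s₀ v₁ v₂ n) z
      = ∫ θ in (0 : ℝ)..1, ((1 - θ) * q θ + (1 - θ) * q (1 - θ)) := by
    simp only [quadForm_eq_sum, sigmaMV, Matrix.of_apply, hq, ← hsym]
    have h3 : ∀ i j, IntervalIntegrable (fun θ => z i * z j * ((1 - θ) *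
        (genAbs γ s₀ n (vPath v₁ v₂ θ) i j + genAbs γ s₀ n (vPath v₂ v₁ θ) i j))) volume 0 1 :=
      fun i j => (((hI h₁ h₂ i j).add (hI h₂ h₁ i j)).continuousOn_mul hlin).const_mul _
    simp only [← intervalIntegral.integral_const_mul]
    simp_rw [← intervalIntegral.integral_finsetSum fun j _ => h3 _ j]
    rw [← intervalIntegral.integral_finsetSum]
    · refine intervalIntegral.integral_congr fun θ _ => ?_
      simp only [Finset.mul_sum, ← Finset.sum_add_distrib]
      exact Finset.sum_congr rfl fun i _ => Finset.sum_congr rfl fun j _ => by ring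
    · intro i _
      have := IntervalIntegrable.sum Finset.univ fun j _ => h3 i j
      rwa [Finset.sum_fn] at this
  have hswap : ∫ θ in (0 : ℝ)..1, (1 - θ) * q (1 - θ) = ∫ θ in (0 : ℝ)..1, θ * q θ := by
    have := intervalIntegral.integral_comp_sub_left (a := 0) (b := 1) (fun θ => θ * q θ) 1
    simpa using this
  have hid : IntervalIntegrable (fun θ => θ * q θ) volume 0 1 :=
    hqi.continuousOn_mul continuousOn_id
  rw [e, intervalIntegral.integral_add (hqi.continuousOn_mul hlin) (hqi'.continuousOn_mul hlin),
    hswap, ← intervalIntegral.integral_add (hqi.continuousOn_mul hlin) hid]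
  exact intervalIntegral.integral_congr fun θ _ => by ring

/-- The entropy inequality of the numerical flux that the stabilization has to provide. -/
def IsDissipative (γ s₀ : ℝ) (σ : Stabilization d) : Prop :=
  ∀ v₁ ∈ negLast d, ∀ v₂ ∈ negLast d, ∀ n : Space d, ‖n‖ = 1 →
    normalPotential γ s₀ n v₂ - normalPotential γ s₀ n v₁
      ≤ numFlux γ s₀ σ v₁ v₂ n ⬝ᵥ (v₂ - v₁)

theorem isDissipative_sigmaMV {γ : ℝ} (hγ : 1 < γ) (s₀ : ℝ) :
    IsDissipative γ s₀ (sigmaMV γ s₀ : Stabilization d) := fun _ h₁ _ h₂ n _ =>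
  normalPotential_sub_le hγ s₀ _ h₁ h₂ n (quadForm_sigmaMV hγ s₀ h₁ h₂ n _).ge

/-- An integral mean over `[0, 1]` does not exceed a pointwise upper bound. -/
theorem integral_quadForm_le_of_vStarCondition {γ : ℝ} (hγ : 1 < γ) {s₀ : ℝ}
    {vstar : State d → State d → Space d → State d} (hs : VStarCondition γ s₀ vstar)
    {v₁ v₂ : State d} (h₁ : v₁ ∈ negLast d) (h₂ : v₂ ∈ negLast d) {n : Space d} (hn : ‖n‖ = 1) :
    vstar v₁ v₂ n ∈ negLast d ∧
    ∫ θ in (0 : ℝ)..1, quadForm (genAbs γ s₀ n (vPath v₁ v₂ θ)) (v₂ - v₁)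
      ≤ quadForm (genAbs γ s₀ n (vstar v₁ v₂ n)) (v₂ - v₁) := by
  rw [VStarCondition, physEntropyStates_eq hγ] at hs
  obtain ⟨hm, hle⟩ := hs v₁ h₁ v₂ h₂ n hn
  refine ⟨hm, ?_⟩
  refine (intervalIntegral.integral_mono_on zero_le_one
    (intervalIntegrable_quadForm_genAbs hγ s₀ h₁ h₂ n _) intervalIntegrable_const hle).trans ?_
  simp

theorem isDissipative_sigmaS {γ : ℝ} (hγ : 1 < γ) {s₀ : ℝ}
    {vstar : State d → State d → Space d → State d} (hs : VStarCondition γ s₀ vstar) :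
    IsDissipative γ s₀ (sigmaS γ s₀ vstar) := fun _ h₁ _ h₂ n hn =>
  normalPotential_sub_le hγ s₀ _ h₁ h₂ n (integral_quadForm_le_of_vStarCondition hγ hs h₁ h₂ hn).2

theorem isDissipative_sigmaSLF {γ : ℝ} (hγ : 1 < γ) {s₀ : ℝ}
    {vstar : State d → State d → Space d → State d} (hs : VStarCondition γ s₀ vstar) :
    IsDissipative γ s₀ (sigmaSLF γ s₀ vstar) := fun _ h₁ _ h₂ n hn =>
  have h := integral_quadForm_le_of_vStarCondition hγ hs h₁ h₂ hn
  normalPotential_sub_le hγ s₀ _ h₁ h₂ n (h.2.trans (quadForm_genAbs_le_lambdaMax hγ s₀ h.1 n _))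

end

section

/-! ### Determinants with one distinguished row -/

/-- The square matrix with rows `x, c 0, …, c (n - 1)`. -/
def consMat {n : ℕ} (x : Space (n + 1)) (c : Fin n → Space (n + 1)) :
    Matrix (Fin (n + 1)) (Fin (n + 1)) ℝ :=
  Matrix.of fun i j => (Fin.cons x c : Fin (n + 1) → Space (n + 1)) i j

theorem consMat_mul_transpose {n : ℕ} (x y : Space (n + 1)) (c c' : Fin n → Space (n + 1))
    (i j : Fin (n + 1)) : (consMat x c * (consMat y c').transpose) i j =
      inner ℝ ((Fin.cons x c : Fin (n + 1) → Space (n + 1)) i)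
        ((Fin.cons y c' : Fin (n + 1) → Space (n + 1)) j) := by
  simp [consMat, Matrix.mul_apply, PiLp.inner_apply, mul_comm]

/-- The product of one matrix with the transpose of the other has the inner products of the rows as
entries. Orthogonality of `ν` to all `c a` makes its first column zero below the corner, and the
complementary minor is the Gram determinant. -/
theorem det_consMat_mul_det_consMat {n : ℕ} (x : Space (n + 1)) {ν : Space (n + 1)}
    {c : Fin n → Space (n + 1)} (hν : ∀ a, inner ℝ ν (c a) = 0) :
    (consMat x c).det * (consMat ν c).det = inner ℝ x ν * (Matrix.gram ℝ c).det := by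
  rw [← Matrix.det_transpose (consMat ν c), ← Matrix.det_mul, Matrix.det_succ_column_zero,
    Fin.sum_univ_succ, Finset.sum_eq_zero, add_zero]
  · rw [consMat_mul_transpose]
    simp only [Fin.val_zero, pow_zero, one_mul, Fin.cons_zero]
    congr 2
    ext a b
    simp only [Matrix.submatrix_apply]
    rw [consMat_mul_transpose, Fin.succAbove_zero]
    rfl
  · intro a _
    rw [consMat_mul_transpose, Fin.cons_succ, Fin.cons_zero, real_inner_comm, hν]
    ring

theorem det_consMat_ne_zero {n : ℕ} {ν : Space (n + 1)} {c : Fin n → Space (n + 1)}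
    (hν : ∀ a, inner ℝ ν (c a) = 0) (h0 : ν ≠ 0) (hc : LinearIndependent ℝ c) :
    (consMat ν c).det ≠ 0 := by
  have hmem : ν ∉ Submodule.span ℝ (range c) := fun h => h0 <| by
    have : Submodule.span ℝ (range c) ≤ (ℝ ∙ ν)ᗮ := by
      rw [Submodule.span_le]
      rintro _ ⟨a, rfl⟩
      exact Submodule.mem_orthogonal_singleton_iff_inner_right.2 (hν a)
    exact inner_self_eq_zero.1 (Submodule.mem_orthogonal_singleton_iff_inner_right.1 (this h))
  have h1 : LinearIndependent ℝ (Fin.cons ν c : Fin (n + 1) → Space (n + 1)) :=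
    linearIndependent_finCons.2 ⟨hc, hmem⟩
  have h2 := h1.map' (WithLp.linearEquiv 2 ℝ (Fin (n + 1) → ℝ)).toLinearMap
    (LinearEquiv.ker _)
  have h3 : IsUnit (consMat ν c) := Matrix.linearIndependent_rows_iff_isUnit.1 h2
  exact ((Matrix.isUnit_iff_isUnit_det _).1 h3).ne_zero

theorem sq_det_consMat {n : ℕ} {ν : Space (n + 1)} {c : Fin n → Space (n + 1)}
    (hν : ∀ a, inner ℝ ν (c a) = 0) (h1 : ‖ν‖ = 1) :
    (consMat ν c).det * (consMat ν c).det = (Matrix.gram ℝ c).det := by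
  rw [det_consMat_mul_det_consMat ν hν, real_inner_self_eq_norm_sq, h1]; ring

theorem abs_det_consMat_unit {n : ℕ} {ν : Space (n + 1)} {c : Fin n → Space (n + 1)}
    (hν : ∀ a, inner ℝ ν (c a) = 0) (h1 : ‖ν‖ = 1) :
    |(consMat ν c).det| = Real.sqrt (Matrix.gram ℝ c).det := by
  rw [← sq_det_consMat hν h1, Real.sqrt_mul_self_eq_abs]

theorem det_consMat_eq {n : ℕ} (x : Space (n + 1)) {ν : Space (n + 1)} {c : Fin n → Space (n + 1)}
    (hν : ∀ a, inner ℝ ν (c a) = 0) (h1 : ‖ν‖ = 1) (hc : LinearIndependent ℝ c) :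
    (consMat x c).det = inner ℝ x ν * (consMat ν c).det := by
  have h0 := det_consMat_ne_zero hν (norm_ne_zero_iff.1 (by rw [h1]; exact one_ne_zero)) hc
  refine mul_right_cancel₀ h0 ?_
  rw [det_consMat_mul_det_consMat x hν, ← sq_det_consMat hν h1]; ring

theorem abs_det_consMat {n : ℕ} (x : Space (n + 1)) {ν : Space (n + 1)}
    {c : Fin n → Space (n + 1)} (hν : ∀ a, inner ℝ ν (c a) = 0) (h1 : ‖ν‖ = 1)
    (hc : LinearIndependent ℝ c) :
    |(consMat x c).det| = |inner ℝ x ν| * Real.sqrt (Matrix.gram ℝ c).det := by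
  rw [det_consMat_eq x hν h1 hc, abs_mul, abs_det_consMat_unit hν h1]

/-- The remaining minor is the Jacobian of a parametrized face projected along the `i`-th axis. -/
theorem abs_det_consMat_single {n : ℕ} (i : Fin (n + 1)) (c : Fin n → Space (n + 1)) :
    |(consMat (EuclideanSpace.single i 1) c).det|
      = |(Matrix.of fun a b => c a (i.succAbove b)).det| := by
  rw [Matrix.det_succ_row_zero, Finset.sum_eq_single i]
  · rw [abs_mul, abs_mul, abs_pow, abs_neg, abs_one, one_pow, one_mul]
    have : consMat (EuclideanSpace.single i 1) c 0 i = 1 := by simp [consMat]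
    rw [this, abs_one, one_mul]
    congr 2
  · intro j _ hj
    have : consMat (EuclideanSpace.single i 1) c 0 j = 0 := by simp [consMat, hj]
    rw [this]; ring
  · simp

/-! ### The divergence theorem on convex polytopes -/

/-- Deletion of the `i`-th coordinate. -/
def delCoord {n : ℕ} (i : Fin (n + 1)) : Space (n + 1) →L[ℝ] Space n :=
  LinearMap.toContinuousLinearMap
    { toFun := fun x => WithLp.toLp 2 fun b => x (i.succAbove b)
      map_add' := fun _ _ => rfl
      map_smul' := fun _ _ => rfl }

/-- Insertion of the `i`-th coordinate. -/
def insCoord {n : ℕ} (i : Fin (n + 1)) (t : ℝ) (y : Space n) : Space (n + 1) :=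
  WithLp.toLp 2 (i.insertNth (α := fun _ => ℝ) t y)

@[simp] theorem delCoord_apply {n : ℕ} (i : Fin (n + 1)) (x : Space (n + 1)) (b : Fin n) :
    delCoord i x b = x (i.succAbove b) := rfl

@[simp] theorem insCoord_apply_same {n : ℕ} (i : Fin (n + 1)) (t : ℝ) (y : Space n) :
    insCoord i t y i = t := by simp [insCoord]

@[simp] theorem insCoord_apply_succAbove {n : ℕ} (i : Fin (n + 1)) (t : ℝ) (y : Space n)
    (b : Fin n) : insCoord i t y (i.succAbove b) = y b := by simp [insCoord]

@[simp] theorem delCoord_insCoord {n : ℕ} (i : Fin (n + 1)) (t : ℝ) (y : Space n) :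
    delCoord i (insCoord i t y) = y := by
  ext b; simp

theorem insCoord_delCoord {n : ℕ} (i : Fin (n + 1)) (x : Space (n + 1)) :
    insCoord i (x i) (delCoord i x) = x := by
  ext j
  rcases Fin.eq_self_or_eq_succAbove i j with rfl | ⟨b, rfl⟩ <;> simp

theorem insCoord_eq_add {n : ℕ} (i : Fin (n + 1)) (t s : ℝ) (y : Space n) :
    insCoord i t y = insCoord i s y + (t - s) • EuclideanSpace.single i 1 := by
  ext j
  rcases Fin.eq_self_or_eq_succAbove i j with rfl | ⟨b, rfl⟩ <;> simp [Fin.succAbove_ne]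

theorem hasDerivAt_insCoord {n : ℕ} (i : Fin (n + 1)) (t : ℝ) (y : Space n) :
    HasDerivAt (fun t => insCoord i t y) (EuclideanSpace.single i 1) t := by
  have h := (((hasDerivAt_id t).sub_const 0).smul_const
    (EuclideanSpace.single i (1 : ℝ) : Space (n + 1))).const_add (insCoord i 0 y)
  rw [one_smul] at h
  exact h.congr_of_eventuallyEq (Filter.Eventually.of_forall fun t => insCoord_eq_add i t 0 y)

/-- Fubini's theorem with the `i`-th coordinate as the inner variable. -/
theorem integral_eq_integral_insCoord {n : ℕ} (i : Fin (n + 1)) {g : Space (n + 1) → ℝ}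
    (hg : Integrable g) :
    ∫ x, g x = ∫ y : Space n, ∫ t, g (insCoord i t y) := by
  have h1 := ((volume_preserving_piFinSuccAbove (fun _ : Fin (n + 1) => ℝ) i).symm).trans
    (EuclideanSpace.volume_preserving_symm_measurableEquiv_toLp (Fin (n + 1))).symm
  have h2 : MeasurePreserving (fun q : ℝ × Space n => insCoord i q.1 q.2)
      (volume.prod volume) volume :=
    h1.comp ((MeasurePreserving.id volume).prod
      (EuclideanSpace.volume_preserving_symm_measurableEquiv_toLp (Fin n)))
  have hemb : MeasurableEmbedding (fun q : ℝ × Space n => insCoord i q.1 q.2) := by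
    refine MeasurableEmbedding.of_measurable_inverse h2.measurable
      (g := fun x => (x i, delCoord i x)) ?_ ?_ fun q => by simp
    · have : range (fun q : ℝ × Space n => insCoord i q.1 q.2) = univ :=
        range_eq_univ.2 fun x => ⟨(x i, delCoord i x), insCoord_delCoord i x⟩
      rw [this]; exact MeasurableSet.univ
    · exact Continuous.measurable (by fun_prop)
  rw [← h2.integral_comp hemb g]
  exact integral_prod_symm _ ((h2.integrable_comp_emb hemb).2 hg)

/-! ### Convex bodies tiled by affine faces -/

/-- `C` is a convex body whose boundary is tiled by the affine images `e f '' R` of a reference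
polytope, with outward unit normals `ν f`. -/
structure IsTiledBody {n : ℕ} {ι : Type*} (C : Set (Space (n + 1))) (R : Set (Space n))
    (e : ι → Space n →ᵃ[ℝ] Space (n + 1)) (ν : ι → Space (n + 1)) : Prop where
  convex : Convex ℝ C
  compact : IsCompact C
  interior_nonempty : (interior C).Nonempty
  face_convex : Convex ℝ R
  face_compact : IsCompact R
  face_interior : (interior R).Nonempty
  injective : ∀ f, Function.Injective (e f)
  cover : frontier C = ⋃ f, e f '' R
  disjoint : ∀ f f', f ≠ f' → Disjoint (e f '' interior R) (e f' '' interior R)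
  norm_normal : ∀ f, ‖ν f‖ = 1
  outward : ∀ f, ∀ s ∈ R, ∀ η ∈ C, inner ℝ (ν f) (η - e f s) ≤ 0

/-- The images of the coordinate vectors under the linear part of an affine map. -/
def colVec {m n : ℕ} (e : Space n →ᵃ[ℝ] Space m) (a : Fin n) : Space m :=
  e.linear (EuclideanSpace.single a 1)

theorem linearIndependent_colVec {m n : ℕ} {e : Space n →ᵃ[ℝ] Space m}
    (he : Function.Injective e) : LinearIndependent ℝ (colVec e) := by
  have := (EuclideanSpace.basisFun (Fin n) ℝ).toBasis.linearIndependent.map' e.linear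
    (LinearMap.ker_eq_bot.2 (e.linear_injective_iff.2 he))
  have h2 : colVec e = e.linear ∘ (EuclideanSpace.basisFun (Fin n) ℝ).toBasis := by
    funext a
    simp [colVec]
  rw [h2]
  exact this

theorem hasFDerivAt_affine {m n : ℕ} (e : Space n →ᵃ[ℝ] Space m) (s : Space n) :
    HasFDerivAt e (LinearMap.toContinuousLinearMap e.linear) s := by
  have h := (LinearMap.toContinuousLinearMap e.linear).hasFDerivAt.add_const (x := s) (e 0)
  refine h.congr_of_eventuallyEq (Filter.Eventually.of_forall fun x => ?_)
  exact congrFun e.decomp x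

theorem continuous_affine {m n : ℕ} (e : Space n →ᵃ[ℝ] Space m) : Continuous e :=
  continuous_iff_continuousAt.2 fun s => (hasFDerivAt_affine e s).continuousAt

namespace IsTiledBody

variable {n : ℕ} {ι : Type*} {C : Set (Space (n + 1))} {R : Set (Space n)}
  {e : ι → Space n →ᵃ[ℝ] Space (n + 1)} {ν : ι → Space (n + 1)} 
theorem face_mem (h : IsTiledBody C R e ν) (f : ι) {s : Space n} (hs : s ∈ R) : e f s ∈ C := by
  refine h.compact.isClosed.frontier_subset ?_
  rw [h.cover]
  exact mem_iUnion.2 ⟨f, mem_image_of_mem _ hs⟩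

/-- From an interior point of the face one can move a little in the direction `a` and stay in the
body, so the outward condition gives `≤ 0`. The same for `-a` gives equality. -/
theorem inner_linear (h : IsTiledBody C R e ν) (f : ι) (a : Space n) : inner ℝ (ν f) ((e f).linear a) = 0 := by
  obtain ⟨s₀, hs₀⟩ := h.face_interior
  have hle : ∀ a : Space n, inner ℝ (ν f) ((e f).linear a) ≤ 0 := fun a => by
    have hc : Filter.Tendsto (fun t : ℝ => s₀ + t • a) (nhdsWithin 0 (Ioi 0)) (nhds s₀) := by
      have : Continuous fun t : ℝ => s₀ + t • a := by fun_prop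
      have := this.tendsto 0
      rw [zero_smul, add_zero] at this
      exact this.mono_left nhdsWithin_le_nhds
    obtain ⟨t, ht, ht0⟩ := ((hc.eventually (isOpen_interior.mem_nhds hs₀)).and
      self_mem_nhdsWithin).exists
    have := h.outward f s₀ (interior_subset hs₀) _ (h.face_mem f (interior_subset ht))
    have e1 : e f (s₀ + t • a) - e f s₀ = t • (e f).linear a := by
      rw [← vsub_eq_sub, ← AffineMap.linearMap_vsub, vsub_eq_sub, add_sub_cancel_left, map_smul]
    rw [e1, inner_smul_right] at this
    exact nonpos_of_mul_nonpos_right this ht0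
  refine le_antisymm (hle a) ?_
  have := hle (-a)
  rw [map_neg, inner_neg_right] at this
  linarith

theorem inner_colVec (h : IsTiledBody C R e ν) (f : ι) (a : Fin n) : inner ℝ (ν f) (colVec (e f) a) = 0 :=
  h.inner_linear f _

/-- Projecting a face along the `i`-th axis scales its area by the normal component `|ν i|`. -/
theorem abs_det_delCoord (h : IsTiledBody C R e ν) (i : Fin (n + 1)) (f : ι) :
    |((delCoord i).comp (LinearMap.toContinuousLinearMap (e f).linear)).det|
      = |ν f i| * Real.sqrt (Matrix.gram ℝ (colVec (e f))).det := by
  have h1 := abs_det_consMat (EuclideanSpace.single i 1) (h.inner_colVec f) (h.norm_normal f)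
    (linearIndependent_colVec (h.injective f))
  rw [abs_det_consMat_single, EuclideanSpace.inner_single_left] at h1
  simp only [map_one, one_mul] at h1
  rw [← h1, ← Matrix.det_transpose, ContinuousLinearMap.det,
    ← LinearMap.det_toMatrix (EuclideanSpace.basisFun (Fin n) ℝ).toBasis]
  congr 2

/-- An extremal point of a vertical section is not an interior point. -/
theorem lt_of_mem_interior (i : Fin (n + 1)) {ε : ℝ} (hε : ε ≠ 0) {y : Space n} {t₀ t : ℝ}
    (ht : ∀ r, insCoord i r y ∈ C → ε * r ≤ ε * t) (ht₀ : insCoord i t₀ y ∈ interior C) :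
    ε * t₀ < ε * t := by
  have hc : Filter.Tendsto (fun r : ℝ => insCoord i (t₀ + r * ε) y) (nhdsWithin 0 (Ioi 0))
      (nhds (insCoord i t₀ y)) := by
    have : Continuous fun r : ℝ => insCoord i (t₀ + r * ε) y :=
      (continuous_iff_continuousAt.2 fun r => (hasDerivAt_insCoord i r y).continuousAt).comp
        (by fun_prop)
    have := this.tendsto 0
    rw [zero_mul, add_zero] at this
    exact this.mono_left nhdsWithin_le_nhds
  obtain ⟨r, hr, hr0⟩ := ((hc.eventually (isOpen_interior.mem_nhds ht₀)).and
    self_mem_nhdsWithin).exists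
  have h1 := ht _ (interior_subset hr)
  have h2 : 0 < ε * ε * r := mul_pos (mul_self_pos.2 hε) hr0
  nlinarith

/-- A face whose normal points into the direction `ε` contains the extremal points of the vertical
sections over it. -/
theorem face_eq_insCoord (h : IsTiledBody C R e ν) (i : Fin (n + 1)) {ε : ℝ} (f : ι) (hf : 0 < ε * ν f i) {s : Space n}
    (hs : s ∈ R) {t : ℝ} (htC : insCoord i t (delCoord i (e f s)) ∈ C)
    (ht : ∀ r, insCoord i r (delCoord i (e f s)) ∈ C → ε * r ≤ ε * t) :
    e f s = insCoord i t (delCoord i (e f s)) := by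
  have h1 := ht (e f s i) (by rw [insCoord_delCoord]; exact h.face_mem f hs)
  have h2 := h.outward f s hs _ htC
  have e1 : insCoord i t (delCoord i (e f s)) - e f s
      = (t - e f s i) • EuclideanSpace.single i 1 := by
    rw [insCoord_eq_add i t (e f s i), insCoord_delCoord, add_sub_cancel_left]
  rw [e1, inner_smul_right, EuclideanSpace.inner_single_right] at h2
  simp only [conj_trivial, one_mul] at h2
  have h3 : t = e f s i := by
    rcases lt_trichotomy ε 0 with hε | hε | hε
    · have : ν f i < 0 := by nlinarith
      nlinarith
    · rw [hε, zero_mul] at hf; exact absurd hf (lt_irrefl _)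
    · have : 0 < ν f i := by nlinarith
      nlinarith
  rw [h3, insCoord_delCoord]

/-- For almost every line parallel to a coordinate axis, the extremal point of the section lies on
exactly one face whose normal points to that side. -/
theorem existsUnique_face (h : IsTiledBody C R e ν) (i : Fin (n + 1)) {ε : ℝ} (hε : ε ≠ 0) {y : Space n} {t₀ t : ℝ}
    (ht₀ : insCoord i t₀ y ∈ interior C) (htC : insCoord i t y ∈ C)
    (ht : ∀ r, insCoord i r y ∈ C → ε * r ≤ ε * t)
    (hN : ∀ f, ν f i = 0 → y ∉ (fun s => delCoord i (e f s)) '' R)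
    (hN' : ∀ f, y ∉ (fun s => delCoord i (e f s)) '' frontier R) :
    ∃! f, 0 < ε * ν f i ∧ y ∈ (fun s => delCoord i (e f s)) '' R := by
  have hlt := lt_of_mem_interior i hε ht ht₀
  have hfr : insCoord i t y ∈ frontier C := by
    refine ⟨subset_closure htC, fun hint => ?_⟩
    exact lt_irrefl _ (lt_of_mem_interior i hε ht hint)
  rw [h.cover] at hfr
  obtain ⟨f, s, hs, hfs⟩ := mem_iUnion.1 hfr
  have hy : delCoord i (e f s) = y := by rw [hfs, delCoord_insCoord]
  have hne : ν f i ≠ 0 := fun h0 => hN f h0 ⟨s, hs, hy⟩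
  -- Testing the outward condition with the interior point of the section fixes the sign of `ε * ν f
  -- i`.
  have hout := h.outward f s hs _ (interior_subset ht₀)
  rw [hfs, insCoord_eq_add i t₀ t, add_sub_cancel_left, inner_smul_right,
    EuclideanSpace.inner_single_right] at hout
  simp only [conj_trivial, one_mul] at hout
  have hpos : 0 < ε * ν f i := by
    refine lt_of_le_of_ne ?_ (mul_ne_zero hε hne).symm
    by_contra hneg
    push Not at hneg
    have h1 : 0 < (ε * (t₀ - t)) * (ε * ν f i) := mul_pos_of_neg_of_neg (by linarith) hneg
    have h2 : (ε * (t₀ - t)) * (ε * ν f i) = ε * ε * ((t₀ - t) * ν f i) := by ring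
    have h3 : 0 ≤ ε * ε := mul_self_nonneg _
    nlinarith [mul_nonneg h3 (neg_nonneg.2 hout)]
  refine ⟨f, ⟨hpos, s, hs, hy⟩, ?_⟩
  rintro f' ⟨hf', s', hs', hy'⟩
  simp only at hy'
  by_contra hff
  -- A second such face would contain the same extremal point. Off the projected face boundaries
  -- this point is interior to both faces, contrary to disjointness.
  have h1 : e f' s' = insCoord i t y := by
    have := h.face_eq_insCoord i f' hf' hs' (t := t) (by rwa [hy']) (by rwa [hy'])
    rwa [hy'] at this
  have hint : ∀ {f s}, s ∈ R → delCoord i (e f s) = y → s ∈ interior R := fun {f s} hs hy => by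
    by_contra hn
    exact hN' f ⟨s, ⟨subset_closure hs, hn⟩, hy⟩
  exact (h.disjoint f' f hff).le_bot
    ⟨⟨s', hint hs' hy', h1⟩, ⟨s, hint hs hy, hfs⟩⟩

/-! ### Sections by lines parallel to a coordinate axis -/

/-- The section of `C` by the line over `y` in the direction of the `i`-th axis. -/
def lineSection (C : Set (Space (n + 1))) (i : Fin (n + 1)) (y : Space n) : Set ℝ :=
  {t | insCoord i t y ∈ C}

theorem lineSection_eq_image (i : Fin (n + 1)) (y : Space n) :
    lineSection C i y = (fun x : Space (n + 1) => x i) '' (C ∩ delCoord i ⁻¹' {y}) := by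
  ext t
  constructor
  · exact fun ht => ⟨insCoord i t y, ⟨ht, by simp⟩, by simp⟩
  · rintro ⟨x, ⟨hx, hxy⟩, rfl⟩
    have : delCoord i x = y := hxy
    change insCoord i (x i) y ∈ C
    rwa [← this, insCoord_delCoord]

theorem isCompact_lineSection (h : IsTiledBody C R e ν) (i : Fin (n + 1)) (y : Space n) :
    IsCompact (lineSection C i y) := by
  rw [lineSection_eq_image]
  exact (h.compact.inter_right (isClosed_singleton.preimage (delCoord i).continuous)).image
    (by fun_prop)

theorem lineSection_eq_Icc (h : IsTiledBody C R e ν) (i : Fin (n + 1)) {y : Space n}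
    (hy : (lineSection C i y).Nonempty) :
    lineSection C i y = Icc (sInf (lineSection C i y)) (sSup (lineSection C i y)) := by
  refine eq_Icc_of_connected_compact ⟨hy, ?_⟩ (h.isCompact_lineSection i y)
  rw [lineSection_eq_image]
  refine IsPreconnected.image ?_ _ (by fun_prop)
  exact (h.convex.inter ((convex_singleton y).linear_preimage
    (delCoord i).toLinearMap)).isPreconnected

/-- Integration of a derivative along a section. -/
theorem integral_lineSection (h : IsTiledBody C R e ν) (i : Fin (n + 1)) {f : Space (n + 1) → ℝ}
    {f' : Space (n + 1) → (Space (n + 1) →L[ℝ] ℝ)} (hf : ∀ x ∈ C, HasFDerivAt f (f' x) x)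
    (hf' : ContinuousOn f' C) {y : Space n} (hy : (lineSection C i y).Nonempty) :
    ∫ t, C.indicator (fun x => f' x (EuclideanSpace.single i 1)) (insCoord i t y)
      = f (insCoord i (sSup (lineSection C i y)) y) - f (insCoord i (sInf (lineSection C i y)) y) := by
  have hS := h.lineSection_eq_Icc i hy
  have hle : sInf (lineSection C i y) ≤ sSup (lineSection C i y) := by
    rw [hS] at hy; exact nonempty_Icc.1 hy
  have e1 : (fun t => C.indicator (fun x => f' x (EuclideanSpace.single i 1)) (insCoord i t y))
      = (lineSection C i y).indicator
        (fun t => f' (insCoord i t y) (EuclideanSpace.single i 1)) := by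
    funext t
    by_cases ht : insCoord i t y ∈ C
    · rw [indicator_of_mem ht, indicator_of_mem (show t ∈ lineSection C i y from ht)]
    · rw [indicator_of_notMem ht, indicator_of_notMem (show t ∉ lineSection C i y from ht)]
  have hcont : Continuous fun t => insCoord i t y :=
    continuous_iff_continuousAt.2 fun t => (hasDerivAt_insCoord i t y).continuousAt
  rw [e1, integral_indicator (h.isCompact_lineSection i y).measurableSet]
  nth_rewrite 1 [hS]
  rw [integral_Icc_eq_integral_Ioc, ← intervalIntegral.integral_of_le hle]
  refine intervalIntegral.integral_eq_sub_of_hasDerivAt (f := fun t => f (insCoord i t y)) ?_ ?_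
  · intro t ht
    rw [uIcc_of_le hle, ← hS] at ht
    exact (hf _ ht).comp_hasDerivAt t (hasDerivAt_insCoord i t y)
  · refine ContinuousOn.intervalIntegrable ?_
    rw [uIcc_of_le hle, ← hS]
    exact (hf'.comp hcont.continuousOn fun t ht => ht).clm_apply continuousOn_const

/-- The value at the end point of the section over `y` on the side of the face `f`, with the sign
of the normal component. -/
def endValue (C : Set (Space (n + 1))) (ν : ι → Space (n + 1)) (i : Fin (n + 1))
    (f : Space (n + 1) → ℝ) (F : ι) (y : Space n) : ℝ :=
  if 0 < ν F i then f (insCoord i (sSup (lineSection C i y)) y)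
  else if ν F i < 0 then -f (insCoord i (sInf (lineSection C i y)) y) else 0

/-- A face with positive component `ν F i` lies at the upper end of the section, and one with
negative component at the lower end. When the component vanishes both sides are zero. -/
theorem endValue_face (h : IsTiledBody C R e ν) (i : Fin (n + 1)) (f : Space (n + 1) → ℝ) (F : ι)
    {s : Space n} (hs : s ∈ R) :
    |ν F i| * endValue C ν i f F (delCoord i (e F s)) = ν F i * f (e F s) := by
  have hne : (lineSection C i (delCoord i (e F s))).Nonempty :=
    ⟨e F s i, by change insCoord _ _ _ ∈ C; rw [insCoord_delCoord]; exact h.face_mem F hs⟩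
  have hc := h.isCompact_lineSection i (delCoord i (e F s))
  rw [endValue]
  split_ifs with h1 h2
  · rw [abs_of_pos h1, ← h.face_eq_insCoord i (ε := 1) F (by rwa [one_mul]) hs
      (hc.sSup_mem hne) fun r hr => by
        rw [one_mul, one_mul]; exact le_csSup hc.bddAbove hr]
  · rw [abs_of_neg h2, ← h.face_eq_insCoord i (ε := -1) F (by linarith) hs
      (hc.sInf_mem hne) fun r hr => by
        have := csInf_le hc.bddBelow hr
        linarith]
    ring
  · have : ν F i = 0 := le_antisymm (not_lt.1 h1) (not_lt.1 h2)
    rw [this]; simp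

theorem hasFDerivWithinAt_face (i : Fin (n + 1)) (F : ι) (s : Space n) :
    HasFDerivWithinAt (fun s => delCoord i (e F s))
      ((delCoord i).comp (LinearMap.toContinuousLinearMap (e F).linear)) R s :=
  ((delCoord i).hasFDerivAt.comp s (hasFDerivAt_affine (e F) s)).hasFDerivWithinAt

theorem sqrt_det_gram_pos (h : IsTiledBody C R e ν) (F : ι) :
    0 < Real.sqrt (Matrix.gram ℝ (colVec (e F))).det := by
  rw [← abs_det_consMat_unit (h.inner_colVec F) (h.norm_normal F)]
  exact abs_pos.2 (det_consMat_ne_zero (h.inner_colVec F)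
    (norm_ne_zero_iff.1 (by rw [h.norm_normal]; exact one_ne_zero))
    (linearIndependent_colVec (h.injective F)))

theorem measurableSet_face (h : IsTiledBody C R e ν) (i : Fin (n + 1)) (F : ι) :
    MeasurableSet ((fun s => delCoord i (e F s)) '' R) :=
  (h.face_compact.image ((delCoord i).continuous.comp (continuous_affine (e F)))).measurableSet

theorem injOn_face (h : IsTiledBody C R e ν) {i : Fin (n + 1)} {F : ι} (hF : ν F i ≠ 0) :
    InjOn (fun s => delCoord i (e F s)) R := by
  have hdet : ((delCoord i).comp (LinearMap.toContinuousLinearMap (e F).linear)).det ≠ 0 := by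
    rw [← abs_pos, h.abs_det_delCoord i F]
    exact mul_pos (abs_pos.2 hF) (h.sqrt_det_gram_pos F)
  intro s _ s' _ hss
  have h1 : (delCoord i).comp (LinearMap.toContinuousLinearMap (e F).linear) (s - s') = 0 := by
    have : (e F).linear (s - s') = e F s - e F s' := by
      rw [← vsub_eq_sub, AffineMap.linearMap_vsub, vsub_eq_sub]
    rw [ContinuousLinearMap.comp_apply, LinearMap.coe_toContinuousLinearMap', this, map_sub]
    exact sub_eq_zero.2 hss
  by_contra hne
  refine hdet ?_
  refine LinearMap.det_eq_zero_iff_ker_ne_bot.2 fun hk => hne ?_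
  exact sub_eq_zero.1 ((LinearMap.ker_eq_bot'.1 hk) _ h1)

/-- Change of variables along the projection of the face. Its Jacobian supplies `|ν F i|`, and the
sign in `endValue` restores `ν F i`. -/
theorem integral_endValue (h : IsTiledBody C R e ν) (i : Fin (n + 1)) {f : Space (n + 1) → ℝ}
    (hf : ContinuousOn f C) (F : ι) :
    IntegrableOn (endValue C ν i f F) ((fun s => delCoord i (e F s)) '' R) ∧
    ∫ y in (fun s => delCoord i (e F s)) '' R, endValue C ν i f F y
      = ∫ s in R, f (e F s) * (ν F i * Real.sqrt (Matrix.gram ℝ (colVec (e F))).det) := by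
  have hR := h.face_compact.measurableSet
  by_cases h0 : ν F i = 0
  · have : endValue C ν i f F = fun _ => 0 := by
      funext y; simp [endValue, h0]
    rw [this, h0]
    simp
  · have key : ∀ s ∈ R, |((delCoord i).comp (LinearMap.toContinuousLinearMap (e F).linear)).det|
        • endValue C ν i f F (delCoord i (e F s))
        = f (e F s) * (ν F i * Real.sqrt (Matrix.gram ℝ (colVec (e F))).det) := fun s hs => by
      rw [h.abs_det_delCoord i F, smul_eq_mul, mul_right_comm, h.endValue_face i f F hs]
      ring
    constructor
    · rw [integrableOn_image_iff_integrableOn_abs_det_fderiv_smul volume hR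
        (fun s _ => hasFDerivWithinAt_face i F s) (h.injOn_face h0)]
      refine IntegrableOn.congr_fun ?_ (fun s hs => (key s hs).symm) hR
      refine ContinuousOn.integrableOn_compact h.face_compact (ContinuousOn.mul ?_ continuousOn_const)
      exact hf.comp (continuous_affine (e F)).continuousOn fun s hs => h.face_mem F hs
    · rw [integral_image_eq_integral_abs_det_fderiv_smul volume hR
        (fun s _ => hasFDerivWithinAt_face i F s) (h.injOn_face h0)]
      exact setIntegral_congr_fun hR key

/-- Outside three kinds of null sets, a line either misses the body or enters and leaves it through
exactly one face each. The null sets are the projections of faces parallel to the axis, the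
projections of face boundaries, and the frontier of the projected interior. -/
theorem ae_integral_eq_sum_endValue (h : IsTiledBody C R e ν) [Fintype ι] (i : Fin (n + 1))
    {f : Space (n + 1) → ℝ} {f' : Space (n + 1) → (Space (n + 1) →L[ℝ] ℝ)}
    (hf : ∀ x ∈ C, HasFDerivAt f (f' x) x) (hf' : ContinuousOn f' C) :
    ∀ᵐ y : Space n,
      ∫ t, C.indicator (fun x => f' x (EuclideanSpace.single i 1)) (insCoord i t y)
        = ∑ F, ((fun s => delCoord i (e F s)) '' R).indicator (endValue C ν i f F) y := by
  have hNull : ∀ F, ν F i = 0 → volume ((fun s => delCoord i (e F s)) '' R) = 0 := fun F hF => by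
    refine addHaar_image_eq_zero_of_det_fderivWithin_eq_zero volume
      (fun s _ => hasFDerivWithinAt_face i F s) fun s _ => ?_
    rw [← abs_eq_zero, h.abs_det_delCoord i F, hF, abs_zero, zero_mul]
  have hNull' : ∀ F, volume ((fun s => delCoord i (e F s)) '' frontier R) = 0 := fun F =>
    addHaar_image_eq_zero_of_differentiableOn_of_addHaar_eq_zero volume
      (fun s _ => (hasFDerivWithinAt_face i F s).differentiableWithinAt)
      (h.face_convex.addHaar_frontier volume)
  have hopen : IsOpen (delCoord i '' interior C) := by
    refine (delCoord i).isOpenMap (fun y => ⟨insCoord i 0 y, by simp⟩) _ isOpen_interior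
  have hconv : Convex ℝ (delCoord i '' interior C) :=
    h.convex.interior.linear_image (delCoord i).toLinearMap
  have hfr : volume (frontier (delCoord i '' interior C)) = 0 := hconv.addHaar_frontier volume
  have hsub : delCoord i '' C ⊆ closure (delCoord i '' interior C) := by
    have : C = closure (interior C) := by
      rw [h.convex.closure_interior_eq_closure_of_nonempty_interior h.interior_nonempty,
        h.compact.isClosed.closure_eq]
    rw [this]
    exact (image_closure_subset_closure_image (delCoord i).continuous).trans
      (closure_mono (image_mono (by rw [← this])))
  have hface : ∀ F, (fun s => delCoord i (e F s)) '' R ⊆ delCoord i '' C := by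
    rintro F _ ⟨s, hs, rfl⟩
    exact ⟨_, h.face_mem F hs, rfl⟩
  have a1 : ∀ᵐ y : Space n, ∀ F, ν F i = 0 → y ∉ (fun s => delCoord i (e F s)) '' R :=
    ae_all_iff.2 fun F => by
      by_cases hF : ν F i = 0
      · filter_upwards [measure_eq_zero_iff_ae_notMem.1 (hNull F hF)] with y hy _ using hy
      · exact Filter.Eventually.of_forall fun y h0 => absurd h0 hF
  have a2 : ∀ᵐ y : Space n, ∀ F, y ∉ (fun s => delCoord i (e F s)) '' frontier R :=
    ae_all_iff.2 fun F => measure_eq_zero_iff_ae_notMem.1 (hNull' F)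
  filter_upwards [a1, a2, measure_eq_zero_iff_ae_notMem.1 hfr] with y hN hN' hyfr
  by_cases hyC : y ∈ delCoord i '' interior C
  · obtain ⟨x₀, hx₀, rfl⟩ := hyC
    set y := delCoord i x₀
    have ht₀ : insCoord i (x₀ i) y ∈ interior C := by rwa [insCoord_delCoord]
    have hne : (lineSection C i y).Nonempty :=
      ⟨x₀ i, interior_subset (s := C) ht₀⟩
    have hc := h.isCompact_lineSection i y
    obtain ⟨F₁, ⟨hF₁, hF₁y⟩, hu₁⟩ := h.existsUnique_face i one_ne_zero ht₀ (hc.sSup_mem hne)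
      (fun r hr => by rw [one_mul, one_mul]; exact le_csSup hc.bddAbove hr) hN hN'
    obtain ⟨F₂, ⟨hF₂, hF₂y⟩, hu₂⟩ := h.existsUnique_face i (neg_ne_zero.2 one_ne_zero) ht₀
      (hc.sInf_mem hne) (fun r hr => by
        have := csInf_le hc.bddBelow hr
        linarith) hN hN'
    have hF₁' : 0 < ν F₁ i := by linarith
    have hF₂' : ν F₂ i < 0 := by linarith
    have hne12 : F₁ ≠ F₂ := fun he => by rw [he] at hF₁'; linarith
    -- Only the entry face `F₂` and the exit face `F₁` contribute to the sum.
    rw [h.integral_lineSection i hf hf' hne, Fintype.sum_eq_add F₁ F₂ hne12]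
    · rw [indicator_of_mem hF₁y, indicator_of_mem hF₂y, endValue, endValue, if_pos hF₁',
        if_neg (not_lt.2 hF₂'.le), if_pos hF₂', sub_eq_add_neg]
    · rintro F ⟨hF1, hF2⟩
      by_cases hy : y ∈ (fun s => delCoord i (e F s)) '' R
      · rcases lt_trichotomy (ν F i) 0 with hlt | heq | hgt
        · exact absurd (hu₂ F ⟨by linarith, hy⟩) hF2
        · exact absurd hy (hN F heq)
        · exact absurd (hu₁ F ⟨by linarith, hy⟩) hF1
      · exact indicator_of_notMem hy _
  · have hy' : y ∉ delCoord i '' C := fun hy => hyfr ⟨hsub hy, by rwa [hopen.interior_eq]⟩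
    rw [Finset.sum_eq_zero fun F _ => indicator_of_notMem (fun hy => hy' (hface F hy)) _]
    have : ∀ t, C.indicator (fun x => f' x (EuclideanSpace.single i 1)) (insCoord i t y) = 0 :=
      fun t => indicator_of_notMem (fun ht => hy' ⟨_, ht, by simp⟩) _
    simp [this]

/-- The divergence theorem for one coordinate direction. -/
theorem integral_fderiv_single (h : IsTiledBody C R e ν) [Fintype ι] (i : Fin (n + 1))
    {f : Space (n + 1) → ℝ} {f' : Space (n + 1) → (Space (n + 1) →L[ℝ] ℝ)}
    (hf : ∀ x ∈ C, HasFDerivAt f (f' x) x) (hf' : ContinuousOn f' C) :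
    ∫ x in C, f' x (EuclideanSpace.single i 1)
      = ∑ F, ∫ s in R, f (e F s) * (ν F i * Real.sqrt (Matrix.gram ℝ (colVec (e F))).det) := by
  have hC := h.compact.measurableSet
  have hfc : ContinuousOn f C := fun x hx => (hf x hx).continuousAt.continuousWithinAt
  have hint : Integrable (C.indicator fun x => f' x (EuclideanSpace.single i 1)) :=
    (integrable_indicator_iff hC).2
      ((hf'.clm_apply continuousOn_const).integrableOn_compact h.compact)
  rw [← integral_indicator hC, integral_eq_integral_insCoord i hint,
    integral_congr_ae (h.ae_integral_eq_sum_endValue i hf hf'), integral_finsetSum]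
  · exact Finset.sum_congr rfl fun F _ => by
      rw [integral_indicator (h.measurableSet_face i F), (h.integral_endValue i hfc F).2]
  · exact fun F _ => (integrable_indicator_iff (h.measurableSet_face i F)).2
      (h.integral_endValue i hfc F).1

end IsTiledBody

end

section

/-! ### Polynomial maps -/

/-- Evaluation of a polynomial at a point of Euclidean space. -/
def polyEval (P : MvPolynomial (Fin d) ℝ) (ξ : Space d) : ℝ := MvPolynomial.eval (fun j => ξ j) P

/-- The derivative of a polynomial function. -/
def polyDeriv (P : MvPolynomial (Fin d) ℝ) (ξ : Space d) : Space d →L[ℝ] ℝ :=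
  ∑ j, polyEval (MvPolynomial.pderiv j P) ξ • EuclideanSpace.proj j

theorem polyDeriv_apply (P : MvPolynomial (Fin d) ℝ) (ξ z : Space d) :
    polyDeriv P ξ z = ∑ j, polyEval (MvPolynomial.pderiv j P) ξ * z j := by
  simp [polyDeriv]

theorem polyDeriv_single (P : MvPolynomial (Fin d) ℝ) (ξ : Space d) (j : Fin d) :
    polyDeriv P ξ (EuclideanSpace.single j 1) = polyEval (MvPolynomial.pderiv j P) ξ := by
  simp [polyDeriv_apply]

theorem contDiff_polyEval (P : MvPolynomial (Fin d) ℝ) : ContDiff ℝ ⊤ (polyEval P) := by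
  unfold polyEval
  induction P using MvPolynomial.induction_on with
  | C a => simp only [MvPolynomial.eval_C]; exact contDiff_const
  | add p q hp hq => simp only [map_add]; exact hp.add hq
  | mul_X p i hp => simp only [map_mul, MvPolynomial.eval_X]; exact hp.mul (by fun_prop)

theorem continuous_polyEval (P : MvPolynomial (Fin d) ℝ) : Continuous (polyEval P) :=
  (contDiff_polyEval P).continuous

theorem hasFDerivAt_polyEval (P : MvPolynomial (Fin d) ℝ) (ξ : Space d) :
    HasFDerivAt (polyEval P) (polyDeriv P ξ) ξ := by
  induction P using MvPolynomial.induction_on with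
  | C a =>
    have : polyDeriv (MvPolynomial.C a) ξ = 0 := by
      ext z; simp [polyDeriv, polyEval]
    rw [this]
    refine (hasFDerivAt_const a ξ).congr_of_eventuallyEq (Filter.Eventually.of_forall fun x => ?_)
    simp [polyEval]
  | add p q hp hq =>
    refine ((hp.add hq).congr_fderiv ?_).congr_of_eventuallyEq
      (Filter.Eventually.of_forall fun x => ?_)
    · simp [polyDeriv, polyEval, add_smul, Finset.sum_add_distrib]
    · simp [polyEval]
  | mul_X p i hp =>
    have hX : HasFDerivAt (fun ξ : Space d => ξ i) (EuclideanSpace.proj i : Space d →L[ℝ] ℝ) ξ :=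
      (EuclideanSpace.proj i : Space d →L[ℝ] ℝ).hasFDerivAt
    refine ((hp.mul hX).congr_fderiv ?_).congr_of_eventuallyEq
      (Filter.Eventually.of_forall fun x => ?_)
    · ext z
      simp only [add_apply, smul_apply, polyDeriv_apply, smul_eq_mul, MvPolynomial.pderiv_mul,
        MvPolynomial.pderiv_X, polyEval, map_add, map_mul, MvPolynomial.eval_X, add_mul,
        Finset.sum_add_distrib, Finset.mul_sum]
      rw [add_comm]
      congr 1
      · exact Finset.sum_congr rfl fun j _ => by ring
      · rw [Finset.sum_eq_single i]
        · simp
        · intro j _ hj; simp [hj.symm]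
        · simp
    · simp [polyEval]

theorem continuous_polyDeriv (P : MvPolynomial (Fin d) ℝ) : Continuous (polyDeriv P) := by
  unfold polyDeriv
  exact continuous_finsetSum _ fun j _ => (continuous_polyEval _).smul continuous_const

/-- The commutator of two derivations is a derivation, and here it kills every variable. -/
theorem pderiv_comm (i j : Fin d) (P : MvPolynomial (Fin d) ℝ) :
    MvPolynomial.pderiv i (MvPolynomial.pderiv j P)
      = MvPolynomial.pderiv j (MvPolynomial.pderiv i P) := by
  have h : ⁅MvPolynomial.pderiv (R := ℝ) i, MvPolynomial.pderiv j⁆ = 0 :=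
    MvPolynomial.derivation_ext fun k => by
      rw [Derivation.commutator_apply]
      simp [MvPolynomial.pderiv_X, Pi.single_apply, apply_ite]
  have := congrArg (fun D => D P) h
  rw [Derivation.commutator_apply] at this
  exact sub_eq_zero.1 this

/-- The Jacobian matrix of a polynomial map. -/
def polyJac (P : Fin d → MvPolynomial (Fin d) ℝ) :
    Matrix (Fin d) (Fin d) (MvPolynomial (Fin d) ℝ) :=
  Matrix.of fun i j => MvPolynomial.pderiv j (P i)

/-- Piola's identity: the columns of the cofactor matrix are divergence free. -/
theorem piola_identity (hd : 1 ≤ d) (hd3 : d ≤ 3) (P : Fin d → MvPolynomial (Fin d) ℝ) (j : Fin d) :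
    ∑ i, MvPolynomial.pderiv i ((polyJac P).adjugate i j) = 0 := by
  -- The dimension bound is used here: the cofactors are written out explicitly, and the terms
  -- cancel by commutation of second derivatives.
  interval_cases d
  · simp [Matrix.adjugate_subsingleton, Subsingleton.elim _ j]
  · rw [Matrix.adjugate_fin_two]
    fin_cases j <;> simp [Fin.sum_univ_two, polyJac, pderiv_comm (1 : Fin 2) 0]
  · rw [Matrix.adjugate_fin_three]
    fin_cases j <;>
    · simp [Fin.sum_univ_three, polyJac, pderiv_comm (1 : Fin 3) 0, pderiv_comm (2 : Fin 3) 0,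
        pderiv_comm (2 : Fin 3) 1]
      ring

/-- The map of Euclidean space with polynomial components `P`. -/
def polyMap (P : Fin d → MvPolynomial (Fin d) ℝ) (ξ : Space d) : Space d :=
  WithLp.toLp 2 fun i => polyEval (P i) ξ

/-- The derivative of `polyMap`. -/
def polyMapDeriv (P : Fin d → MvPolynomial (Fin d) ℝ) (ξ : Space d) : Space d →L[ℝ] Space d :=
  (PiLp.continuousLinearEquiv 2 ℝ fun _ : Fin d => ℝ).symm.toContinuousLinearMap.comp
    (ContinuousLinearMap.pi fun i => polyDeriv (P i) ξ)

@[simp] theorem polyMapDeriv_apply (P : Fin d → MvPolynomial (Fin d) ℝ) (ξ z : Space d)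
    (i : Fin d) : polyMapDeriv P ξ z i = polyDeriv (P i) ξ z := rfl

theorem hasFDerivAt_polyMap (P : Fin d → MvPolynomial (Fin d) ℝ) (ξ : Space d) :
    HasFDerivAt (polyMap P) (polyMapDeriv P ξ) ξ :=
  (PiLp.continuousLinearEquiv 2 ℝ fun _ : Fin d => ℝ).symm.hasFDerivAt.comp ξ
    (hasFDerivAt_pi.2 fun i => hasFDerivAt_polyEval (P i) ξ)

theorem contDiff_polyMap (P : Fin d → MvPolynomial (Fin d) ℝ) : ContDiff ℝ ⊤ (polyMap P) :=
  (PiLp.continuousLinearEquiv 2 ℝ fun _ : Fin d => ℝ).symm.contDiff.comp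
    (contDiff_pi.2 fun i => contDiff_polyEval (P i))

theorem continuous_polyMapDeriv (P : Fin d → MvPolynomial (Fin d) ℝ) :
    Continuous (polyMapDeriv P) := by
  have h : ContDiff ℝ ⊤ (polyMap P) := contDiff_polyMap P
  have h1 : polyMapDeriv P = fderiv ℝ (polyMap P) :=
    funext fun ξ => (hasFDerivAt_polyMap P ξ).fderiv.symm
  rw [h1]
  exact h.continuous_fderiv (by simp)

/-- The vector of entropy variables with polynomial components `Q`. -/
def polyState (Q : Comp d → MvPolynomial (Fin d) ℝ) (ξ : Space d) : State d :=
  fun c => polyEval (Q c) ξ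

/-- The derivative of `polyState`. -/
def polyStateDeriv (Q : Comp d → MvPolynomial (Fin d) ℝ) (ξ : Space d) : Space d →L[ℝ] State d :=
  ContinuousLinearMap.pi fun c => polyDeriv (Q c) ξ

@[simp] theorem polyStateDeriv_apply (Q : Comp d → MvPolynomial (Fin d) ℝ) (ξ z : Space d)
    (c : Comp d) : polyStateDeriv Q ξ z c = polyDeriv (Q c) ξ z := rfl

theorem hasFDerivAt_polyState (Q : Comp d → MvPolynomial (Fin d) ℝ) (ξ : Space d) :
    HasFDerivAt (polyState Q) (polyStateDeriv Q ξ) ξ :=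
  hasFDerivAt_pi.2 fun c => hasFDerivAt_polyEval (Q c) ξ

theorem continuous_polyState (Q : Comp d → MvPolynomial (Fin d) ℝ) : Continuous (polyState Q) :=
  continuous_pi fun c => continuous_polyEval (Q c)

/-- The entries of the adjugate of the Jacobian matrix. -/
def cof (P : Fin d → MvPolynomial (Fin d) ℝ) (i j : Fin d) : MvPolynomial (Fin d) ℝ :=
  (polyJac P).adjugate i j

theorem continuousOn_flux {γ : ℝ} (hγ : 1 < γ) (s₀ : ℝ) (c : Comp d) (j : Fin d) :
    ContinuousOn (fun v => flux γ (consVar γ s₀ v) c j) (negLast d) := by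
  have h := (contDiffOn_normalFlux_consVar hγ s₀ (EuclideanSpace.single j 1)).continuousOn
  refine (continuousOn_pi.1 h c).congr fun v _ => ?_
  simp [normalFlux]

/-- The divergence theorem for the flux potential on the reference element, with the Piola
transform of a polynomial map. -/
theorem IsTiledBody.integral_flux_cof {n : ℕ} (hn : n + 1 ≤ 3) {ι : Type*} [Fintype ι]
    {C : Set (Space (n + 1))} {R : Set (Space n)} {e : ι → Space n →ᵃ[ℝ] Space (n + 1)}
    {ν : ι → Space (n + 1)} (h : IsTiledBody C R e ν) {γ : ℝ} (hγ : 1 < γ) (s₀ : ℝ)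
    (P : Fin (n + 1) → MvPolynomial (Fin (n + 1)) ℝ)
    (Q : Comp (n + 1) → MvPolynomial (Fin (n + 1)) ℝ)
    (hQ : ∀ ξ ∈ C, polyState Q ξ ∈ negLast (n + 1)) :
    ∫ ξ in C, ∑ c, ∑ j, flux γ (consVar γ s₀ (polyState Q ξ)) c j
        * ∑ l, polyEval (cof P l j) ξ * polyEval (MvPolynomial.pderiv l (Q c)) ξ
      = ∑ F, ∫ s in R, (∑ j, fluxPotential γ s₀ j (polyState Q (e F s))
          * ∑ i, polyEval (cof P i j) (e F s) * ν F i)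
          * Real.sqrt (Matrix.gram ℝ (colVec (e F))).det := by
  set Ψ : Fin (n + 1) → Space (n + 1) → ℝ := fun j ξ => fluxPotential γ s₀ j (polyState Q ξ)
  set Ψ' : Fin (n + 1) → Space (n + 1) → (Space (n + 1) →L[ℝ] ℝ) := fun j ξ =>
    (dotCL fun c => flux γ (consVar γ s₀ (polyState Q ξ)) c j).comp (polyStateDeriv Q ξ)
  have hΨ : ∀ j, ∀ ξ ∈ C, HasFDerivAt (Ψ j) (Ψ' j ξ) ξ := fun j ξ hξ =>
    (hasFDerivAt_fluxPotential hγ s₀ (hQ ξ hξ) j).comp ξ (hasFDerivAt_polyState Q ξ)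
  have hΨc : ∀ j, ContinuousOn (Ψ j) C := fun j ξ hξ =>
    (hΨ j ξ hξ).continuousAt.continuousWithinAt
  have hflux : ∀ c j, ContinuousOn (fun ξ => flux γ (consVar γ s₀ (polyState Q ξ)) c j) C :=
    fun c j => (continuousOn_flux hγ s₀ c j).comp (continuous_polyState Q).continuousOn hQ
  have hΨ'c : ∀ j, ContinuousOn (Ψ' j) C := fun j => by
    refine continuousOn_clm_apply.2 fun z => ?_
    simp only [Ψ', ContinuousLinearMap.comp_apply, dotCL_apply, dotProduct, polyStateDeriv_apply]
    exact continuousOn_finsetSum _ fun c _ => (hflux c j).mul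
      ((continuous_polyDeriv (Q c)).clm_apply continuous_const).continuousOn
  set f : Fin (n + 1) → Space (n + 1) → ℝ := fun i ξ => ∑ j, Ψ j ξ * polyEval (cof P i j) ξ
  set f' : Fin (n + 1) → Space (n + 1) → (Space (n + 1) →L[ℝ] ℝ) := fun i ξ =>
    ∑ j, (Ψ j ξ • polyDeriv (cof P i j) ξ + polyEval (cof P i j) ξ • Ψ' j ξ)
  have hf : ∀ i, ∀ ξ ∈ C, HasFDerivAt (f i) (f' i ξ) ξ := fun i ξ hξ =>
    HasFDerivAt.fun_sum fun j _ => (hΨ j ξ hξ).mul (hasFDerivAt_polyEval (cof P i j) ξ)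
  have hf' : ∀ i, ContinuousOn (f' i) C := fun i => continuousOn_finsetSum _ fun j _ =>
    ((hΨc j).smul (continuous_polyDeriv _).continuousOn).add
      ((continuous_polyEval _).continuousOn.smul (hΨ'c j))
  -- By Piola's identity the terms that differentiate the cofactors vanish in the divergence. Only
  -- the derivatives of the potentials remain, and these are the flux contracted with the gradient
  -- of the state.
  have hdiv : ∀ ξ, ∑ c, ∑ j, flux γ (consVar γ s₀ (polyState Q ξ)) c j
        * ∑ l, polyEval (cof P l j) ξ * polyEval (MvPolynomial.pderiv l (Q c)) ξ
      = ∑ i, f' i ξ (EuclideanSpace.single i 1) := fun ξ => by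
    have hp : ∀ j, ∑ i, polyEval (MvPolynomial.pderiv i (cof P i j)) ξ = 0 := fun j => by
      have := congrArg (fun p => polyEval p ξ) (piola_identity (by omega) hn P j)
      simpa [polyEval, cof] using this
    have e1 : ∀ i, f' i ξ (EuclideanSpace.single i 1)
        = ∑ j, (Ψ j ξ * polyEval (MvPolynomial.pderiv i (cof P i j)) ξ
          + polyEval (cof P i j) ξ * ∑ c, flux γ (consVar γ s₀ (polyState Q ξ)) c j
            * polyEval (MvPolynomial.pderiv i (Q c)) ξ) := fun i => by
      simp [f', Ψ', polyDeriv_single, dotProduct]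
    simp only [e1]
    simp only [Finset.sum_add_distrib]
    rw [Finset.sum_comm (f := fun i j => Ψ j ξ * polyEval (MvPolynomial.pderiv i (cof P i j)) ξ)]
    simp only [← Finset.mul_sum, hp, mul_zero, Finset.sum_const_zero, zero_add]
    simp only [Finset.mul_sum]
    rw [Finset.sum_comm]
    rw [Finset.sum_comm (s := Finset.univ (α := Fin (n + 1))) (t := Finset.univ (α := Fin (n + 1)))
      (f := fun i j => ∑ c, polyEval (cof P i j) ξ * (flux γ (consVar γ s₀ (polyState Q ξ)) c j
            * polyEval (MvPolynomial.pderiv i (Q c)) ξ))]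
    refine Finset.sum_congr rfl fun j _ => ?_
    rw [Finset.sum_comm]
    exact Finset.sum_congr rfl fun l _ => Finset.sum_congr rfl fun c _ => by ring
  have hIL : ∀ i, IntegrableOn (fun ξ => f' i ξ (EuclideanSpace.single i 1)) C := fun i =>
    ((hf' i).clm_apply continuousOn_const).integrableOn_compact h.compact
  have hIR : ∀ i F, IntegrableOn (fun s => f i (e F s)
      * (ν F i * Real.sqrt (Matrix.gram ℝ (colVec (e F))).det)) R := fun i F => by
    refine ContinuousOn.integrableOn_compact h.face_compact (ContinuousOn.mul ?_ continuousOn_const)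
    have hfc : ContinuousOn (f i) C := fun x hx => (hf i x hx).continuousAt.continuousWithinAt
    exact hfc.comp (continuous_affine (e F)).continuousOn fun s hs => h.face_mem F hs
  simp_rw [hdiv]
  rw [integral_finsetSum _ fun i _ => hIL i]
  simp_rw [fun i => h.integral_fderiv_single i (hf i) (hf' i)]
  rw [Finset.sum_comm]
  refine Finset.sum_congr rfl fun F _ => ?_
  rw [← integral_finsetSum _ fun i _ => hIR i F]
  refine integral_congr_ae (Filter.Eventually.of_forall fun s => ?_)
  simp only [f, Finset.sum_mul, Finset.mul_sum]
  rw [Finset.sum_comm]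
  exact Finset.sum_congr rfl fun j _ => Finset.sum_congr rfl fun i _ => by ring

/-! ### Transformation of normals and surface elements -/

theorem inverse_apply_of_det_ne_zero {A : Space d →L[ℝ] Space d} (hA : A.det ≠ 0) (x : Space d) :
    A.inverse (A x) = x ∧ A (A.inverse x) = x := by
  have h1 : A = (A.toContinuousLinearEquivOfDetNeZero hA : Space d →L[ℝ] Space d) :=
    (A.coe_toContinuousLinearEquivOfDetNeZero hA).symm
  have h2 : A.inverse = ((A.toContinuousLinearEquivOfDetNeZero hA).symm : Space d →L[ℝ] Space d) := by
    rw [← ContinuousLinearMap.inverse_equiv]; congr 1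
  constructor
  · rw [h2]; exact (A.toContinuousLinearEquivOfDetNeZero hA).symm_apply_apply x
  · rw [h2]; exact (A.toContinuousLinearEquivOfDetNeZero hA).apply_symm_apply x

/-- The (not normalized) image of a normal vector under a linear map. -/
def pushNormal (A : Space d →L[ℝ] Space d) (ν : Space d) : Space d :=
  ContinuousLinearMap.adjoint A.inverse ν

theorem inner_pushNormal (A : Space d →L[ℝ] Space d) (ν x : Space d) :
    inner ℝ (pushNormal A ν) x = inner ℝ ν (A.inverse x) :=
  ContinuousLinearMap.adjoint_inner_left _ _ _

theorem pushNormal_ne_zero {A : Space d →L[ℝ] Space d} (hA : A.det ≠ 0) {ν : Space d}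
    (hν : ν ≠ 0) : pushNormal A ν ≠ 0 := fun h0 => hν <| by
  have := inner_pushNormal A ν (A ν)
  rw [h0, inner_zero_left, (inverse_apply_of_det_ne_zero hA ν).1] at this
  exact inner_self_eq_zero.1 this.symm

theorem consMat_map {n : ℕ} (A : Space (n + 1) →L[ℝ] Space (n + 1)) (x : Space (n + 1))
    (c : Fin n → Space (n + 1)) :
    (consMat (A x) fun a => A (c a)).det = (consMat x c).det * A.det := by
  rw [ContinuousLinearMap.det, ← LinearMap.det_toMatrix (EuclideanSpace.basisFun (Fin (n + 1)) ℝ).toBasis,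
    ← Matrix.det_transpose (LinearMap.toMatrix _ _ _), ← Matrix.det_mul]
  congr 1
  ext i j
  have hA : ∀ z : Space (n + 1), A z j = ∑ k, z k * A (EuclideanSpace.single k 1) j := fun z => by
    conv_lhs => rw [← (EuclideanSpace.basisFun (Fin (n + 1)) ℝ).sum_repr z]
    simp
  rw [Matrix.mul_apply]
  have : (consMat (A x) fun a => A (c a)) i j
      = A ((Fin.cons x c : Fin (n + 1) → Space (n + 1)) i) j := by
    refine Fin.cases ?_ (fun a => ?_) i <;> simp [consMat]
  rw [this, hA]
  refine Finset.sum_congr rfl fun k _ => ?_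
  simp [consMat, LinearMap.toMatrix_apply]

/-- Nanson's formula for the surface element. -/
theorem sqrt_det_gram_map {n : ℕ} {A : Space (n + 1) →L[ℝ] Space (n + 1)} (hA : A.det ≠ 0)
    {ν : Space (n + 1)} {c : Fin n → Space (n + 1)} (hν : ∀ a, inner ℝ ν (c a) = 0)
    (h1 : ‖ν‖ = 1) (hc : LinearIndependent ℝ c) :
    Real.sqrt (Matrix.gram ℝ fun a => A (c a)).det
      = |A.det| * ‖pushNormal A ν‖ * Real.sqrt (Matrix.gram ℝ c).det := by
  set w := pushNormal A ν
  have hw : w ≠ 0 := pushNormal_ne_zero hA (norm_ne_zero_iff.1 (by rw [h1]; exact one_ne_zero))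
  have hw' : ‖w‖ ≠ 0 := norm_ne_zero_iff.2 hw
  have hn1 : ‖‖w‖⁻¹ • w‖ = 1 := by
    rw [norm_smul, norm_inv, norm_norm, inv_mul_cancel₀ hw']
  have hnc : ∀ a, inner ℝ (‖w‖⁻¹ • w) (A (c a)) = 0 := fun a => by
    rw [real_inner_smul_left, inner_pushNormal, (inverse_apply_of_det_ne_zero hA _).1, hν, mul_zero]
  -- Writing the new unit normal as an image under `A` lets the determinant with that row factor
  -- through `det A`.
  have hAn : A (A.inverse (‖w‖⁻¹ • w)) = ‖w‖⁻¹ • w := (inverse_apply_of_det_ne_zero hA _).2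
  rw [← abs_det_consMat_unit hnc hn1, ← hAn, consMat_map, abs_mul, abs_det_consMat _ hν h1 hc,
    real_inner_comm, ← inner_pushNormal, real_inner_smul_right, real_inner_self_eq_norm_sq]
  have : ‖w‖⁻¹ * ‖w‖ ^ 2 = ‖w‖ := by field_simp
  rw [this, abs_norm]
  ring

theorem det_polyMapDeriv (P : Fin d → MvPolynomial (Fin d) ℝ) (ξ : Space d) :
    (polyMapDeriv P ξ).det = polyEval (polyJac P).det ξ := by
  rw [ContinuousLinearMap.det, ← LinearMap.det_toMatrix (EuclideanSpace.basisFun (Fin d) ℝ).toBasis,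
    polyEval, RingHom.map_det]
  congr 1
  ext i j
  simp [LinearMap.toMatrix_apply, polyJac, polyDeriv_single, polyEval]

/-- Cramer's rule: the adjugate is the determinant times the inverse. Clearing the denominator
leaves a polynomial expression, to which Piola's identity applies. -/
theorem polyMapDeriv_inverse {P : Fin d → MvPolynomial (Fin d) ℝ} {ξ : Space d}
    (hξ : (polyMapDeriv P ξ).det ≠ 0) (x : Space d) (l : Fin d) :
    (polyMapDeriv P ξ).det * (polyMapDeriv P ξ).inverse x l
      = ∑ j, polyEval (cof P l j) ξ * x j := by
  obtain ⟨z, rfl⟩ : ∃ z, x = polyMapDeriv P ξ z := ⟨_, (inverse_apply_of_det_ne_zero hξ x).2.symm⟩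
  rw [(inverse_apply_of_det_ne_zero hξ z).1]
  simp only [polyMapDeriv_apply, polyDeriv_apply, Finset.mul_sum]
  rw [Finset.sum_comm]
  have h1 : ∀ k, ∑ j, polyEval (cof P l j) ξ * polyEval (MvPolynomial.pderiv k (P j)) ξ
      = if l = k then polyEval (polyJac P).det ξ else 0 := fun k => by
    have h2 := congrArg (fun M => polyEval (M l k) ξ) (Matrix.adjugate_mul (polyJac P))
    simp only [Matrix.mul_apply, Matrix.smul_apply, Matrix.one_apply, smul_eq_mul, polyEval,
      map_sum, map_mul] at h2
    rw [apply_ite (MvPolynomial.eval fun j => ξ j), map_one, map_zero, mul_ite, mul_one,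
      mul_zero] at h2
    exact h2
  simp only [← mul_assoc, ← Finset.sum_mul, h1, ite_mul, zero_mul, Finset.sum_ite_eq,
    Finset.mem_univ, if_true]
  rw [det_polyMapDeriv]

/-- The transposed cofactor matrix is `det A • A⁻ᵗ`, so the reference normal contracted with the
cofactors is a multiple of the physical normal. -/
theorem polyMapDeriv_pushNormal {P : Fin d → MvPolynomial (Fin d) ℝ} {ξ : Space d}
    (hξ : (polyMapDeriv P ξ).det ≠ 0) (ν : Space d) (j : Fin d) :
    ∑ i, polyEval (cof P i j) ξ * ν i
      = (polyMapDeriv P ξ).det * pushNormal (polyMapDeriv P ξ) ν j := by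
  have h1 : pushNormal (polyMapDeriv P ξ) ν j
      = ∑ i, ν i * (polyMapDeriv P ξ).inverse (EuclideanSpace.single j 1) i := by
    have := inner_pushNormal (polyMapDeriv P ξ) ν (EuclideanSpace.single j 1)
    rw [EuclideanSpace.inner_single_right, PiLp.inner_apply] at this
    simpa [mul_comm] using this
  rw [h1, Finset.mul_sum]
  refine Finset.sum_congr rfl fun i _ => ?_
  have := polyMapDeriv_inverse hξ (EuclideanSpace.single j 1) i
  simp at this
  rw [← this]; ring

end

section

/-! ### Curved elements -/

/-- Normalization of a vector. -/
def unitVec (w : Space d) : Space d := ‖w‖⁻¹ • w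

theorem norm_unitVec {w : Space d} (hw : w ≠ 0) : ‖unitVec w‖ = 1 := by
  rw [unitVec, norm_smul, norm_inv, norm_norm, inv_mul_cancel₀ (norm_ne_zero_iff.2 hw)]

/-- A local inverse of a polynomial map at a point with invertible derivative. -/
theorem exists_local_inverse {P : Fin d → MvPolynomial (Fin d) ℝ} {ξ : Space d}
    (hξ : (polyMapDeriv P ξ).det ≠ 0) :
    ∃ g : Space d → Space d, g (polyMap P ξ) = ξ ∧
      HasFDerivAt g (polyMapDeriv P ξ).inverse (polyMap P ξ) ∧
      ∀ᶠ y in nhds (polyMap P ξ), polyMap P (g y) = y := by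
  set E := (polyMapDeriv P ξ).toContinuousLinearEquivOfDetNeZero hξ
  have hE : (E : Space d →L[ℝ] Space d) = polyMapDeriv P ξ :=
    (polyMapDeriv P ξ).coe_toContinuousLinearEquivOfDetNeZero hξ
  have hs : HasStrictFDerivAt (polyMap P) (E : Space d →L[ℝ] Space d) ξ := by
    rw [hE]
    exact (contDiff_polyMap P).contDiffAt.hasStrictFDerivAt' (hasFDerivAt_polyMap P ξ) (by simp)
  have hinv : (polyMapDeriv P ξ).inverse = (E.symm : Space d →L[ℝ] Space d) := by
    rw [← hE, ContinuousLinearMap.inverse_equiv]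
  refine ⟨hs.localInverse _ _ _, hs.localInverse_apply_image, ?_, hs.eventually_right_inverse⟩
  rw [hinv]
  exact hs.to_localInverse.hasFDerivAt

/-- The local inverse at each image point is continuous and therefore maps nearby points back into
`U`. -/
theorem isOpen_polyMap_image {P : Fin d → MvPolynomial (Fin d) ℝ} {U : Set (Space d)}
    (hU : IsOpen U) (hdet : ∀ ξ ∈ U, (polyMapDeriv P ξ).det ≠ 0) : IsOpen (polyMap P '' U) := by
  refine isOpen_iff_mem_nhds.2 ?_
  rintro _ ⟨ξ, hξ, rfl⟩
  obtain ⟨g, hg0, hg, hgy⟩ := exists_local_inverse (hdet ξ hξ)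
  have := hg.continuousAt.eventually (hU.mem_nhds (by rwa [hg0]))
  filter_upwards [this, hgy] with y h1 h2 using ⟨g y, h1, h2⟩

/-- The derivative of a function whose pull-back to the reference element is a polynomial. -/
theorem hasFDerivAt_of_pullback {P : Fin d → MvPolynomial (Fin d) ℝ}
    {Q : Comp d → MvPolynomial (Fin d) ℝ} {C : Set (Space d)} {w : Space d → State d}
    (hw : ∀ ξ ∈ C, w (polyMap P ξ) = polyState Q ξ) {ξ : Space d} (hξ : ξ ∈ interior C)
    (hdet : (polyMapDeriv P ξ).det ≠ 0) :
    HasFDerivAt w ((polyStateDeriv Q ξ).comp (polyMapDeriv P ξ).inverse) (polyMap P ξ) := by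
  obtain ⟨g, hg0, hg, hgy⟩ := exists_local_inverse hdet
  have h1 : HasFDerivAt (fun y => polyState Q (g y))
      ((polyStateDeriv Q ξ).comp (polyMapDeriv P ξ).inverse) (polyMap P ξ) := by
    have h0 : HasFDerivAt (polyState Q) (polyStateDeriv Q ξ) (g (polyMap P ξ)) := by
      rw [hg0]; exact hasFDerivAt_polyState Q ξ
    exact h0.comp _ hg
  refine h1.congr_of_eventuallyEq ?_
  have := hg.continuousAt.eventually (isOpen_interior.mem_nhds (by rwa [hg0]))
  filter_upwards [this, hgy] with y h1 h2
  rw [← hw _ (interior_subset h1), h2]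

theorem interior_ae_eq {C : Set (Space d)} (hC : Convex ℝ C) :
    (interior C : Set (Space d)) =ᵐ[volume] C :=
  interior_ae_eq_of_null_frontier (hC.addHaar_frontier volume)

/-- Change of variables from the physical to the reference element. -/
theorem integral_polyMap_image {P : Fin d → MvPolynomial (Fin d) ℝ} {C : Set (Space d)}
    (hC : Convex ℝ C) (hinj : InjOn (polyMap P) C) (g : Space d → ℝ) :
    ∫ x in polyMap P '' interior C, g x
      = ∫ ξ in C, |(polyMapDeriv P ξ).det| * g (polyMap P ξ) := by
  rw [integral_image_eq_integral_abs_det_fderiv_smul volume isOpen_interior.measurableSet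
    (fun ξ _ => (hasFDerivAt_polyMap P ξ).hasFDerivWithinAt) (hinj.mono interior_subset)]
  exact setIntegral_congr_set (interior_ae_eq hC)

theorem integrableOn_polyMap_image {P : Fin d → MvPolynomial (Fin d) ℝ} {C : Set (Space d)}
    (hC : Convex ℝ C) (hinj : InjOn (polyMap P) C) (g : Space d → ℝ) :
    IntegrableOn g (polyMap P '' interior C)
      ↔ IntegrableOn (fun ξ => |(polyMapDeriv P ξ).det| * g (polyMap P ξ)) C := by
  rw [integrableOn_image_iff_integrableOn_abs_det_fderiv_smul volume isOpen_interior.measurableSet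
    (fun ξ _ => (hasFDerivAt_polyMap P ξ).hasFDerivWithinAt) (hinj.mono interior_subset)]
  exact integrableOn_congr_set_ae (interior_ae_eq hC)

theorem continuous_det_polyMapDeriv (P : Fin d → MvPolynomial (Fin d) ℝ) :
    Continuous fun ξ => (polyMapDeriv P ξ).det := by
  simp only [det_polyMapDeriv]
  exact continuous_polyEval _

/-- A nonvanishing continuous function on a convex set keeps its sign. The constant `ε` reconciles
the factor `|det|` of the change of variables with the signed `det` in the cofactors. -/
theorem exists_sign {C : Set (Space d)} (hC : Convex ℝ C) {P : Fin d → MvPolynomial (Fin d) ℝ}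
    (hdet : ∀ ξ ∈ C, (polyMapDeriv P ξ).det ≠ 0) :
    ∃ ε : ℝ, ∀ ξ ∈ C, |(polyMapDeriv P ξ).det| = ε * (polyMapDeriv P ξ).det := by
  have hcont := continuous_det_polyMapDeriv P
  by_cases h : ∃ ξ ∈ C, (polyMapDeriv P ξ).det < 0
  · obtain ⟨ξ₀, hξ₀, hneg⟩ := h
    refine ⟨-1, fun ξ hξ => ?_⟩
    rw [abs_of_neg, neg_one_mul]
    by_contra hpos
    obtain ⟨ζ, hζ, h0⟩ := hC.isPreconnected.intermediate_value hξ₀ hξ hcont.continuousOn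
      ⟨hneg.le, not_lt.1 hpos⟩
    exact hdet ζ hζ h0
  · push Not at h
    refine ⟨1, fun ξ hξ => ?_⟩
    rw [abs_of_nonneg (h ξ hξ), one_mul]

theorem normalPotential_smul (γ s₀ : ℝ) (a : ℝ) (n : Space d) (v : State d) :
    normalPotential γ s₀ (a • n) v = a * normalPotential γ s₀ n v := by
  simp only [normalPotential, Finset.mul_sum]
  exact Finset.sum_congr rfl fun j _ => by simp; ring

/-- The divergence theorem for the flux potential on a curved element. -/
theorem IsTiledBody.integral_flux_fderiv {n : ℕ} (hn : n + 1 ≤ 3) {ι : Type*} [Fintype ι]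
    {C : Set (Space (n + 1))} {R : Set (Space n)} {e : ι → Space n →ᵃ[ℝ] Space (n + 1)}
    {ν : ι → Space (n + 1)} (h : IsTiledBody C R e ν) {γ : ℝ} (hγ : 1 < γ) (s₀ : ℝ)
    {P : Fin (n + 1) → MvPolynomial (Fin (n + 1)) ℝ} (hinj : InjOn (polyMap P) C)
    (hdet : ∀ ξ ∈ C, (polyMapDeriv P ξ).det ≠ 0)
    {Q : Comp (n + 1) → MvPolynomial (Fin (n + 1)) ℝ} {w : Space (n + 1) → State (n + 1)}
    (hw : ∀ ξ ∈ C, w (polyMap P ξ) = polyState Q ξ)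
    (hQ : ∀ ξ ∈ C, w (polyMap P ξ) ∈ negLast (n + 1)) :
    ∫ x in polyMap P '' interior C, ∑ c, ∑ j, flux γ (consVar γ s₀ (w x)) c j
        * fderiv ℝ w x (EuclideanSpace.single j 1) c
      = ∑ F, ∫ s in R,
          normalPotential γ s₀ (unitVec (pushNormal (polyMapDeriv P (e F s)) (ν F)))
            (w (polyMap P (e F s)))
          * Real.sqrt (Matrix.gram ℝ fun a => polyMapDeriv P (e F s) (colVec (e F) a)).det := by
  obtain ⟨ε, hε⟩ := exists_sign h.convex hdet
  have hQ' : ∀ ξ ∈ C, polyState Q ξ ∈ negLast (n + 1) := fun ξ hξ => by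
    rw [← hw ξ hξ]; exact hQ ξ hξ
  have h1 : ∫ x in polyMap P '' interior C, ∑ c, ∑ j, flux γ (consVar γ s₀ (w x)) c j
        * fderiv ℝ w x (EuclideanSpace.single j 1) c
      = ε * ∫ ξ in C, ∑ c, ∑ j, flux γ (consVar γ s₀ (polyState Q ξ)) c j
        * ∑ l, polyEval (cof P l j) ξ * polyEval (MvPolynomial.pderiv l (Q c)) ξ := by
    -- Both integrals are restricted to the interior, since `w` is known only on the image of `C`
    -- and its derivative is determined only at interior points. The frontier is a null set.
    rw [integral_polyMap_image h.convex hinj, ← integral_const_mul,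
      ← setIntegral_congr_set (interior_ae_eq h.convex),
      ← setIntegral_congr_set (interior_ae_eq h.convex)]
    refine setIntegral_congr_fun isOpen_interior.measurableSet fun ξ hξ => ?_
    have hξC := interior_subset hξ
    simp only [(hasFDerivAt_of_pullback hw hξ (hdet ξ hξC)).fderiv, hε ξ hξC, hw ξ hξC,
      ContinuousLinearMap.comp_apply, polyStateDeriv_apply, polyDeriv_apply]
    rw [mul_assoc]
    congr 1
    rw [Finset.mul_sum]
    refine Finset.sum_congr rfl fun c _ => ?_
    rw [Finset.mul_sum]
    refine Finset.sum_congr rfl fun j _ => ?_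
    rw [mul_left_comm, Finset.mul_sum]
    congr 1
    refine Finset.sum_congr rfl fun l _ => ?_
    have := polyMapDeriv_inverse (hdet ξ hξC) (EuclideanSpace.single j 1) l
    simp at this
    rw [← this]; ring
  rw [h1, h.integral_flux_cof hn hγ s₀ P Q hQ', Finset.mul_sum]
  refine Finset.sum_congr rfl fun F _ => ?_
  rw [← integral_const_mul]
  refine setIntegral_congr_fun h.face_compact.measurableSet fun s hs => ?_
  have hC := h.face_mem F hs
  have hν0 : ν F ≠ 0 := norm_ne_zero_iff.1 (by rw [h.norm_normal]; exact one_ne_zero)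
  have hp := norm_ne_zero_iff.2 (pushNormal_ne_zero (hdet _ hC) hν0)
  simp only [polyMapDeriv_pushNormal (hdet _ hC), ← hw _ hC]
  rw [sqrt_det_gram_map (hdet _ hC) (h.inner_colVec F) (h.norm_normal F)
    (linearIndependent_colVec (h.injective F)), unitVec, normalPotential_smul, hε _ hC]
  have e1 : ∑ j, fluxPotential γ s₀ j (w (polyMap P (e F s)))
        * ((polyMapDeriv P (e F s)).det * pushNormal (polyMapDeriv P (e F s)) (ν F) j)
      = (polyMapDeriv P (e F s)).det * normalPotential γ s₀
          (pushNormal (polyMapDeriv P (e F s)) (ν F)) (w (polyMap P (e F s))) := by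
    rw [normalPotential, Finset.mul_sum]
    exact Finset.sum_congr rfl fun j _ => by ring
  rw [e1]
  field_simp

/-! ### The side of a face on which an element lies -/

/-- The direction space of the face is contained in the hyperplane orthogonal to the normal, and
both have dimension `n`. -/
theorem IsTiledBody.mem_range_linear {n : ℕ} {ι : Type*} {C : Set (Space (n + 1))}
    {R : Set (Space n)} {e : ι → Space n →ᵃ[ℝ] Space (n + 1)} {ν : ι → Space (n + 1)}
    (h : IsTiledBody C R e ν) (F : ι) {x : Space (n + 1)} (hx : inner ℝ (ν F) x = 0) :
    x ∈ LinearMap.range (e F).linear := by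
  have hν0 : ν F ≠ 0 := norm_ne_zero_iff.1 (by rw [h.norm_normal]; exact one_ne_zero)
  have hle : LinearMap.range (e F).linear ≤ (ℝ ∙ ν F)ᗮ := by
    rintro _ ⟨a, rfl⟩
    exact Submodule.mem_orthogonal_singleton_iff_inner_right.2 (h.inner_linear F a)
  have hfact : Fact (Module.finrank ℝ (Space (n + 1)) = n + 1) := ⟨by simp⟩
  have h1 : Module.finrank ℝ (ℝ ∙ ν F)ᗮ = n := Submodule.finrank_orthogonal_span_singleton hν0
  have h2 : Module.finrank ℝ (LinearMap.range (e F).linear) = n := by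
    rw [LinearMap.finrank_range_of_inj ((e F).linear_injective_iff.2 (h.injective F))]; simp
  rw [Submodule.eq_of_le_of_finrank_eq hle (h2.trans h1.symm)]
  exact Submodule.mem_orthogonal_singleton_iff_inner_right.2 hx

/-- Near an interior point of a face, the body contains a half ball. -/
theorem IsTiledBody.eventually_mem_interior {n : ℕ} {ι : Type*} {C : Set (Space (n + 1))}
    {R : Set (Space n)} {e : ι → Space n →ᵃ[ℝ] Space (n + 1)} {ν : ι → Space (n + 1)}
    (h : IsTiledBody C R e ν) (F : ι) {s : Space n} (hs : s ∈ interior R) :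
    ∀ᶠ y in nhds (e F s), inner ℝ (ν F) (y - e F s) < 0 → y ∈ interior C := by
  obtain ⟨q, hq⟩ := h.interior_nonempty
  have hν0 : ν F ≠ 0 := norm_ne_zero_iff.1 (by rw [h.norm_normal]; exact one_ne_zero)
  -- Strictness holds because a short step from `q` along the normal still satisfies the outward
  -- inequality.
  have hβ : inner ℝ (ν F) (q - e F s) < 0 := by
    have hc : Filter.Tendsto (fun t : ℝ => q + t • ν F) (nhdsWithin 0 (Ioi 0)) (nhds q) := by
      have : Continuous fun t : ℝ => q + t • ν F := by fun_prop
      have := this.tendsto 0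
      rw [zero_smul, add_zero] at this
      exact this.mono_left nhdsWithin_le_nhds
    obtain ⟨t, ht, ht0⟩ := ((hc.eventually (isOpen_interior.mem_nhds hq)).and
      self_mem_nhdsWithin).exists
    have := h.outward F s (interior_subset hs) _ (interior_subset ht)
    rw [add_sub_right_comm, inner_add_right, inner_smul_right, real_inner_self_eq_norm_sq,
      h.norm_normal] at this
    have ht0' : (0 : ℝ) < t := ht0
    linarith
  set β := inner ℝ (ν F) (q - e F s) with hβdef
  obtain ⟨G, hG⟩ := (e F).linear.exists_leftInverse_of_injective
    (LinearMap.ker_eq_bot.2 ((e F).linear_injective_iff.2 (h.injective F)))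
  have hGc : Continuous G := G.continuous_of_finiteDimensional
  -- Coordinates adapted to the face: `y - e F s` is `α y` times the direction towards the interior
  -- point `q`, plus the image of `a y` under the linear part.
  set α : Space (n + 1) → ℝ := fun y => inner ℝ (ν F) (y - e F s) / β with hα
  set a : Space (n + 1) → Space n := fun y => G (y - e F s - α y • (q - e F s)) with ha
  have hαc : Continuous α := by
    simp only [hα]
    exact (continuous_const.inner (continuous_id.sub continuous_const)).div_const _
  have hac : Continuous a := hGc.comp
    ((continuous_id.sub continuous_const).sub (hαc.smul continuous_const))
  have hα0 : α (e F s) = 0 := by simp [hα]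
  have ha0 : a (e F s) = 0 := by simp [ha, hα0]
  have hlim : Filter.Tendsto (fun y => s + (1 - α y)⁻¹ • a y) (nhds (e F s)) (nhds s) := by
    have h1 : ContinuousAt (fun y => s + (1 - α y)⁻¹ • a y) (e F s) := by
      have h0 : ContinuousAt (fun y => (1 - α y)⁻¹) (e F s) :=
        ContinuousAt.inv₀ (continuousAt_const.sub hαc.continuousAt) (by rw [hα0]; norm_num)
      exact continuousAt_const.add (h0.smul hac.continuousAt)
    have h2 := h1.tendsto
    rwa [ha0, smul_zero, add_zero] at h2
  have hα1 : ∀ᶠ y in nhds (e F s), α y < 1 :=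
    hαc.continuousAt.eventually (gt_mem_nhds (by rw [hα0]; norm_num))
  filter_upwards [hlim.eventually (isOpen_interior.mem_nhds hs), hα1] with y hy hy1 hneg
  have hαpos : 0 < α y := div_pos_of_neg_of_neg hneg hβ
  have hrange : (e F).linear (a y) = y - e F s - α y • (q - e F s) := by
    obtain ⟨b, hb⟩ := h.mem_range_linear F (x := y - e F s - α y • (q - e F s)) (by
      rw [inner_sub_right, inner_smul_right, ← hβdef]
      simp only [hα]
      rw [div_mul_cancel₀ _ hβ.ne, sub_self])
    have : a y = b := by
      simp only [ha]
      rw [← hb]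
      exact LinearMap.congr_fun hG b
    rw [this, hb]
  have hz : e F (s + (1 - α y)⁻¹ • a y) = e F s + (1 - α y)⁻¹ • (e F).linear (a y) := by
    have := (e F).map_vadd s ((1 - α y)⁻¹ • a y)
    rw [vadd_eq_add, vadd_eq_add, map_smul] at this
    rw [add_comm s]
    exact this.trans (add_comm _ _)
  have h1α : 1 - α y ≠ 0 := by linarith
  -- For `y` near `e F s` on the inner side, this writes `y` as a convex combination of a face point
  -- and `q` with positive weight on `q`; hence `y` is interior.
  have hy' : y = (1 - α y) • e F (s + (1 - α y)⁻¹ • a y) + α y • q := by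
    rw [hz, smul_add, smul_smul, mul_inv_cancel₀ h1α, one_smul, hrange]
    module
  rw [hy']
  exact h.convex.combo_self_interior_mem_interior (h.face_mem F (interior_subset hy)) hq
    (by linarith) hαpos (by ring)

/-- The points just below an interior point of a face lie in the curved element. -/
theorem IsTiledBody.eventually_mem_image {n : ℕ} {ι : Type*} {C : Set (Space (n + 1))}
    {R : Set (Space n)} {e : ι → Space n →ᵃ[ℝ] Space (n + 1)} {ν : ι → Space (n + 1)}
    (h : IsTiledBody C R e ν) {P : Fin (n + 1) → MvPolynomial (Fin (n + 1)) ℝ}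
    (hdet : ∀ ξ ∈ C, (polyMapDeriv P ξ).det ≠ 0) (F : ι) {s : Space n} (hs : s ∈ interior R) :
    ∀ᶠ δ in nhdsWithin (0 : ℝ) (Ioi 0), polyMap P (e F s)
      - δ • unitVec (pushNormal (polyMapDeriv P (e F s)) (ν F)) ∈ polyMap P '' interior C := by
  have hν0 : ν F ≠ 0 := norm_ne_zero_iff.1 (by rw [h.norm_normal]; exact one_ne_zero)
  have hC := hdet _ (h.face_mem F (interior_subset hs))
  obtain ⟨g, hg0, hg, hgy⟩ := exists_local_inverse hC
  set w := pushNormal (polyMapDeriv P (e F s)) (ν F)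
  have hw : w ≠ 0 := pushNormal_ne_zero hC hν0
  set x := polyMap P (e F s)
  have hpath : HasDerivAt (fun δ : ℝ => x - δ • unitVec w) (-unitVec w) 0 := by
    have := ((hasDerivAt_id (0 : ℝ)).smul_const (unitVec w)).const_sub x
    rwa [one_smul] at this
  have hpath0 : x - (0 : ℝ) • unitVec w = x := by simp
  have hgd : HasDerivAt (fun δ : ℝ => g (x - δ • unitVec w))
      ((polyMapDeriv P (e F s)).inverse (-unitVec w)) 0 :=
    HasFDerivAt.comp_hasDerivAt (0 : ℝ) (by rw [hpath0]; exact hg) hpath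
  -- The height of the pulled-back point over the reference face has derivative `-‖w‖` at zero, so
  -- the point moves strictly to the inner side.
  have hr : HasDerivAt (fun δ : ℝ => inner ℝ (ν F) (g (x - δ • unitVec w) - e F s)) (-‖w‖) 0 := by
    have h1 := (innerSL ℝ (ν F)).hasFDerivAt.comp_hasDerivAt (0 : ℝ) (hgd.sub_const (e F s))
    have h2 : innerSL ℝ (ν F) ((polyMapDeriv P (e F s)).inverse (-unitVec w)) = -‖w‖ := by
      rw [innerSL_apply_apply, ← inner_pushNormal, inner_neg_right, unitVec]
      change -(inner ℝ w (‖w‖⁻¹ • w)) = -‖w‖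
      rw [real_inner_smul_right, real_inner_self_eq_norm_sq]
      have := norm_ne_zero_iff.2 hw
      field_simp
    rw [h2] at h1
    exact h1
  have hneg : ∀ᶠ δ in nhdsWithin (0 : ℝ) (Ioi 0),
      inner ℝ (ν F) (g (x - δ • unitVec w) - e F s) < 0 := by
    have hsl := (hasDerivAt_iff_tendsto_slope.1 hr).mono_left
      (nhdsWithin_mono 0 fun δ (hδ : 0 < δ) => hδ.ne')
    filter_upwards [hsl.eventually (gt_mem_nhds (neg_neg_of_pos (norm_pos_iff.2 hw))),
      self_mem_nhdsWithin] with δ h1 hδ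
    rw [slope_def_field, hpath0, hg0, sub_self, inner_zero_right, sub_zero, sub_zero] at h1
    exact (div_neg_iff.1 h1).resolve_left (fun h => absurd h.2 (not_lt.2 (le_of_lt hδ))) |>.1
  have hc0 : Filter.Tendsto (fun δ : ℝ => x - δ • unitVec w) (nhdsWithin 0 (Ioi 0)) (nhds x) := by
    have := hpath.continuousAt.tendsto
    rw [hpath0] at this
    exact this.mono_left nhdsWithin_le_nhds
  have hg1 : Filter.Tendsto g (nhds x) (nhds (e F s)) := by
    have := hg.continuousAt.tendsto
    rwa [hg0] at this
  filter_upwards [hneg, (hg1.comp hc0).eventually (h.eventually_mem_interior F hs),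
    hc0.eventually hgy] with δ h1 h2 h3
  exact ⟨_, h2 h1, h3⟩

/-- Two unit vectors that are orthogonal to the same hyperplane agree up to the sign. -/
theorem eq_or_eq_neg_of_orthogonal {n : ℕ} {ν ν' : Space (n + 1)} {c : Fin n → Space (n + 1)}
    (hν : ∀ a, inner ℝ ν (c a) = 0) (h1 : ‖ν‖ = 1) (hν' : ∀ a, inner ℝ ν' (c a) = 0)
    (h1' : ‖ν'‖ = 1) (hc : LinearIndependent ℝ c) : ν' = ν ∨ ν' = -ν := by
  have hdet := det_consMat_eq ν' hν h1 hc
  have h0 := det_consMat_ne_zero hν (norm_ne_zero_iff.1 (by rw [h1]; exact one_ne_zero)) hc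
  -- Both squared determinants equal the same nonzero Gram determinant, and their quotient is the
  -- squared inner product of the two unit vectors.
  have hsq : inner ℝ ν' ν * inner ℝ ν' ν = 1 := by
    have e1 := sq_det_consMat hν h1
    have e2 := sq_det_consMat hν' h1'
    rw [hdet, ← e1] at e2
    have h3 : ((consMat ν c).det * (consMat ν c).det) ≠ 0 := mul_ne_zero h0 h0
    refine mul_right_cancel₀ h3 ?_
    linarith
  rcases mul_self_eq_one_iff.1 hsq with h | h
  · exact Or.inl ((inner_eq_one_iff_of_norm_eq_one (𝕜 := ℝ) h1' h1).1 h)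
  · refine Or.inr ((inner_eq_one_iff_of_norm_eq_one (𝕜 := ℝ) h1' (by rwa [norm_neg])).1 ?_)
    rw [inner_neg_right, h, neg_neg]

end

section

/-! ### Meshes -/

namespace PeriodicMesh

variable {n p : ℕ} {Elem Face : Type*} (M : PeriodicMesh (n + 1) p Elem Face)

/-- The polynomials that define the parametric mapping of an element. -/
def poly (K : Elem) (i : Fin (n + 1)) : MvPolynomial (Fin (n + 1)) ℝ := (M.map_poly K i).choose

theorem map_eq (K : Elem) : M.map K = polyMap (M.poly K) := by
  funext ξ
  ext i
  exact (M.map_poly K i).choose_spec.2 ξ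

theorem fderiv_map (K : Elem) (ξ : Space (n + 1)) :
    fderiv ℝ (M.map K) ξ = polyMapDeriv (M.poly K) ξ := by
  rw [M.map_eq]; exact (hasFDerivAt_polyMap _ _).fderiv

theorem det_ne_zero (K : Elem) {ξ : Space (n + 1)} (hξ : ξ ∈ M.Kref) :
    (polyMapDeriv (M.poly K) ξ).det ≠ 0 := by
  rw [← M.fderiv_map]; exact M.map_nonsingular K ξ hξ

theorem injOn_polyMap (K : Elem) : InjOn (polyMap (M.poly K)) M.Kref := by
  rw [← M.map_eq]; exact M.map_injOn K

/-- The face sides on the element `K`. -/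
abbrev SideOf (K : Elem) := {q : Face × Bool // M.side q.1 q.2 = K}

/-- The embedding of the reference face. -/
def femb (F : Face) (b : Bool) : Space n →ᵃ[ℝ] Space (n + 1) := M.emb F b

/-- The reference face. -/
def fref : Set (Space n) := M.Fref

theorem tiledBody (K : Elem) : IsTiledBody M.Kref M.fref
    (fun q : M.SideOf K => M.femb q.1.1 q.1.2) fun q => M.refNormal q.1.1 q.1.2 where
  convex := M.Kref_convex
  compact := M.Kref_compact
  interior_nonempty := M.Kref_interior
  face_convex := M.Fref_convex
  face_compact := M.Fref_compact
  face_interior := M.Fref_interior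
  injective q := M.emb_injective _ _
  cover := by
    rw [M.boundary_cover K]
    ext x
    simp only [mem_iUnion]
    constructor
    · rintro ⟨F, b, hF, hx⟩
      exact ⟨⟨(F, b), hF⟩, hx⟩
    · rintro ⟨⟨⟨F, b⟩, hF⟩, hx⟩
      exact ⟨F, b, hF, hx⟩
  disjoint q q' hq := M.boundary_disjoint _ _ _ _ (q.2.trans q'.2.symm) fun h => hq (Subtype.ext h)
  norm_normal q := M.refNormal_norm _ _
  outward q := M.refNormal_outward _ _

/-- The tangent vectors on the side `b` of a face. -/
def tangent (F : Face) (b : Bool) (s : Space n) (a : Fin n) : Space (n + 1) :=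
  polyMapDeriv (M.poly (M.side F b)) (M.femb F b s) (colVec (M.femb F b) a)

theorem femb_mem (F : Face) (b : Bool) {s : Space n} (hs : s ∈ M.fref) : M.femb F b s ∈ M.Kref :=
  (M.tiledBody (M.side F b)).face_mem ⟨(F, b), rfl⟩ hs

theorem hasFDerivAt_sidePoint (F : Face) (b : Bool) (s : Space n) :
    HasFDerivAt (M.sidePoint F b) ((polyMapDeriv (M.poly (M.side F b)) (M.femb F b s)).comp
      (LinearMap.toContinuousLinearMap (M.femb F b).linear)) s := by
  have h1 := (hasFDerivAt_polyMap (M.poly (M.side F b)) (M.femb F b s)).comp s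
    (hasFDerivAt_affine (M.femb F b) s)
  rw [← M.map_eq] at h1
  exact h1

theorem areaElement_eq (F : Face) (s : Space n) :
    M.areaElement F s = Real.sqrt (Matrix.gram ℝ (M.tangent F false s)).det := by
  have h := (M.hasFDerivAt_sidePoint F false s).fderiv
  change Real.sqrt (Matrix.gram ℝ fun a : Fin n =>
    fderiv ℝ (M.sidePoint F false) s (EuclideanSpace.single a 1)).det = _
  rw [h]
  rfl

/-- The two side parametrizations differ by a constant translation on the reference face, so their
derivatives agree at its interior points. -/
theorem tangent_eq (F : Face) {s : Space n} (hs : s ∈ interior M.fref) :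
    M.tangent F true s = M.tangent F false s := by
  have h1 := (M.hasFDerivAt_sidePoint F true s).add_const (M.shift F : Space (n + 1))
  have h2 : (fun s => M.sidePoint F true s + (M.shift F : Space (n + 1))) =ᶠ[nhds s]
      M.sidePoint F false := by
    filter_upwards [isOpen_interior.mem_nhds hs] with r hr
    exact M.sides_glued F r (interior_subset hr)
  have h3 := (h1.congr_of_eventuallyEq h2.symm).unique (M.hasFDerivAt_sidePoint F false s)
  funext a
  exact congrArg (fun L => L (EuclideanSpace.single a 1)) h3

/-- The normal vector before normalization. -/
def rawNormal (F : Face) (b : Bool) (s : Space n) : Space (n + 1) :=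
  pushNormal (polyMapDeriv (M.poly (M.side F b)) (M.femb F b s)) (M.refNormal F b)

theorem normal_eq (F : Face) (b : Bool) (s : Space n) :
    M.normal F b s = unitVec (M.rawNormal F b s) := by
  change unitVec (ContinuousLinearMap.adjoint (ContinuousLinearMap.inverse
    (fderiv ℝ (M.map (M.side F b)) (M.femb F b s))) (M.refNormal F b)) = _
  rw [M.fderiv_map]
  rfl

theorem rawNormal_ne_zero (F : Face) (b : Bool) {s : Space n} (hs : s ∈ M.fref) :
    M.rawNormal F b s ≠ 0 :=
  pushNormal_ne_zero (M.det_ne_zero _ (M.femb_mem F b hs))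
    (norm_ne_zero_iff.1 (by rw [M.refNormal_norm]; exact one_ne_zero))

theorem norm_normal (F : Face) (b : Bool) {s : Space n} (hs : s ∈ M.fref) :
    ‖M.normal F b s‖ = 1 := by
  rw [M.normal_eq]; exact norm_unitVec (M.rawNormal_ne_zero F b hs)

theorem inner_normal_tangent (F : Face) (b : Bool) {s : Space n} (hs : s ∈ M.fref) (a : Fin n) :
    inner ℝ (M.normal F b s) (M.tangent F b s a) = 0 := by
  rw [M.normal_eq, unitVec, real_inner_smul_left, rawNormal, inner_pushNormal, tangent,
    (inverse_apply_of_det_ne_zero (M.det_ne_zero _ (M.femb_mem F b hs)) _).1]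
  have := (M.tiledBody (M.side F b)).inner_colVec ⟨(F, b), rfl⟩ a
  simp only at this
  rw [this, mul_zero]

theorem linearIndependent_tangent (F : Face) (b : Bool) {s : Space n} (hs : s ∈ M.fref) :
    LinearIndependent ℝ (M.tangent F b s) := by
  have h1 := linearIndependent_colVec (M.emb_injective F b : Function.Injective (M.femb F b))
  have hdet := M.det_ne_zero (M.side F b) (M.femb_mem F b hs)
  refine h1.map' (polyMapDeriv (M.poly (M.side F b)) (M.femb F b s)).toLinearMap ?_
  refine LinearMap.ker_eq_bot'.2 fun x hx => ?_
  rw [← (inverse_apply_of_det_ne_zero hdet x).1]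
  have hx' : polyMapDeriv (M.poly (M.side F b)) (M.femb F b s) x = 0 := hx
  rw [hx', map_zero]

/-- The outward normals on the two sides of a face are opposite. -/
theorem normal_true_eq_neg (F : Face) {s : Space n} (hs : s ∈ interior M.fref) :
    M.normal F true s = -M.normal F false s := by
  have hs' := interior_subset hs
  have ht : ∀ a, inner ℝ (M.normal F true s) (M.tangent F false s a) = 0 := fun a => by
    rw [← M.tangent_eq F hs]; exact M.inner_normal_tangent F true hs' a
  refine (eq_or_eq_neg_of_orthogonal (M.inner_normal_tangent F false hs') (M.norm_normal F false hs')
    ht (M.norm_normal F true hs') (M.linearIndependent_tangent F false hs')).resolve_left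
    fun heq => ?_
  have hmem : ∀ b, ∀ᶠ δ in nhdsWithin (0 : ℝ) (Ioi 0),
      M.sidePoint F b s - δ • M.normal F b s ∈ M.elem (M.side F b) := fun b => by
    have := (M.tiledBody (M.side F b)).eventually_mem_image
      (fun ξ hξ => M.det_ne_zero (M.side F b) hξ) ⟨(F, b), rfl⟩ hs
    rw [← M.map_eq] at this
    rw [M.normal_eq]
    exact this
  obtain ⟨δ, h1, h2⟩ := ((hmem true).and (hmem false)).exists
  have hglue : M.sidePoint F true s + (M.shift F : Space (n + 1)) = M.sidePoint F false s :=
    M.sides_glued F s hs'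
  rw [heq] at h1
  set z := M.sidePoint F false s - δ • M.normal F false s with hz
  have hz' : M.sidePoint F true s - δ • M.normal F false s + (M.shift F : Space (n + 1)) = z := by
    rw [hz, ← hglue]; abel
  -- Equal normals would put one point, up to the shift, into both adjacent elements. For zero shift
  -- the elements are different and disjoint; otherwise two distinct translates of `Ω` would meet.
  by_cases hl : (M.shift F : Space (n + 1)) = 0
  · have hside : M.side F true ≠ M.side F false := fun h =>
      M.sides_ne F ⟨h, Subtype.ext hl⟩
    rw [hl, add_zero] at hz'
    rw [hz'] at h1
    exact (M.elem_disjoint _ _ hside).le_bot ⟨h1, h2⟩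
  · exact (M.translates_disjoint _ (M.shift F).2 hl).le_bot
      ⟨M.elem_subset _ h2, _, M.elem_subset _ h1, hz'⟩

/-- Cramer's rule expresses the raw normal through polynomials divided by the nonvanishing
determinant. -/
theorem continuousOn_normal (F : Face) (b : Bool) :
    ContinuousOn (fun s : Space n => M.normal F b s) M.fref := by
  have hraw : ContinuousOn (M.rawNormal F b) M.fref := by
    have hcoord : ∀ j, ContinuousOn (fun s => M.rawNormal F b s j) M.fref := fun j => by
      have he := continuous_affine (M.femb F b)
      have h1 : ContinuousOn (fun s => (polyMapDeriv (M.poly (M.side F b)) (M.femb F b s)).det⁻¹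
          * ∑ i, polyEval (cof (M.poly (M.side F b)) i j) (M.femb F b s) * M.refNormal F b i)
          M.fref := by
        refine ContinuousOn.mul (ContinuousOn.inv₀
          ((continuous_det_polyMapDeriv _).comp he).continuousOn
          fun s hs => M.det_ne_zero _ (M.femb_mem F b hs)) ?_
        exact continuousOn_finsetSum _ fun i _ =>
          ((continuous_polyEval _).comp he).continuousOn.mul continuousOn_const
      refine h1.congr fun s hs => ?_
      have hdet := M.det_ne_zero (M.side F b) (M.femb_mem F b hs)
      simp only [polyMapDeriv_pushNormal hdet]
      rw [inv_mul_cancel_left₀ hdet]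
      rfl
    exact (PiLp.continuous_toLp 2 fun _ : Fin (n + 1) => ℝ).comp_continuousOn
      (continuousOn_pi.2 hcoord)
  simp only [M.normal_eq]
  exact (hraw.norm.inv₀ fun s hs => norm_ne_zero_iff.2 (M.rawNormal_ne_zero F b hs)).smul hraw

theorem continuous_areaElement (F : Face) : Continuous fun s : Space n => M.areaElement F s := by
  simp only [M.areaElement_eq]
  refine Real.continuous_sqrt.comp (Continuous.matrix_det ?_)
  refine continuous_matrix fun a b => ?_
  have h : ∀ a, Continuous fun s => M.tangent F false s a := fun a =>
    ((continuous_polyMapDeriv _).comp (continuous_affine _)).clm_apply continuous_const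
  exact (h a).inner (h b)

theorem areaElement_nonneg (F : Face) (s : Space n) : 0 ≤ M.areaElement F s := Real.sqrt_nonneg _

theorem elem_eq (K : Elem) : M.elem K = polyMap (M.poly K) '' interior M.Kref := by
  rw [elem, M.map_eq]

theorem exists_polyState {k : ℕ} {w : Elem → Space (n + 1) → State (n + 1)} (hw : M.MemV k w)
    (K : Elem) : ∃ Q : Comp (n + 1) → MvPolynomial (Fin (n + 1)) ℝ,
      (∀ c, (Q c).totalDegree ≤ k) ∧
      ∀ ξ ∈ M.Kref, w K (polyMap (M.poly K) ξ) = polyState Q ξ := by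
  choose Q hQ hQe using hw K
  refine ⟨Q, hQ, fun ξ hξ => ?_⟩
  rw [← M.map_eq]
  exact funext fun c => hQe c ξ hξ

theorem continuousOn_side {k : ℕ} {w : Elem → Space (n + 1) → State (n + 1)} (hw : M.MemV k w)
    (F : Face) (b : Bool) :
    ContinuousOn (fun s : Space n => w (M.side F b) (M.sidePoint F b s)) M.fref := by
  obtain ⟨Q, -, hQ⟩ := M.exists_polyState hw (M.side F b)
  refine ((continuous_polyState Q).comp (continuous_affine (M.femb F b))).continuousOn.congr
    fun s hs => ?_
  have := hQ _ (M.femb_mem F b hs)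
  rwa [← M.map_eq] at this

theorem continuousOn_trace {k : ℕ} {EE : Set Face} {μ : Face → Space (n + 1) → State (n + 1)}
    (hμ : M.MemM k EE μ) (F : Face) :
    ContinuousOn (fun s : Space n => μ F (M.facePoint F s)) M.fref := by
  refine continuousOn_pi.2 fun i => ?_
  obtain ⟨P, -, hP⟩ := hμ.1 F i
  have hc : Continuous (polyEval (d := n) P) := continuous_polyEval (d := n) P
  exact hc.continuousOn.congr fun s hs => hP s hs

theorem continuousOn_normalPotential {γ : ℝ} (hγ : 1 < γ) (s₀ : ℝ) (F : Face) (b : Bool)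
    {v : Space n → State (n + 1)} (hv : ContinuousOn v M.fref)
    (hneg : ∀ s ∈ M.fref, v s ∈ negLast (n + 1)) :
    ContinuousOn (fun s : Space n => normalPotential γ s₀ (M.normal F b s) (v s)) M.fref := by
  unfold normalPotential
  refine continuousOn_finsetSum _ fun j _ => ContinuousOn.mul ?_ ?_
  · exact ContinuousOn.comp (t := negLast (n + 1)) (g := fluxPotential γ s₀ j) (fun v hv =>
      (hasFDerivAt_fluxPotential hγ s₀ hv j).continuousAt.continuousWithinAt) hv hneg
  · exact (EuclideanSpace.proj j : Space (n + 1) →L[ℝ] ℝ).continuous.comp_continuousOn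
      (M.continuousOn_normal F b)

/-! ### Integrals over the faces of the mesh -/

variable [Fintype Face]

noncomputable instance instFintypeSideOf (K : Elem) : Fintype (M.SideOf K) := Fintype.ofFinite _

/-- The integral over all faces of a function on the reference face. -/
theorem skeletonIntegral_eq (g : Face → Bool → Space n → ℝ) :
    M.skeletonIntegral g = ∑ F, ∑ b, ∫ s in M.fref, g F b s * M.areaElement F s := rfl

theorem skeletonIntegral_sub {g g' : Face → Bool → Space n → ℝ}
    (hg : ∀ F b, IntegrableOn (fun s => g F b s * M.areaElement F s) M.fref)
    (hg' : ∀ F b, IntegrableOn (fun s => g' F b s * M.areaElement F s) M.fref) :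
    M.skeletonIntegral (fun F b s => g F b s - g' F b s)
      = M.skeletonIntegral g - M.skeletonIntegral g' := by
  rw [skeletonIntegral_eq, skeletonIntegral_eq, skeletonIntegral_eq, ← Finset.sum_sub_distrib]
  refine Finset.sum_congr rfl fun F _ => ?_
  rw [← Finset.sum_sub_distrib]
  refine Finset.sum_congr rfl fun b _ => ?_
  rw [← integral_sub (hg F b) (hg' F b)]
  simp only [sub_mul]

/-- A potential that is single valued on the faces does not contribute. -/
theorem skeletonIntegral_normalPotential_trace {γ s₀ : ℝ}
    {μ : Face → Space (n + 1) → State (n + 1)} :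
    M.skeletonIntegral (fun F b s => normalPotential γ s₀ (M.normal F b s) (μ F (M.facePoint F s)))
      = 0 := by
  rw [skeletonIntegral_eq]
  refine Finset.sum_eq_zero fun F _ => ?_
  rw [Fintype.sum_bool, add_eq_zero_iff_eq_neg, ← integral_neg,
    ← setIntegral_congr_set (interior_ae_eq (show Convex ℝ M.fref from M.Fref_convex)),
    ← setIntegral_congr_set (interior_ae_eq (show Convex ℝ M.fref from M.Fref_convex))]
  refine setIntegral_congr_fun isOpen_interior.measurableSet fun s hs => ?_
  rw [M.normal_true_eq_neg F hs, ← neg_one_smul ℝ (M.normal F false s), normalPotential_smul]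
  ring

/-- Pointwise entropy stability of the numerical flux, integrated over all faces. -/
theorem skeletonIntegral_normalPotential_le {k : ℕ} {EE : Set Face} {γ : ℝ} (hγ : 1 < γ) {s₀ : ℝ}
    {σ : Stabilization (n + 1)} (hσ : IsDissipative γ s₀ σ)
    {v : Elem → Space (n + 1) → State (n + 1)} {μ : Face → Space (n + 1) → State (n + 1)}
    (hv : M.MemV k v) (hμ : M.MemM k EE μ)
    (hvneg : ∀ K, ∀ x ∈ M.closedElem K, v K x ∈ negLast (n + 1))
    (hμneg : ∀ F, ∀ s ∈ M.fref, μ F (M.facePoint F s) ∈ negLast (n + 1))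
    (hint : ∀ F b, IntegrableOn
      (fun s : Space n => M.areaElement F s • M.sideFlux γ s₀ σ v μ F b s) M.fref)
    (hcons : M.skeletonIntegral (fun F b s => ∑ i,
      M.sideFlux γ s₀ σ v μ F b s i * μ F (M.facePoint F s) i) = 0) :
    M.skeletonIntegral (fun F b s => normalPotential γ s₀ (M.normal F b s)
        (v (M.side F b) (M.sidePoint F b s)))
      ≤ M.skeletonIntegral (fun F b s => ∑ i, M.sideFlux γ s₀ σ v μ F b s i
          * v (M.side F b) (M.sidePoint F b s) i) := by
  have hRc : IsCompact M.fref := M.Fref_compact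
  have hside : ∀ F b, ∀ s ∈ M.fref, M.sidePoint F b s ∈ M.closedElem (M.side F b) :=
    fun F b s hs => mem_image_of_mem _ (M.femb_mem F b hs)
  have hvn : ∀ F b, ∀ s ∈ M.fref, v (M.side F b) (M.sidePoint F b s) ∈ negLast (n + 1) :=
    fun F b s hs => hvneg _ _ (hside F b s hs)
  have harea : ∀ F, ContinuousOn (fun s : Space n => M.areaElement F s) M.fref := fun F =>
    (M.continuous_areaElement F).continuousOn
  -- The stabilization need not depend continuously on its arguments, so integrability of the flux
  -- is taken from `hint`; only the test factor is continuous.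
  have hflux : ∀ F b (z : Space n → State (n + 1)), ContinuousOn z M.fref →
      IntegrableOn (fun s => (∑ i, M.sideFlux γ s₀ σ v μ F b s i * z s i) * M.areaElement F s)
        M.fref := fun F b z hz => by
    have h1 : ∀ i, IntegrableOn (fun s => z s i
        * (M.areaElement F s • M.sideFlux γ s₀ σ v μ F b s) i) M.fref := fun i =>
      IntegrableOn.continuousOn_mul (continuousOn_pi.1 hz i)
        ((ContinuousLinearMap.proj (R := ℝ) (φ := fun _ : Comp (n + 1) => ℝ) i).integrable_comp
          (hint F b)) hRc
    refine (integrable_finsetSum Finset.univ fun i _ => h1 i).congr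
      (Filter.Eventually.of_forall fun s => ?_)
    simp only [Finset.sum_mul]
    refine Finset.sum_congr rfl fun i _ => ?_
    simp only [Pi.smul_apply, smul_eq_mul]
    ring
  have hpot1 : ∀ F b, IntegrableOn (fun s : Space n => normalPotential γ s₀ (M.normal F b s)
      (v (M.side F b) (M.sidePoint F b s)) * M.areaElement F s) M.fref := fun F b =>
    ((M.continuousOn_normalPotential hγ s₀ F b (M.continuousOn_side hv F b) (hvn F b)).mul
      (harea F)).integrableOn_compact hRc
  have hpot2 : ∀ F b, IntegrableOn (fun s : Space n => normalPotential γ s₀ (M.normal F b s)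
      (μ F (M.facePoint F s)) * M.areaElement F s) M.fref := fun F b =>
    ((M.continuousOn_normalPotential hγ s₀ F b (M.continuousOn_trace hμ F) (hμneg F)).mul
      (harea F)).integrableOn_compact hRc
  have hf1 := fun F b => hflux F b _ (M.continuousOn_side hv F b)
  have hf2 := fun F b => hflux F b _ (M.continuousOn_trace hμ F)
  have e1 := M.skeletonIntegral_sub hpot1 hpot2
  have e2 := M.skeletonIntegral_sub hf1 hf2
  have htrace : M.skeletonIntegral (fun F b (s : Space n) =>
      normalPotential γ s₀ (M.normal F b s) (μ F (M.facePoint F s))) = 0 :=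
    M.skeletonIntegral_normalPotential_trace
  rw [htrace, sub_zero] at e1
  have hcons' : M.skeletonIntegral (fun F b (s : Space n) => ∑ i,
      M.sideFlux γ s₀ σ v μ F b s i * μ F (M.facePoint F s) i) = 0 := hcons
  rw [hcons', sub_zero] at e2
  -- Both trace terms are zero, the one by opposite normals and the other by the conservation
  -- equation. Subtracting them turns the claim into the pointwise inequality for the pair of `μ`
  -- and `v`.
  refine e1.symm.le.trans (le_trans ?_ e2.le)
  rw [skeletonIntegral_eq, skeletonIntegral_eq]
  refine Finset.sum_le_sum fun F _ => Finset.sum_le_sum fun b _ => ?_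
  refine setIntegral_mono_on ?_ ?_ hRc.measurableSet fun s hs => ?_
  · exact ((hpot1 F b).sub (hpot2 F b)).congr
      (Filter.Eventually.of_forall fun s => (sub_mul _ _ _).symm)
  · exact ((hf1 F b).sub (hf2 F b)).congr
      (Filter.Eventually.of_forall fun s => (sub_mul _ _ _).symm)
  · refine mul_le_mul_of_nonneg_right ?_ (M.areaElement_nonneg F s)
    refine (hσ _ (hμneg F s hs) _ (hvn F b s hs) _ (M.norm_normal F b hs)).trans (le_of_eq ?_)
    rw [← Finset.sum_sub_distrib]
    exact Finset.sum_congr rfl fun i _ => by rw [← mul_sub]; rfl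

variable [Fintype Elem]

/-- Every side belongs to exactly one element, so the sides are the disjoint union of the fibres of
`side`. -/
theorem sum_sides (f : Face → Bool → ℝ) :
    ∑ K, ∑ q : M.SideOf K, f q.1.1 q.1.2 = ∑ F, ∑ b, f F b := by
  classical
  rw [← Fintype.sum_prod_type' (f := f),
    ← (Equiv.sigmaFiberEquiv fun q : Face × Bool => M.side q.1 q.2).sum_comp, Fintype.sum_sigma]
  refine Finset.sum_congr rfl fun K _ => ?_
  exact Fintype.sum_equiv (Equiv.refl _) _ _ fun _ => rfl

/-- The divergence theorem for the flux potential on the mesh. -/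
theorem meshIntegral_flux_fderiv (hn : n + 1 ≤ 3) {k : ℕ} {γ : ℝ} (hγ : 1 < γ) (s₀ : ℝ)
    {v : Elem → Space (n + 1) → State (n + 1)} (hv : M.MemV k v)
    (hvneg : ∀ K, ∀ x ∈ M.closedElem K, v K x ∈ negLast (n + 1)) :
    M.meshIntegral (fun K x => ∑ i, ∑ j, flux γ (consVar γ s₀ (v K x)) i j
        * fderiv ℝ (v K) x (EuclideanSpace.single j 1) i)
      = M.skeletonIntegral (fun F b s => normalPotential γ s₀ (M.normal F b s)
        (v (M.side F b) (M.sidePoint F b s))) := by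
  rw [skeletonIntegral_eq, ← M.sum_sides, meshIntegral]
  refine Finset.sum_congr rfl fun K _ => ?_
  obtain ⟨Q, -, hQ⟩ := M.exists_polyState hv K
  rw [M.elem_eq, (M.tiledBody K).integral_flux_fderiv hn hγ s₀ (M.injOn_polyMap K)
    (fun ξ hξ => M.det_ne_zero K hξ) hQ fun ξ hξ => ?_]
  · refine Finset.sum_congr rfl fun q _ => ?_
    obtain ⟨⟨F, b⟩, rfl⟩ := q
    rw [← setIntegral_congr_set (interior_ae_eq (show Convex ℝ M.fref from M.Fref_convex)),
      ← setIntegral_congr_set (interior_ae_eq (show Convex ℝ M.fref from M.Fref_convex))]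
    refine setIntegral_congr_fun isOpen_interior.measurableSet fun s hs => ?_
    have harea : M.areaElement F s = Real.sqrt (Matrix.gram ℝ (M.tangent F b s)).det := by
      rw [M.areaElement_eq]
      cases b
      · rfl
      · rw [M.tangent_eq F hs]
    simp only [harea, M.normal_eq, ← M.map_eq]
    rfl
  · rw [← M.map_eq]
    exact hvneg K _ (mem_image_of_mem _ hξ)

end PeriodicMesh

end

section

/-! ### Regularity in time -/

/-- A path in a finite-dimensional space of functions that is pointwise continuous and
differentiable has continuous and differentiable coordinates. -/
theorem exists_coordinates {X κ : Type*} [Fintype κ] (W : Submodule ℝ (X → κ → ℝ))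
    [FiniteDimensional ℝ W] {S T : Set ℝ} (hT : IsOpen T) (hTS : T ⊆ S) {w : ℝ → X → κ → ℝ}
    (hw : ∀ t ∈ S, w t ∈ W) (hc : ∀ x, ContinuousOn (fun t => w t x) S)
    (hd : ∀ x, ∀ t ∈ T, DifferentiableAt ℝ (fun t => w t x) t) :
    ∃ (N : ℕ) (β : Fin N → X → κ → ℝ) (c : ℝ → Fin N → ℝ), (∀ i, β i ∈ W) ∧ ContinuousOn c S ∧
      (∀ t ∈ T, DifferentiableAt ℝ c t) ∧ ∀ t ∈ S, w t = ∑ i, c t i • β i := by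
  classical
  -- The default value `0` is irrelevant, since on `S` the path lies in `W`.
  let z : ℝ → W := fun t => if h : w t ∈ W then ⟨w t, h⟩ else 0
  have hz : ∀ t ∈ S, (z t : X → κ → ℝ) = w t := fun t ht => by simp [z, hw t ht]
  let ev : X × κ → Module.Dual ℝ W := fun q =>
    (LinearMap.proj q.2 ∘ₗ LinearMap.proj q.1 ∘ₗ W.subtype : W →ₗ[ℝ] ℝ)
  -- A function annihilated by all point evaluations is zero, so in finite dimension the evaluations
  -- span the dual. Regularity then passes from evaluations to all functionals, in particular to the
  -- coordinates.
  have hspan : Submodule.span ℝ (range ev) = ⊤ := by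
    have h0 : (Submodule.span ℝ (range ev)).dualCoannihilator = ⊥ := by
      refine (Submodule.eq_bot_iff _).2 fun x hx => ?_
      rw [Submodule.mem_dualCoannihilator] at hx
      refine Subtype.ext (funext fun y => funext fun k => ?_)
      exact hx (ev (y, k)) (Submodule.subset_span (mem_range_self _))
    rw [← Subspace.dualCoannihilator_dualAnnihilator_eq (W := Submodule.span ℝ (range ev)), h0,
      Submodule.dualAnnihilator_bot]
  have key : ∀ ℓ : Module.Dual ℝ W, ContinuousOn (fun t => ℓ (z t)) S ∧
      ∀ t ∈ T, DifferentiableAt ℝ (fun t => ℓ (z t)) t := fun ℓ => by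
    have hℓ : ℓ ∈ Submodule.span ℝ (range ev) := hspan ▸ Submodule.mem_top
    induction hℓ using Submodule.span_induction with
    | mem ℓ h =>
      obtain ⟨⟨x, k⟩, rfl⟩ := h
      have he : ∀ t ∈ S, ev (x, k) (z t) = w t x k := fun t ht =>
        congrFun (congrFun (hz t ht) x) k
      refine ⟨(continuousOn_pi.1 (hc x) k).congr he, fun t ht => ?_⟩
      refine (differentiableAt_pi.1 (hd x t ht) k).congr_of_eventuallyEq ?_
      filter_upwards [hT.mem_nhds ht] with r hr using he r (hTS hr)
    | zero => exact ⟨continuousOn_const, fun t _ => differentiableAt_const _⟩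
    | add a b _ _ ha hb => exact ⟨ha.1.add hb.1, fun t ht => (ha.2 t ht).add (hb.2 t ht)⟩
    | smul r a _ ha => exact ⟨ha.1.const_smul r, fun t ht => (ha.2 t ht).const_smul r⟩
  let b := Module.finBasis ℝ W
  refine ⟨_, fun i => (b i : X → κ → ℝ), fun t i => b.coord i (z t), fun i => (b i).2,
    continuousOn_pi.2 fun i => (key (b.coord i)).1,
    fun t ht => differentiableAt_pi.2 fun i => (key (b.coord i)).2 t ht, fun t ht => ?_⟩
  rw [← hz t ht]
  have hsum := congrArg W.subtype (b.sum_repr (z t)).symm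
  rw [map_sum] at hsum
  exact hsum

/-- The linear map that sends components to the corresponding function on a set. -/
def restrictPolyState (k : ℕ) (C : Set (Space d)) :
    (Comp d → MvPolynomial.restrictTotalDegree (Fin d) ℝ k) →ₗ[ℝ] (C → Comp d → ℝ) where
  toFun Q ξ := polyState (fun c => (Q c : MvPolynomial (Fin d) ℝ)) ξ
  map_add' Q Q' := by funext ξ c; simp [polyState, polyEval]
  map_smul' r Q := by funext ξ c; simp [polyState, polyEval, MvPolynomial.smul_eval]

/-- A path of polynomial states is the image of a path in `ℝ^N`. -/
theorem exists_polyState_path {k : ℕ} {C : Set (Space d)} {S T : Set ℝ} (hT : IsOpen T)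
    (hTS : T ⊆ S) {w : ℝ → Space d → State d}
    (hw : ∀ t ∈ S, ∃ Q : Comp d → MvPolynomial (Fin d) ℝ, (∀ c, (Q c).totalDegree ≤ k) ∧
      ∀ ξ ∈ C, w t ξ = polyState Q ξ)
    (hc : ∀ ξ ∈ C, ContinuousOn (fun t => w t ξ) S)
    (hd : ∀ ξ ∈ C, ∀ t ∈ T, DifferentiableAt ℝ (fun t => w t ξ) t) :
    ∃ (N : ℕ) (B : Space d → (Fin N → ℝ) →L[ℝ] State d) (c : ℝ → Fin N → ℝ), Continuous B ∧
      ContinuousOn c S ∧ (∀ t ∈ T, DifferentiableAt ℝ c t) ∧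
      ∀ t ∈ S, ∀ ξ ∈ C, w t ξ = B ξ (c t) := by
  obtain ⟨N, β, c, hβ, hcc, hcd, he⟩ := exists_coordinates
    (LinearMap.range (restrictPolyState k C)) hT hTS (w := fun t (ξ : C) => w t ξ)
    (fun t ht => by
      obtain ⟨Q, hQ, hQe⟩ := hw t ht
      refine ⟨fun c => ⟨Q c, (MvPolynomial.mem_restrictTotalDegree _ _ _).2 (hQ c)⟩, ?_⟩
      exact funext fun ξ => (hQe ξ ξ.2).symm)
    (fun ξ => hc ξ ξ.2) (fun ξ => hd ξ ξ.2)
  choose Q hQ using hβ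
  let β' : Fin N → Space d → State d := fun i =>
    polyState fun c => (Q i c : MvPolynomial (Fin d) ℝ)
  refine ⟨N, fun ξ => ∑ i, (ContinuousLinearMap.proj (R := ℝ) (φ := fun _ : Fin N => ℝ) i).smulRight
    (β' i ξ), c, ?_, hcc, hcd, fun t ht ξ hξ => ?_⟩
  · refine continuous_finsetSum _ fun i _ => ?_
    exact (ContinuousLinearMap.smulRightL ℝ (Fin N → ℝ) (State d)
      (ContinuousLinearMap.proj i)).continuous.comp (continuous_polyState _)
  · have h1 := congrFun (he t ht) ⟨ξ, hξ⟩
    simp only [Finset.sum_apply, Pi.smul_apply, ← hQ] at h1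
    rw [h1, sum_apply]
    rfl

/-- Differentiation under the integral sign for a parameter in a finite-dimensional space. -/
theorem hasFDerivAt_integral_of_contDiffOn {Y E V : Type*} [TopologicalSpace Y] [T2Space Y]
    [MeasurableSpace Y] [BorelSpace Y] [SecondCountableTopology Y] {μ : Measure Y}
    [IsFiniteMeasureOnCompacts μ]
    [NormedAddCommGroup E] [NormedSpace ℝ E] [FiniteDimensional ℝ E]
    [NormedAddCommGroup V] [NormedSpace ℝ V]
    {C : Set Y} (hC : IsCompact C) {ρ : Y → ℝ} (hρ : Continuous ρ) {h : V → ℝ} {U : Set V}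
    (hU : IsOpen U) (hh : ContDiffOn ℝ 1 h U) {B : Y → E →L[ℝ] V} (hB : Continuous B) {a₀ : E}
    (ha₀ : ∀ ξ ∈ C, B ξ a₀ ∈ U) :
    HasFDerivAt (fun a => ∫ ξ in C, ρ ξ * h (B ξ a) ∂μ)
      (∫ ξ in C, ρ ξ • (fderiv ℝ h (B ξ a₀)).comp (B ξ) ∂μ) a₀ ∧
    IntegrableOn (fun ξ => ρ ξ • (fderiv ℝ h (B ξ a₀)).comp (B ξ)) C μ := by
  have hG : Continuous fun q : E × Y => B q.2 q.1 := (hB.comp continuous_snd).clm_apply continuous_fst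
  -- The tube lemma over the compact set `C` gives one neighbourhood of parameters whose states stay
  -- in `U` for all points of `C`. On a closed ball inside it the derivative has a uniform bound.
  obtain ⟨u, v, hu, -, hau, hCv, huv⟩ := generalized_tube_lemma (isCompact_singleton (x := a₀)) hC
    (hU.preimage hG) (by
      rintro ⟨a, ξ⟩ ⟨ha, hξ⟩
      rw [mem_singleton_iff] at ha
      subst ha
      exact ha₀ ξ hξ)
  obtain ⟨r, hr, hru⟩ := Metric.nhds_basis_closedBall.mem_iff.1 (hu.mem_nhds (hau rfl))
  have hmem : ∀ a ∈ Metric.closedBall a₀ r, ∀ ξ ∈ C, B ξ a ∈ U := fun a ha ξ hξ =>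
    huv (show (a, ξ) ∈ u ×ˢ v from ⟨hru ha, hCv hξ⟩)
  have hfd : ContinuousOn (fderiv ℝ h) U := hh.continuousOn_fderiv_of_isOpen hU le_rfl
  have : ProperSpace E := FiniteDimensional.proper ℝ E
  have hF' : ContinuousOn (fun q : E × Y => ρ q.2 • (fderiv ℝ h (B q.2 q.1)).comp (B q.2))
      (Metric.closedBall a₀ r ×ˢ C) := by
    refine (hρ.comp continuous_snd).continuousOn.smul (ContinuousOn.clm_comp
      (hfd.comp hG.continuousOn fun q hq => hmem _ hq.1 _ hq.2)
      (hB.comp continuous_snd).continuousOn)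
  obtain ⟨K, hK⟩ := ((isCompact_closedBall a₀ r).prod hC).exists_bound_of_continuousOn hF'
  have hF : ∀ a ∈ Metric.closedBall a₀ r, IntegrableOn (fun ξ => ρ ξ * h (B ξ a)) C μ :=
    fun a ha => ContinuousOn.integrableOn_compact hC (hρ.continuousOn.mul (hh.continuousOn.comp
      (hB.clm_apply continuous_const).continuousOn (hmem a ha)))
  have ha₀r : a₀ ∈ Metric.closedBall a₀ r := Metric.mem_closedBall_self hr.le
  have hI : IntegrableOn (fun ξ => ρ ξ • (fderiv ℝ h (B ξ a₀)).comp (B ξ)) C μ :=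
    ContinuousOn.integrableOn_compact hC
      (hF'.comp (f := fun ξ => (a₀, ξ)) (by fun_prop) fun ξ hξ => ⟨ha₀r, hξ⟩)
  refine ⟨hasFDerivAt_integral_of_dominated_of_fderiv_le
    (F' := fun a ξ => ρ ξ • (fderiv ℝ h (B ξ a)).comp (B ξ)) (bound := fun _ => K)
    (Metric.closedBall_mem_nhds a₀ hr) ?_ (hF a₀ ha₀r) hI.aestronglyMeasurable ?_ ?_ ?_, hI⟩
  · filter_upwards [Metric.closedBall_mem_nhds a₀ hr] with a ha using (hF a ha).aestronglyMeasurable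
  · exact (ae_restrict_iff' hC.measurableSet).2 (Filter.Eventually.of_forall fun ξ hξ a ha =>
      hK (a, ξ) ⟨ha, hξ⟩)
  · exact integrableOn_const hC.measure_lt_top.ne
  · refine (ae_restrict_iff' hC.measurableSet).2 (Filter.Eventually.of_forall fun ξ hξ a ha => ?_)
    have h1 : HasFDerivAt h (fderiv ℝ h (B ξ a)) (B ξ a) :=
      ((hh.contDiffAt (hU.mem_nhds (hmem a ha ξ hξ))).differentiableAt one_ne_zero).hasFDerivAt
    exact (h1.comp a (B ξ).hasFDerivAt).const_smul (ρ ξ)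

/-- Differentiation of the integral of a function of a path of polynomial states. -/
theorem hasDerivAt_integral_polyState_path {k : ℕ} {C : Set (Space d)} (hC : IsCompact C)
    {S T : Set ℝ} (hT : IsOpen T)
    (hTS : T ⊆ S) {w : ℝ → Space d → State d}
    (hw : ∀ t ∈ S, ∃ Q : Comp d → MvPolynomial (Fin d) ℝ, (∀ c, (Q c).totalDegree ≤ k) ∧
      ∀ ξ ∈ C, w t ξ = polyState Q ξ)
    (hc : ∀ ξ ∈ C, ContinuousOn (fun t => w t ξ) S)
    (hd : ∀ ξ ∈ C, ∀ t ∈ T, DifferentiableAt ℝ (fun t => w t ξ) t)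
    {ρ : Space d → ℝ} (hρ : Continuous ρ) {h : State d → ℝ} {U : Set (State d)}
    (hU : IsOpen U) (hh : ContDiffOn ℝ 1 h U) (hwU : ∀ t ∈ S, ∀ ξ ∈ C, w t ξ ∈ U) :
    ContinuousOn (fun t => ∫ ξ in C, ρ ξ * h (w t ξ)) S ∧
    ∀ t ∈ T, HasDerivAt (fun t => ∫ ξ in C, ρ ξ * h (w t ξ))
      (∫ ξ in C, ρ ξ * deriv (fun t => h (w t ξ)) t) t := by
  obtain ⟨N, B, c, hB, hcc, hcd, he⟩ := exists_polyState_path hT hTS hw hc hd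
  have hI : ∀ t ∈ S, ∫ ξ in C, ρ ξ * h (w t ξ) = ∫ ξ in C, ρ ξ * h (B ξ (c t)) := fun t ht =>
    setIntegral_congr_fun hC.measurableSet fun ξ hξ => by simp only [he t ht ξ hξ]
  have hBU : ∀ t ∈ S, ∀ ξ ∈ C, B ξ (c t) ∈ U := fun t ht ξ hξ => by
    rw [← he t ht ξ hξ]; exact hwU t ht ξ hξ
  have key := fun t ht => hasFDerivAt_integral_of_contDiffOn (μ := volume) hC hρ hU hh hB
    (hBU t ht)
  refine ⟨fun t ht => ?_, fun t ht => ?_⟩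
  · have h1 := (key t ht).1.continuousAt.comp_continuousWithinAt (hcc t ht)
    exact h1.congr hI (hI t ht)
  · have htS := hTS ht
    have h1 := (key t htS).1.comp_hasDerivAt t (hcd t ht).hasDerivAt
    rw [ContinuousLinearMap.integral_apply (key t htS).2] at h1
    have h2 : ∀ᶠ r in nhds t, r ∈ S := Filter.mem_of_superset (hT.mem_nhds ht) hTS
    refine (h1.congr_of_eventuallyEq (h2.mono hI)).congr_deriv ?_
    refine setIntegral_congr_fun hC.measurableSet fun ξ hξ => ?_
    have h3 : HasFDerivAt h (fderiv ℝ h (B ξ (c t))) (B ξ (c t)) :=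
      ((hh.contDiffAt (hU.mem_nhds (hBU t htS ξ hξ))).differentiableAt one_ne_zero).hasFDerivAt
    have h4 := h3.comp_hasDerivAt t ((B ξ).hasFDerivAt.comp_hasDerivAt t (hcd t ht).hasDerivAt)
    have h5 := h4.congr_of_eventuallyEq (f₁ := fun t => h (w t ξ))
      (h2.mono fun r hr => by simp only [he r hr ξ hξ, Function.comp])
    simp only [h5.deriv]
    rfl

end

section

/-! ### Entropy stability -/

theorem contDiffOn_entropy_consVar {γ : ℝ} (hγ : 1 < γ) (s₀ : ℝ) :
    ContDiffOn ℝ ⊤ (fun v : State d => entropy γ s₀ (consVar γ s₀ v)) (negLast d) := by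
  have h1 : ContDiffOn ℝ ⊤ (fun v : State d => v ⬝ᵥ consVar γ s₀ v - (γ - 1) * density γ s₀ v)
      (negLast d) := by
    refine ContDiffOn.sub ?_ (contDiffOn_const.mul (contDiffOn_density hγ s₀))
    exact ContDiffOn.sum fun i _ => ((contDiff_apply ℝ ℝ i).contDiffOn).mul
      (contDiffOn_pi.1 (contDiffOn_consVar hγ s₀) i)
  exact h1.congr fun v hv => entropy_consVar hγ s₀ hv

/-- The time derivative of the entropy is `v · ∂ₜu`. -/
theorem deriv_entropy_consVar {γ : ℝ} (hγ : 1 < γ) (s₀ : ℝ) {v : ℝ → State d} {t : ℝ}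
    (hv : DifferentiableAt ℝ v t) (hneg : v t ∈ negLast d) :
    deriv (fun t => entropy γ s₀ (consVar γ s₀ (v t))) t
      = ∑ i, deriv (fun t => consVar γ s₀ (v t) i) t * v t i := by
  have hu : DifferentiableAt ℝ (fun t => consVar γ s₀ (v t)) t :=
    (hasFDerivAt_consVar hγ s₀ hneg).differentiableAt.comp t hv
  have hρ := (hasFDerivAt_density hγ s₀ hneg).comp_hasDerivAt t hv.hasDerivAt
  have hdot : HasDerivAt (fun t => ∑ i, v t i * consVar γ s₀ (v t) i)
      (∑ i, (deriv v t i * consVar γ s₀ (v t) i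
        + v t i * deriv (fun t => consVar γ s₀ (v t) i) t)) t :=
    HasDerivAt.fun_sum fun i _ => (hasDerivAt_pi.1 hv.hasDerivAt i).mul
      (differentiableAt_pi.1 hu i).hasDerivAt
  have h1 := hdot.sub (hρ.const_mul (γ - 1))
  have h2 : ∀ᶠ r in nhds t, v r ∈ negLast d :=
    hv.continuousAt.eventually_mem (isOpen_negLast.mem_nhds hneg)
  have h3 := h1.congr_of_eventuallyEq (f₁ := fun t => entropy γ s₀ (consVar γ s₀ (v t)))
    (h2.mono fun r hr => entropy_consVar hγ s₀ hr)
  -- The term `u · ∂ₜv` cancels against the derivative of `(γ - 1) ρ`.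
  rw [h3.deriv, Finset.sum_add_distrib]
  have hg : γ - 1 ≠ 0 := by linarith
  simp only [smul_apply, dotCL_apply, smul_eq_mul, mul_inv_cancel_left₀ hg, dotProduct,
    mul_comm (deriv v t _), add_sub_cancel_left, mul_comm (v t _)]

namespace PeriodicMesh

variable {n p : ℕ} {Elem Face : Type*} (M : PeriodicMesh (n + 1) p Elem Face)

theorem polyMap_mem_closedElem (K : Elem) {ξ : Space (n + 1)} (hξ : ξ ∈ M.Kref) :
    polyMap (M.poly K) ξ ∈ M.closedElem K := by
  rw [← M.map_eq]; exact mem_image_of_mem _ hξ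

theorem elem_subset_closedElem (K : Elem) : M.elem K ⊆ M.closedElem K :=
  image_mono interior_subset

theorem isOpen_elem (K : Elem) : IsOpen (M.elem K) := by
  rw [M.elem_eq]
  exact isOpen_polyMap_image isOpen_interior fun ξ hξ => M.det_ne_zero K (interior_subset hξ)

theorem elem_nonempty (K : Elem) : (M.elem K).Nonempty := M.Kref_interior.image _

theorem memV_const (k : ℕ) (a : State (n + 1)) : M.MemV k fun _ _ => a := fun _ i =>
  ⟨MvPolynomial.C (a i), by simp, fun _ _ => by simp⟩

theorem memM_const (k : ℕ) (EE : Set Face) (a : State (n + 1)) : M.MemM k EE fun _ _ => a :=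
  ⟨fun _ i => ⟨MvPolynomial.C (a i), by simp, fun _ _ => by simp⟩, fun _ _ _ _ _ _ _ _ _ => rfl⟩

theorem integrableOn_elem {k : ℕ} {w : Elem → Space (n + 1) → State (n + 1)} (hw : M.MemV k w)
    {U : Set (State (n + 1))} (hwU : ∀ K, ∀ x ∈ M.closedElem K, w K x ∈ U)
    {h : State (n + 1) → ℝ} (hh : ContinuousOn h U) (K : Elem) :
    IntegrableOn (fun x => h (w K x)) (M.elem K) := by
  rw [M.elem_eq, integrableOn_polyMap_image M.Kref_convex (M.injOn_polyMap K)]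
  obtain ⟨Q, -, hQ⟩ := M.exists_polyState hw K
  refine ContinuousOn.integrableOn_compact M.Kref_compact
    ((continuous_det_polyMapDeriv _).abs.continuousOn.mul (hh.comp ?_
      fun ξ hξ => hwU K _ (M.polyMap_mem_closedElem K hξ)))
  exact (continuous_polyState Q).continuousOn.congr hQ

theorem volume_elem_lt_top (K : Elem) : volume (M.elem K) < ⊤ :=
  (measure_mono (M.elem_subset K)).trans_lt M.isBounded.measure_lt_top

theorem volume_Ω_pos : 0 < volume.real M.Ω :=
  ENNReal.toReal_pos (M.isOpen.measure_pos volume M.isConnected.nonempty).ne'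
    M.isBounded.measure_lt_top.ne

theorem nonempty_elem (M : PeriodicMesh (n + 1) p Elem Face) : Nonempty Elem := by
  obtain ⟨x, hx⟩ := M.isConnected.nonempty.closure
  rw [M.elem_cover] at hx
  exact ⟨(mem_iUnion.1 hx).choose⟩

section State

variable {k : ℕ} {γ s₀ : ℝ} {w : Elem → Space (n + 1) → State (n + 1)}

theorem integrableOn_consVar (hγ : 1 < γ) (hw : M.MemV k w)
    (hneg : ∀ K, ∀ x ∈ M.closedElem K, w K x ∈ negLast (n + 1)) (K : Elem) (i : Comp (n + 1)) :
    IntegrableOn (fun x => consVar γ s₀ (w K x) i) (M.elem K) :=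
  M.integrableOn_elem hw hneg (h := fun v => consVar γ s₀ v i)
    (continuousOn_pi.1 (contDiffOn_consVar hγ s₀).continuousOn i) K

theorem integrableOn_affine (hγ : 1 < γ) (hw : M.MemV k w)
    (hneg : ∀ K, ∀ x ∈ M.closedElem K, w K x ∈ negLast (n + 1)) (a : ℝ) (q : State (n + 1))
    (K : Elem) : IntegrableOn (fun x => a + q ⬝ᵥ consVar γ s₀ (w K x)) (M.elem K) :=
  M.integrableOn_elem hw hneg (h := fun v => a + q ⬝ᵥ consVar γ s₀ v)
    (continuousOn_const.add ((dotCL q).continuous.comp_continuousOn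
      (contDiffOn_consVar hγ s₀).continuousOn)) K

end State

variable [Fintype Elem]

/-- The open elements are disjoint and fill `Ω` up to the images of the reference frontier, which
are null because the frontier of a convex set is null and smooth maps preserve null sets. -/
theorem sum_volume_elem : ∑ K, volume.real (M.elem K) = volume.real M.Ω := by
  have hU : volume (⋃ K, M.elem K) = ∑ K, volume (M.elem K) := by
    rw [← tsum_fintype (L := SummationFilter.unconditional _)]
    exact measure_iUnion (fun K K' h => M.elem_disjoint K K' h)
      fun K => (M.isOpen_elem K).measurableSet
  have hnull : volume (⋃ K, M.map K '' frontier M.Kref) = 0 := by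
    refine measure_iUnion_null fun K => ?_
    rw [M.map_eq]
    exact addHaar_image_eq_zero_of_differentiableOn_of_addHaar_eq_zero volume
      (fun ξ _ => (hasFDerivAt_polyMap (M.poly K) ξ).differentiableAt.differentiableWithinAt)
      (M.Kref_convex.addHaar_frontier volume)
  have hle : volume M.Ω ≤ ∑ K, volume (M.elem K) := by
    rw [← hU, ← add_zero (volume (⋃ K, M.elem K)), ← hnull]
    refine (measure_mono ?_).trans (measure_union_le _ _)
    refine subset_closure.trans ?_
    rw [M.elem_cover, ← iUnion_union_distrib]
    refine iUnion_mono fun K => ?_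
    rw [elem, ← image_union]
    refine image_mono ?_
    rw [M.Kref_compact.isClosed.frontier_eq]
    exact fun x hx => or_iff_not_imp_left.2 fun h => ⟨hx, h⟩
  have hge : ∑ K, volume (M.elem K) ≤ volume M.Ω :=
    hU ▸ measure_mono (iUnion_subset M.elem_subset)
  rw [Measure.real, hle.antisymm hge, ENNReal.toReal_sum fun K _ => (M.volume_elem_lt_top K).ne]
  rfl

theorem meshIntegral_eq (g : Elem → Space (n + 1) → ℝ) :
    M.meshIntegral g = ∑ K, ∫ ξ in M.Kref,
      |(polyMapDeriv (M.poly K) ξ).det| * g K (polyMap (M.poly K) ξ) :=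
  Finset.sum_congr rfl fun K _ => by
    rw [M.elem_eq, integral_polyMap_image M.Kref_convex (M.injOn_polyMap K)]

theorem meshIntegral_const (a : ℝ) : M.meshIntegral (fun _ _ => a) = volume.real M.Ω * a := by
  rw [meshIntegral, ← M.sum_volume_elem, Finset.sum_mul]
  exact Finset.sum_congr rfl fun K _ => by simp

theorem meshIntegral_mono {f g : Elem → Space (n + 1) → ℝ}
    (hf : ∀ K, IntegrableOn (f K) (M.elem K)) (hg : ∀ K, IntegrableOn (g K) (M.elem K))
    (hfg : ∀ K, ∀ x ∈ M.elem K, f K x ≤ g K x) : M.meshIntegral f ≤ M.meshIntegral g :=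
  Finset.sum_le_sum fun K _ =>
    setIntegral_mono_on (hf K) (hg K) (M.isOpen_elem K).measurableSet (hfg K)

theorem meshIntegral_pos {f : Elem → Space (n + 1) → ℝ}
    (hf : ∀ K, IntegrableOn (f K) (M.elem K)) (hpos : ∀ K, ∀ x ∈ M.elem K, 0 < f K x) :
    0 < M.meshIntegral f := by
  have := M.nonempty_elem
  refine Finset.sum_pos (fun K _ => ?_) Finset.univ_nonempty
  have hm := (M.isOpen_elem K).measurableSet
  rw [setIntegral_pos_iff_support_of_nonneg_ae
    ((ae_restrict_iff' hm).2 (Filter.Eventually.of_forall fun x hx => (hpos K x hx).le)) (hf K)]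
  refine ((M.isOpen_elem K).measure_pos volume (M.elem_nonempty K)).trans_le (measure_mono ?_)
  exact fun x hx => ⟨(hpos K x hx).ne', hx⟩

section State

variable {k : ℕ} {γ s₀ : ℝ} {w : Elem → Space (n + 1) → State (n + 1)}

/-- The integral of an affine function of `u` depends only on the mean of `u`; this turns tangent
plane bounds into Jensen-type inequalities. -/
theorem meshIntegral_affine (hγ : 1 < γ) (hw : M.MemV k w)
    (hneg : ∀ K, ∀ x ∈ M.closedElem K, w K x ∈ negLast (n + 1)) (a : ℝ) (q : State (n + 1)) :
    M.meshIntegral (fun K x => a + q ⬝ᵥ consVar γ s₀ (w K x))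
      = volume.real M.Ω * (a + q ⬝ᵥ M.uStar γ s₀ w) := by
  have h1 : M.meshIntegral (fun K x => a + q ⬝ᵥ consVar γ s₀ (w K x))
      = M.meshIntegral (fun _ _ => a)
        + ∑ i, q i * M.meshIntegral (fun K x => consVar γ s₀ (w K x) i) := by
    simp only [meshIntegral, Finset.mul_sum]
    rw [Finset.sum_comm, ← Finset.sum_add_distrib]
    refine Finset.sum_congr rfl fun K _ => ?_
    have hi : ∀ i, IntegrableOn (fun x => q i * consVar γ s₀ (w K x) i) (M.elem K) := fun i =>
      (M.integrableOn_consVar hγ hw hneg K i).const_mul (q i)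
    simp only [dotProduct, ← integral_const_mul]
    rw [integral_add (integrableOn_const (C := a) (M.volume_elem_lt_top K).ne)
      (integrable_finsetSum _ fun i _ => hi i), integral_finsetSum _ fun i _ => hi i]
  have hΩ := M.volume_Ω_pos.ne'
  rw [h1, M.meshIntegral_const, mul_add, dotProduct, Finset.mul_sum]
  congr 1
  refine Finset.sum_congr rfl fun i _ => ?_
  simp only [uStar]
  field_simp

/-- The minimum total entropy state is physical. -/
theorem uStar_mem_physStates (hγ : 1 < γ) (hw : M.MemV k w)
    (hneg : ∀ K, ∀ x ∈ M.closedElem K, w K x ∈ negLast (n + 1)) :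
    M.uStar γ s₀ w ∈ physStates (n + 1) γ := by
  have hmem : ∀ K, ∀ x ∈ M.elem K, consVar γ s₀ (w K x) ∈ physStates (n + 1) γ := fun K x hx =>
    consVar_mem hγ s₀ (hneg K x (M.elem_subset_closedElem K hx))
  have hΩ := M.volume_Ω_pos
  have hfst : 0 < fstC (M.uStar γ s₀ w) :=
    mul_pos (inv_pos.2 hΩ) (M.meshIntegral_pos (fun K => M.integrableOn_consVar hγ hw hneg K _)
      fun K x hx => (hmem K x hx).1)
  refine ⟨hfst, ?_⟩
  set a := M.uStar γ s₀ w with ha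
  -- The functional `q` is the tangent plane of the concave pressure at the mean `a`. Its integral
  -- is positive because it dominates the pointwise pressure, and its value at `a` is the pressure
  -- of `a`.
  let q : State (n + 1) := (γ - 1) • mkState ((∑ j, (midC a j / fstC a) ^ 2) / 2)
    (fun j => -(midC a j / fstC a)) 1
  have hq : ∀ u : State (n + 1), q ⬝ᵥ u = (γ - 1) * (lastC u - ∑ j, midC a j / fstC a * midC u j
      + (∑ j, (midC a j / fstC a) ^ 2) / 2 * fstC u) := fun u => by
    rw [smul_dotProduct, dotProduct_state, smul_eq_mul]
    simp only [mkState, fstC, midC, lastC, Sum.elim_inl, Sum.elim_inr, neg_mul,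
      Finset.sum_neg_distrib]
    ring
  have hpos : 0 < M.meshIntegral (fun K x => 0 + q ⬝ᵥ consVar γ s₀ (w K x)) := by
    refine M.meshIntegral_pos (fun K => M.integrableOn_affine hγ hw hneg 0 q K) fun K x hx => ?_
    rw [zero_add, hq]
    exact (hmem K x hx).2.trans_le (pressure_le_tangent hγ (hmem K x hx).1 hfst)
  rw [M.meshIntegral_affine hγ hw hneg, zero_add, ← ha, hq] at hpos
  refine (pos_of_mul_pos_right hpos hΩ.le).trans_le (le_of_eq ?_)
  rw [pressure]
  congr 1
  have e1 : ∑ j, midC a j / fstC a * midC a j = (∑ j, midC a j ^ 2) / fstC a := by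
    rw [Finset.sum_div]; exact Finset.sum_congr rfl fun j _ => by ring
  have e2 : ∑ j, (midC a j / fstC a) ^ 2 = (∑ j, midC a j ^ 2) / fstC a ^ 2 := by
    rw [Finset.sum_div]; exact Finset.sum_congr rfl fun j _ => by rw [div_pow]
  rw [e1, e2]
  field_simp
  ring

/-- The entropy of the minimum total entropy state is a lower bound. -/
theorem meshIntegral_entropy_uStar_le (hγ : 1 < γ) (hw : M.MemV k w)
    (hneg : ∀ K, ∀ x ∈ M.closedElem K, w K x ∈ negLast (n + 1)) :
    M.meshIntegral (fun _ _ => entropy γ s₀ (M.uStar γ s₀ w)) ≤ M.totalEntropy γ s₀ w := by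
  set a := M.uStar γ s₀ w with ha
  have hphys := M.uStar_mem_physStates (s₀ := s₀) hγ hw hneg
  have hb : entropyVar γ s₀ a ∈ negLast (n + 1) := by
    rw [← physEntropyStates_eq hγ s₀]; exact mem_image_of_mem _ hphys
  have hcb : consVar γ s₀ (entropyVar γ s₀ a) = a := consVar_entropyVar hγ s₀ hphys
  set b := entropyVar γ s₀ a
  -- Jensen's inequality: the affine minorant is tangent to `H` at the mean state, so its integral
  -- over the mesh is the entropy of the constant state.
  have h1 : M.meshIntegral (fun K x => (entropy γ s₀ a - b ⬝ᵥ a) + b ⬝ᵥ consVar γ s₀ (w K x))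
      ≤ M.totalEntropy γ s₀ w := by
    refine M.meshIntegral_mono (fun K => M.integrableOn_affine hγ hw hneg _ _ K)
      (fun K => M.integrableOn_elem hw hneg (h := fun v => entropy γ s₀ (consVar γ s₀ v))
        (contDiffOn_entropy_consVar hγ s₀).continuousOn K) fun K x hx => ?_
    have := entropy_tangent_le hγ s₀ (hneg K x (M.elem_subset_closedElem K hx)) hb
    rw [hcb, dotProduct_sub] at this
    linarith
  rw [M.meshIntegral_affine hγ hw hneg, ← ha, sub_add_cancel] at h1
  rwa [M.meshIntegral_const]

end State

/-- Differentiation in time of the integral of a function of the discrete solution. -/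
theorem hasDerivAt_meshIntegral {k : ℕ} {tf : ℝ} {vh : ℝ → Elem → Space (n + 1) → State (n + 1)}
    (hV : ∀ t ∈ Icc 0 tf, M.MemV k (vh t))
    (hc : ∀ K, ∀ x ∈ M.closedElem K, ContinuousOn (fun t => vh t K x) (Icc 0 tf))
    (hd : ∀ K, ∀ x ∈ M.closedElem K, ∀ t ∈ Ioo 0 tf, DifferentiableAt ℝ (fun t => vh t K x) t)
    {U : Set (State (n + 1))} (hU : IsOpen U)
    (hvU : ∀ t ∈ Icc 0 tf, ∀ K, ∀ x ∈ M.closedElem K, vh t K x ∈ U)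
    {h : State (n + 1) → ℝ} (hh : ContDiffOn ℝ 1 h U) :
    ContinuousOn (fun t => M.meshIntegral fun K x => h (vh t K x)) (Icc 0 tf) ∧
    ∀ t ∈ Ioo 0 tf, HasDerivAt (fun t => M.meshIntegral fun K x => h (vh t K x))
      (M.meshIntegral fun K x => deriv (fun t => h (vh t K x)) t) t := by
  have key := fun K => hasDerivAt_integral_polyState_path (k := k) M.Kref_compact
    isOpen_Ioo Ioo_subset_Icc_self (w := fun t ξ => vh t K (polyMap (M.poly K) ξ))
    (fun t ht => M.exists_polyState (hV t ht) K)
    (fun ξ hξ => hc K _ (M.polyMap_mem_closedElem K hξ))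
    (fun ξ hξ => hd K _ (M.polyMap_mem_closedElem K hξ))
    (continuous_det_polyMapDeriv (M.poly K)).abs hU hh
    fun t ht ξ hξ => hvU t ht K _ (M.polyMap_mem_closedElem K hξ)
  simp only [M.meshIntegral_eq]
  exact ⟨continuousOn_finsetSum _ fun K _ => (key K).1,
    fun t ht => HasDerivAt.fun_sum fun K _ => (key K).2 t ht⟩

/-- The scheme with a dissipative stabilization matrix is entropy stable. -/
theorem IsSolution.isEntropyStable [Fintype Face] (hn : n + 1 ≤ 3) {k : ℕ} {EE : Set Face}
    {γ s₀ tf : ℝ} (hγ : 1 < γ) (htf : 0 < tf) {σ : Stabilization (n + 1)}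
    (hσ : IsDissipative γ s₀ σ) {u₀ : Space (n + 1) → State (n + 1)}
    {vh : ℝ → Elem → Space (n + 1) → State (n + 1)}
    {vhat : ℝ → Face → Space (n + 1) → State (n + 1)}
    (hphys : M.IsPhysical γ s₀ tf vh vhat)
    (hsol : M.IsSolution k EE γ s₀ tf σ u₀ vh vhat) : M.IsEntropyStable γ s₀ tf vh := by
  have hel : ∀ t ∈ Icc 0 tf, ∀ K, ∀ x ∈ M.closedElem K, vh t K x ∈ negLast (n + 1) := by
    rw [← physEntropyStates_eq hγ s₀]; exact hphys.element
  have htr : ∀ t ∈ Ioo 0 tf, ∀ F, ∀ s ∈ M.fref,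
      vhat t F (M.facePoint F s) ∈ negLast (n + 1) := by
    rw [← physEntropyStates_eq hγ s₀]; exact hphys.trace
  have hdiff := fun (h : State (n + 1) → ℝ) (hh : ContDiffOn ℝ 1 h (negLast (n + 1))) =>
    M.hasDerivAt_meshIntegral hsol.mem_V hsol.continuousOn hsol.differentiableAt isOpen_negLast
      hel hh
  obtain ⟨hHc, hHd⟩ := hdiff _ ((contDiffOn_entropy_consVar hγ s₀).of_le (by simp))
  have hI0 : ∀ t ∈ Ioo 0 tf, M.meshIntegral
      (fun K x => deriv (fun t => entropy γ s₀ (consVar γ s₀ (vh t K x))) t) ≤ 0 := fun t ht => by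
    have ht' := Ioo_subset_Icc_self ht
    have e1 : M.meshIntegral
        (fun K x => deriv (fun t => entropy γ s₀ (consVar γ s₀ (vh t K x))) t)
        = M.meshIntegral (fun K x =>
          ∑ i, deriv (fun t' => consVar γ s₀ (vh t' K x) i) t * vh t K x i) :=
      Finset.sum_congr rfl fun K _ => setIntegral_congr_fun (M.isOpen_elem K).measurableSet
        fun x hx => deriv_entropy_consVar hγ s₀
          (hsol.differentiableAt K x (M.elem_subset_closedElem K hx) t ht)
          (hel t ht' K x (M.elem_subset_closedElem K hx))
    -- The solution is its own test function. The time term becomes the entropy rate, and the volume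
    -- and face terms are compared through the potential.
    have e2 := hsol.euler t ht (vh t) (hsol.mem_V t ht')
    have e3 := M.meshIntegral_flux_fderiv hn hγ s₀ (hsol.mem_V t ht') (hel t ht')
    have e4 := M.skeletonIntegral_normalPotential_le hγ hσ (hsol.mem_V t ht') (hsol.mem_M t ht)
      (hel t ht') (htr t ht) (hsol.flux_integrable t ht)
      (hsol.conservation t ht _ (hsol.mem_M t ht))
    linarith
  have hcons : ∀ i, ∀ t ∈ Icc 0 tf, M.meshIntegral (fun K x => consVar γ s₀ (vh t K x) i)
      = M.meshIntegral (fun K x => consVar γ s₀ (vh 0 K x) i) := fun i t ht => by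
    obtain ⟨hc, hd⟩ := hdiff (fun v => consVar γ s₀ v i)
      ((contDiffOn_pi.1 (contDiffOn_consVar hγ s₀) i).of_le (by simp))
    have h0 : ∀ r ∈ Ioo 0 tf, M.meshIntegral
        (fun K x => deriv (fun t => consVar γ s₀ (vh t K x) i) r) = 0 := fun r hr => by
      -- Constants lie in both test spaces: their gradient vanishes, and the face term vanishes by
      -- the conservation equation.
      have e1 := hsol.euler r hr _ (M.memV_const k (Pi.single i 1))
      have e2 := hsol.conservation r hr _ (M.memM_const k EE (Pi.single i 1))
      rw [e2] at e1
      simpa [Pi.single_apply, meshIntegral] using e1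
    have hdw : DifferentiableOn ℝ (fun t => M.meshIntegral fun K x => consVar γ s₀ (vh t K x) i)
        (interior (Icc 0 tf)) := by
      rw [interior_Icc]
      exact fun r hr => (hd r hr).differentiableAt.differentiableWithinAt
    have hd0 : ∀ r ∈ interior (Icc 0 tf),
        deriv (fun t => M.meshIntegral fun K x => consVar γ s₀ (vh t K x) i) r = 0 := by
      rw [interior_Icc]
      exact fun r hr => (hd r hr).deriv.trans (h0 r hr)
    have h00 : (0 : ℝ) ∈ Icc 0 tf := left_mem_Icc.2 htf.le
    exact le_antisymm
      (antitoneOn_of_deriv_nonpos (convex_Icc 0 tf) hc hdw (fun r hr => (hd0 r hr).le) h00 ht ht.1)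
      (monotoneOn_of_deriv_nonneg (convex_Icc 0 tf) hc hdw (fun r hr => (hd0 r hr).ge) h00 ht ht.1)
  -- Conservation of the mean lets the lower bound at time `t` be expressed through the initial mean
  -- state.
  have huS : ∀ t ∈ Icc 0 tf, M.uStar γ s₀ (vh t) = M.uStar γ s₀ (vh 0) := fun t ht =>
    funext fun i => by rw [uStar, uStar, hcons i t ht]
  have h00 : (0 : ℝ) ∈ Icc 0 tf := left_mem_Icc.2 htf.le
  refine ⟨fun t ht K => ⟨?_, ?_⟩, fun t ht => (hHd t ht).differentiableAt, fun t ht => ?_,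
    M.uStar_mem_physStates hγ (hsol.mem_V 0 h00) (hel 0 h00), fun t ht => ?_, fun t ht => ?_⟩
  · exact Integrable.of_eval fun i => M.integrableOn_consVar hγ (hsol.mem_V t ht) (hel t ht) K i
  · exact M.integrableOn_elem (hsol.mem_V t ht) (hel t ht)
      (h := fun v => entropy γ s₀ (consVar γ s₀ v)) (contDiffOn_entropy_consVar hγ s₀).continuousOn K
  · exact (hHd t ht).deriv.trans_le (hI0 t ht)
  · rw [← huS t ht]
    exact M.meshIntegral_entropy_uStar_le hγ (hsol.mem_V t ht) (hel t ht)
  · refine antitoneOn_of_deriv_nonpos (convex_Icc 0 tf) hHc ?_ ?_ h00 ht ht.1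
    · rw [interior_Icc]
      exact fun t ht => (hHd t ht).differentiableAt.differentiableWithinAt
    · rw [interior_Icc]
      exact fun t ht => (hHd t ht).deriv.trans_le (hI0 t ht)

end PeriodicMesh

end

end EulerHDG

end

open EulerHDG in
theorem mainTheorem5 {d p k : ℕ} (hd : 1 ≤ d) (hd3 : d ≤ 3) {γ s₀ tf : ℝ} (hγ : 1 < γ)
    (htf : 0 < tf) {Elem Face : Type*} [Fintype Elem] [Fintype Face]
    (M : PeriodicMesh d p Elem Face) (EE : Set Face) (u₀ : Space d → State d)
    (vh : ℝ → Elem → Space d → State d) (vhat : ℝ → Face → Space d → State d)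
    (hphys : M.IsPhysical γ s₀ tf vh vhat) :
    (M.IsSolution k EE γ s₀ tf (sigmaMV γ s₀) u₀ vh vhat →
      M.IsEntropyStable γ s₀ tf vh) ∧
    (∀ vstar : State d → State d → Space d → State d, VStarCondition γ s₀ vstar →
      M.IsSolution k EE γ s₀ tf (sigmaS γ s₀ vstar) u₀ vh vhat →
      M.IsEntropyStable γ s₀ tf vh) ∧
    (∀ vstar : State d → State d → Space d → State d, VStarCondition γ s₀ vstar →
      M.IsSolution k EE γ s₀ tf (sigmaSLF γ s₀ vstar) u₀ vh vhat →
      M.IsEntropyStable γ s₀ tf vh) := by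
  -- With `d = n + 1` the face dimension `d - 1` reduces to `n`.
  obtain ⟨n, rfl⟩ : ∃ n, d = n + 1 := ⟨d - 1, by omega⟩
  exact ⟨fun h => h.isEntropyStable M hd3 hγ htf (isDissipative_sigmaMV hγ s₀) hphys,
    fun _ hs h => h.isEntropyStable M hd3 hγ htf (isDissipative_sigmaS hγ hs) hphys,
    fun _ hs h => h.isEntropyStable M hd3 hγ htf (isDissipative_sigmaSLF hγ hs) hphys⟩
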